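/- **Theorem (Solution relationship, frictional case).** *Setting.* Let $f_{\mathrm v}:\mathbb R^{n_q}\times\mathbb R^{n_q}\times\mathbb R^{n_u}\to\mathbb R^{n_q}$, $M:\mathbb R^{n_q}\to\mathbb R^{n_q\times n_q}$ and $b:\mathbb R^{n_q}\to\mathbb R^{n_q}$ be $C^2$, let $f_c:\mathbb R^{n_q}\to\mathbb R$ be such that $f_c$ and $n:=\nabla f_c$ are $C^2$, let $M(q)$ be symmetric positive definite, and let $\mu>0$, $a_{\mathrm n}>0$. At every contact point ($f_c(q)=0$) assume $n(q)\neq0$, $b(q)\ne 0$ and $b(q)^\top M(q)^{-1}n(q)=0$. Write $x=(q,v)$, $v_{\mathrm t}=b(q)^\top v$, and $$D=n^\top M^{-1}n,\quad \varphi(x,u)=n^\top f_{\mathrm v}(q,v,u)+\nabla_q(n^\top v)^\top v,\quad \tilde D=[n\ b]^\top M^{-1}[n\ b],\quad \tilde\varphi(x,u)=[n\ b]^\top f_{\mathrm v}(q,v,u)+\nabla_q([n\ b]^\top v)^\top v .$$ *The complementarity Lagrangian system (CLS).* A solution on $[0,t_{\mathrm f}]$ with control $u(t)$ and initial value $(q_0,v_0)$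 consists of a trajectory $x=(q,v)$ and a contact force $\lambda=(\lambda_{\mathrm n},\lambda_{\mathrm t})$ that is an integrable function of $t$ plus Dirac impulses at a finite set of impact times, with $$\dot q=v,\qquad \dot v=f_{\mathrm v}(q,v,u)+M(q)^{-1}(n(q)\lambda_{\mathrm n}+b(q)\lambda_{\mathrm t}),\qquad 0\le\lambda_{\mathrm n}\perp f_c(q)\ge0,$$ $$\lambda_{\mathrm t}\in\arg\min\{\,v_{\mathrm t}\,\tilde\lambda_{\mathrm t} : |\tilde\lambda_{\mathrm t}|\le\mu\lambda_{\mathrm n}\}$$ (the equations holding in integrated form, the conditions on the force for almost every $t$). The impact times are exactly the $t_{\mathrm s}$ with $f_c(q(t_{\mathrm s}))=0$ and $n(q(t_{\mathrm s}))^\top v(t_{\mathrm s}^-)<0$ (where $v(0^-)=v_0$). At such a time $n(q(t_{\mathrm s}))^\top v(t_{\mathrm s}^+)=0$, the normal impulse is nonnegative, and the impulses satisfy the friction law with $v_{\mathrm t}(t_{\mathrm s}^+)$. *The time-freezing system.* Let $y=(q,v,t)$, $c_1=f_c(q)$, $c_2=n(q)^\top v$, $c_3=b(q)^\top v$, and let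 $R_1=\{c_1>0\}\cup\{c_1<0,c_2>0\}$, $R_2=\{c_1<0,c_2<0,c_3>0\}$, $R_3=\{c_1<0,c_2<0,c_3<0\}$, with $$f_1=(v,f_{\mathrm v}(q,v,u),1),\qquad f_{2}=(0,M^{-1}(n-\mu b)a_{\mathrm n},0),\qquad f_3=(0,M^{-1}(n+\mu b)a_{\mathrm n},0).$$ A solution is an absolutely continuous $y$ with $y'(\tau)\in\{\sum_i\theta_if_i : \theta_i\ge0,\ \sum_i\theta_i=1,\ \theta_i=0\text{ if }y(\tau)\notin\overline{R_i}\}$ for almost every $\tau$. Let $\Sigma=\{c_1=0,\ c_2=0\}$. *Hypotheses.* Let $f_c(q_0)\ge0$ and let $y$ solve the time-freezing system on $[0,\tau_{\mathrm f}]$, $\tau_{\mathrm f}>0$, with some control $\tilde u(\tau)$ and $y(0)=(q_0,v_0,0)$. Put $t_{\mathrm f}=t(\tau_{\mathrm f})$ and let $u$ be a measurable control, bounded on $[0,t_{\mathrm f}]$, with $\tilde u(\tau)=u(t(\tau))$ for almost every $\tau$ with $t'(\tau)>0$. Assume that $f_c(q)\ge0$ and $n(q)^\top v\ge0$ at $y(\tau_{\mathrm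 f})$, and that there is at most one physical time $t_{\mathrm s}=t(\tau)$ at which $f_c(q(\tau))=0$ and $n(q(\tau))^\top v(\tau)<0$. *Conclusion.* The CLS with control $u$ and initial value $(q_0,v_0)$ has a solution on $[0,t_{\mathrm f}]$ that is related to $y$ by the statements below. If moreover $\{\tau\in[0,\tau_{\mathrm f}] : f_c(q(\tau))=0\}$ is a finite union of compact intervals (possibly points), that is, if contact and free flight alternate only finitely often, then every solution of the CLS on $[0,t_{\mathrm f}]$ with this control and initial value is related to $y$ by them. 0. The CLS has the same impact time $t_{\mathrm s}$ as $y$, if there is one, and no other. 1. For every $\tau$ with $t(\tau)\ne t_{\mathrm s}$ we have $x(t(\tau))=Ry(\tau)=(q(\tau),v(\tau))$. For almost every $t=t(\tau)\neq t_{\mathrm s}$, $$\lambda(t(\tau))=\begin{cases}-D(q)^{-1}\varphi(x,u)\,(1,-\mu\,\mathrm{sign}(v_{\mathrm t})), & y(\tau)\in\Sigma,\ v_{\mathrm t}\ne0,\\ -\tilde D(q)^{-1}\tilde\varphi(x,u), & y(\tau)\in\Sigma,\ v_{\mathrm t}=0,\\ 0,&\text{otherwise.}\end{cases}$$ 2.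 If there is an impact time $t_{\mathrm s}$, there are $\tau_{\mathrm s}<\tau_{\mathrm r}\le\tau_{\mathrm f}$ such that $f_c(q)=0$ and $n^\top v<0$ hold along $y$ exactly on $[\tau_{\mathrm s},\tau_{\mathrm r})$, $t(\tau)=t_{\mathrm s}$ on $[\tau_{\mathrm s},\tau_{\mathrm r}]$, and $f_c(q)=0=n^\top v$ at $\tau_{\mathrm r}$; and $$\lim_{\epsilon\downarrow0}\int_{t_{\mathrm s}-\epsilon}^{t_{\mathrm s}+\epsilon}\lambda_{\mathrm n}\,dt=\int_{\tau_{\mathrm s}}^{\tau_{\mathrm r}}a_{\mathrm n}\,d\tau,\qquad \lim_{\epsilon\downarrow0}\int_{t_{\mathrm s}-\epsilon}^{t_{\mathrm s}+\epsilon}|\lambda_{\mathrm t}|\,dt=\int_{\tau_{\mathrm s}}^{\tau_{\mathrm r}}\mu a_{\mathrm n}\,|\mathrm{sign}(v_{\mathrm t}(\tau))|\,d\tau$$ (integrals over the part of $[t_{\mathrm s}-\epsilon,t_{\mathrm s}+\epsilon]$ in $[0,t_{\mathrm f}]$, Dirac impulses included). In particular, if the contact slips during the whole impact, i.e. $v_{\mathrm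 t}(\tau)\ne0$ on $[\tau_{\mathrm s},\tau_{\mathrm r})$, the second limit is $\int_{\tau_{\mathrm s}}^{\tau_{\mathrm r}}\mu a_{\mathrm n}\,d\tau$. -/

import Mathlib

open MeasureTheory Filter Topology Set

noncomputable section

/-! ### Piecewise smooth systems and their Filippov extension -/

/-- The Filippov set of the piecewise smooth system `y' = f i y u` on the region `R i`: all convex
combinations of the fields whose region has `y` in its closure. -/
def FilippovSet {ι Y U : Type*} [Fintype ι] [TopologicalSpace Y] [AddCommGroup Y] [Module ℝ Y]
    (R : ι → Set Y) (f : ι → Y → U → Y) (y : Y) (u : U) : Set Y :=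
  {w | ∃ θ : ι → ℝ, (∑ i, θ i = 1) ∧ (∀ i, 0 ≤ θ i) ∧ (∀ i, y ∉ closure (R i) → θ i = 0) ∧
    w = ∑ i, θ i • f i y u}

/-- Caratheodory solutions of the Filippov inclusion on `[0, T]` for a given control function:
absolutely continuous curves whose derivative lies in the Filippov set almost everywhere. -/
structure IsFilippovSolution {ι Y U : Type*} [Fintype ι] [NormedAddCommGroup Y] [NormedSpace ℝ Y]
    (R : ι → Set Y) (f : ι → Y → U → Y) (u : ℝ → U) (T : ℝ) (y : ℝ → Y) : Prop where
  absCont : AbsolutelyContinuousOnInterval y 0 T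
  inclusion : ∀ᵐ s ∂volume, s ∈ Icc 0 T → ∃ w ∈ FilippovSet R f (y s) (u s), HasDerivAt y w s

/-! ### Planar complementarity Lagrangian systems with Coulomb friction -/

/-- Data of a complementarity Lagrangian system with one unilateral constraint `fc q ≥ 0`, planar
Coulomb friction (one tangential direction `b q`) and `m` controls, with the standing assumptions on
these data. -/
structure PlanarCLS (n m : ℕ) where
  /-- total acceleration without contact forces -/
  fv : EuclideanSpace ℝ (Fin n) → EuclideanSpace ℝ (Fin n) → EuclideanSpace ℝ (Fin m) →
    EuclideanSpace ℝ (Fin n)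
  /-- inertia matrix -/
  M : EuclideanSpace ℝ (Fin n) → Matrix (Fin n) (Fin n) ℝ
  /-- signed distance (gap) function -/
  fc : EuclideanSpace ℝ (Fin n) → ℝ
  /-- tangential contact direction -/
  b : EuclideanSpace ℝ (Fin n) → EuclideanSpace ℝ (Fin n)
  /-- friction coefficient -/
  μ : ℝ
  μ_pos : 0 < μ
  fv_smooth : ContDiff ℝ 2 (fun p : EuclideanSpace ℝ (Fin n) × EuclideanSpace ℝ (Fin n) ×
    EuclideanSpace ℝ (Fin m) => fv p.1 p.2.1 p.2.2)
  M_smooth : ∀ i j, ContDiff ℝ 2 (fun q => M q i j)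
  M_posDef : ∀ q, (M q).PosDef
  /-- equivalently, `fc` and its gradient, hence all switching functions, are twice continuously
  differentiable -/
  fc_smooth : ContDiff ℝ 3 fc
  b_smooth : ContDiff ℝ 2 b
  normal_ne_zero : ∀ q, fc q = 0 → gradient fc q ≠ 0
  b_ne_zero : ∀ q, fc q = 0 → b q ≠ 0
  /-- orthogonality of tangent and normal in the kinetic metric, at contact points -/
  orthogonal : ∀ q, fc q = 0 → inner ℝ (b q) (Matrix.toEuclideanLin (M q)⁻¹ (gradient fc q)) = 0

namespace PlanarCLS

variable {n m : ℕ} (S : PlanarCLS n m)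

/-- The contact normal `n(q) = ∇ fc(q)`. -/
def normal (q : EuclideanSpace ℝ (Fin n)) : EuclideanSpace ℝ (Fin n) := gradient S.fc q

/-- `M(q)⁻¹ w`. -/
def invM (q w : EuclideanSpace ℝ (Fin n)) : EuclideanSpace ℝ (Fin n) :=
  Matrix.toEuclideanLin (S.M q)⁻¹ w

/-- Normal velocity `n(q)ᵀ v`. -/
def vn (q v : EuclideanSpace ℝ (Fin n)) : ℝ := inner ℝ (S.normal q) v

/-- Tangential velocity `b(q)ᵀ v`. -/
def vt (q v : EuclideanSpace ℝ (Fin n)) : ℝ := inner ℝ (S.b q) v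

/-- The columns of the matrix `[n(q) b(q)]`. -/
def col (i : Fin 2) (q : EuclideanSpace ℝ (Fin n)) : EuclideanSpace ℝ (Fin n) :=
  ![S.normal q, S.b q] i

/-- `M(q)⁻¹ (n(q) l₀ + b(q) l₁)`, the acceleration (or velocity jump) caused by the contact force
(or impulse) `l`, with normal component `l 0` and tangential component `l 1`. -/
def contactAcc (q : EuclideanSpace ℝ (Fin n)) (l : Fin 2 → ℝ) : EuclideanSpace ℝ (Fin n) :=
  S.invM q (l 0 • S.normal q + l 1 • S.b q)

/-- `D̃(q) = [n b]ᵀ M(q)⁻¹ [n b]`. -/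
def Dtilde (q : EuclideanSpace ℝ (Fin n)) : Matrix (Fin 2) (Fin 2) ℝ :=
  Matrix.of fun i j => inner ℝ (S.col i q) (S.invM q (S.col j q))

/-- `φ̃(x,u) = [n b]ᵀ f_v(q,v,u) + ∇_q([n b]ᵀ v)ᵀ v`. -/
def phitilde (q v : EuclideanSpace ℝ (Fin n)) (u : EuclideanSpace ℝ (Fin m)) : Fin 2 → ℝ :=
  fun i => inner ℝ (S.col i q) (S.fv q v u) +
    inner ℝ (gradient (fun p => inner ℝ (S.col i p) v) q) v

/-- `D(q) = n(q)ᵀ M(q)⁻¹ n(q)`. -/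
def D (q : EuclideanSpace ℝ (Fin n)) : ℝ := inner ℝ (S.normal q) (S.invM q (S.normal q))

/-- `φ(x,u) = n(q)ᵀ f_v(q,v,u) + ∇_q(n(q)ᵀ v)ᵀ v`. -/
def phi (q v : EuclideanSpace ℝ (Fin n)) (u : EuclideanSpace ℝ (Fin m)) : ℝ :=
  inner ℝ (S.normal q) (S.fv q v u) + inner ℝ (gradient (fun p => inner ℝ (S.normal p) v) q) v

/-- Slip force `-D(q)⁻¹ φ(x,u) (1, -μ sign(v_t))`. -/
def slipForce (q v : EuclideanSpace ℝ (Fin n)) (u : EuclideanSpace ℝ (Fin m)) : Fin 2 → ℝ :=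
  (-((S.D q)⁻¹ * S.phi q v u)) • ![1, -(S.μ * Real.sign (S.vt q v))]

/-- Stick force `-D̃(q)⁻¹ φ̃(x,u)`. -/
def stickForce (q v : EuclideanSpace ℝ (Fin n)) (u : EuclideanSpace ℝ (Fin m)) : Fin 2 → ℝ :=
  -((S.Dtilde q)⁻¹.mulVec (S.phitilde q v u))

open Classical in
/-- The slip formula on `Σ = {fc(q) = 0, n(q)ᵀ v = 0}` if `v_t ≠ 0`, the stick formula on `Σ` if
`v_t = 0`, and zero off `Σ`. -/
def modeForce (q v : EuclideanSpace ℝ (Fin n)) (u : EuclideanSpace ℝ (Fin m)) : Fin 2 → ℝ :=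
  if S.fc q = 0 ∧ S.vn q v = 0 then
    if S.vt q v ≠ 0 then S.slipForce q v u else S.stickForce q v u
  else 0

/-- Maximum dissipation principle: among all `s` with `|s| ≤ μ * lamN`, the tangential force (or
impulse) `lamT` minimises the power `vT * s`. -/
def MaxDissipation (lamN vT lamT : ℝ) : Prop :=
  lamT ∈ {s : ℝ | |s| ≤ S.μ * lamN} ∧
    IsMinOn (fun s => vT * s) {s : ℝ | |s| ≤ S.μ * lamN} lamT

end PlanarCLS

/-- A trajectory of a planar complementarity system with finitely many impacts. The contact force is
the vector measure `lam(t) dt + ∑_{t ∈ J} P(t) δ_t`; component `0` is normal and component `1` is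
tangential. At an impact time `v` is the post-impact velocity. -/
structure CLSTrajectory (n : ℕ) where
  q : ℝ → EuclideanSpace ℝ (Fin n)
  v : ℝ → EuclideanSpace ℝ (Fin n)
  /-- regular part (density) of the contact force -/
  lam : ℝ → Fin 2 → ℝ
  /-- impact times -/
  J : Finset ℝ
  /-- contact impulses at the impact times -/
  P : ℝ → Fin 2 → ℝ

namespace CLSTrajectory

variable {n : ℕ}

/-- The left limit `v(t⁻)`, with the convention `v(0⁻) = v₀` at the initial time. -/
def leftVel (x : CLSTrajectory n) (v₀ : EuclideanSpace ℝ (Fin n)) (t : ℝ) :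
    EuclideanSpace ℝ (Fin n) :=
  if t ≤ 0 then v₀ else Function.leftLim x.v t

/-- The integral over `[α, β] ∩ [0, T]` of component `i` of the contact force. -/
def forceIntegral (x : CLSTrajectory n) (T : ℝ) (i : Fin 2) (α β : ℝ) : ℝ :=
  (∫ s in Icc α β ∩ Icc 0 T, x.lam s i) + ∑ s ∈ x.J.filter (fun s => s ∈ Icc α β), x.P s i

/-- The integral over `[α, β] ∩ [0, T]` of the absolute value (total variation measure) of component
`i` of the contact force. -/
def absForceIntegral (x : CLSTrajectory n) (T : ℝ) (i : Fin 2) (α β : ℝ) : ℝ :=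
  (∫ s in Icc α β ∩ Icc 0 T, |x.lam s i|) + ∑ s ∈ x.J.filter (fun s => s ∈ Icc α β), |x.P s i|

end CLSTrajectory

/-- `x` solves the frictional complementarity system with inelastic impacts on `[0, T]` with control
`u` and initial value `(q₀, v₀)`. -/
structure IsCLSSolution {n m : ℕ} (S : PlanarCLS n m) (u : ℝ → EuclideanSpace ℝ (Fin m)) (T : ℝ)
    (q₀ v₀ : EuclideanSpace ℝ (Fin n)) (x : CLSTrajectory n) : Prop where
  lam_integrable : IntegrableOn x.lam (Icc 0 T)
  fv_integrable : IntegrableOn (fun s => S.fv (x.q s) (x.v s) (u s)) (Icc 0 T)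
  /-- `q̇ = v` -/
  position : ∀ t ∈ Icc 0 T, x.q t = q₀ + ∫ s in (0 : ℝ)..t, x.v s
  /-- `v̇ = f_v + M⁻¹ (n λ_n + b λ_t)`, including the velocity jumps at the impact times -/
  velocity : ∀ t ∈ Icc 0 T, x.v t = v₀ +
    (∫ s in (0 : ℝ)..t, (S.fv (x.q s) (x.v s) (u s) + S.contactAcc (x.q s) (x.lam s))) +
    ∑ s ∈ x.J.filter (fun s => s ≤ t), S.contactAcc (x.q s) (x.P s)
  gap_nonneg : ∀ t ∈ Icc 0 T, 0 ≤ S.fc (x.q t)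
  complementarity : ∀ᵐ t ∂volume, t ∈ Icc 0 T →
    0 ≤ x.lam t 0 ∧ x.lam t 0 * S.fc (x.q t) = 0
  friction : ∀ᵐ t ∂volume, t ∈ Icc 0 T →
    S.MaxDissipation (x.lam t 0) (S.vt (x.q t) (x.v t)) (x.lam t 1)
  /-- impacts occur exactly when contact is made with negative normal velocity -/
  mem_J : ∀ t, t ∈ x.J ↔ t ∈ Icc 0 T ∧ S.fc (x.q t) = 0 ∧ S.vn (x.q t) (x.leftVel v₀ t) < 0
  /-- inelastic impact law -/
  impact_normal : ∀ t ∈ x.J, S.vn (x.q t) (x.v t) = 0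
  impulse_nonneg : ∀ t ∈ x.J, 0 ≤ x.P t 0
  /-- maximum dissipation for the impulses, with the post-impact tangential velocity -/
  impact_friction : ∀ t ∈ x.J, S.MaxDissipation (x.P t 0) (S.vt (x.q t) (x.v t)) (x.P t 1)

/-! ### The time-freezing system -/

/-- The extended state `y = (q, v, t)`. -/
abbrev TFState (n : ℕ) : Type := EuclideanSpace ℝ (Fin n) × EuclideanSpace ℝ (Fin n) × ℝ

namespace PlanarCLS

variable {n m : ℕ} (S : PlanarCLS n m)

/-- Switching function `c₁(y) = fc(q)`. -/
def c1 (y : TFState n) : ℝ := S.fc y.1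

/-- Switching function `c₂(y) = n(q)ᵀ v`. -/
def c2 (y : TFState n) : ℝ := S.vn y.1 y.2.1

/-- Switching function `c₃(y) = b(q)ᵀ v`. -/
def c3 (y : TFState n) : ℝ := S.vt y.1 y.2.1

/-- The three regions of the time-freezing system. -/
def region : Fin 3 → Set (TFState n) :=
  ![{y | 0 < S.c1 y} ∪ {y | S.c1 y < 0 ∧ 0 < S.c2 y},
    {y | S.c1 y < 0 ∧ S.c2 y < 0} ∩ {y | 0 < S.c3 y},
    {y | S.c1 y < 0 ∧ S.c2 y < 0} ∩ {y | S.c3 y < 0}]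

/-- Normal auxiliary dynamics. -/
def fAuxN (aN : ℝ) (y : TFState n) : TFState n := (0, S.invM y.1 (aN • S.normal y.1), 0)

/-- Tangential auxiliary dynamics for negative tangential velocity. -/
def fAuxTminus (aT : ℝ) (y : TFState n) : TFState n := (0, S.invM y.1 (aT • S.b y.1), 0)

/-- Tangential auxiliary dynamics for positive tangential velocity. -/
def fAuxTplus (aT : ℝ) (y : TFState n) : TFState n := -S.fAuxTminus aT y

/-- The three vector fields of the time-freezing system, with `a_t = μ a_n`. -/
def tfField (aN : ℝ) : Fin 3 → TFState n → EuclideanSpace ℝ (Fin m) → TFState n :=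
  ![fun y u => (y.2.1, S.fv y.1 y.2.1 u, 1),
    fun y _ => S.fAuxN aN y + S.fAuxTplus (S.μ * aN) y,
    fun y _ => S.fAuxN aN y + S.fAuxTminus (S.μ * aN) y]

/-- `y` solves the time-freezing system on `[0, τf]` with control `u`. -/
def IsTFSolution (aN : ℝ) (u : ℝ → EuclideanSpace ℝ (Fin m)) (τf : ℝ) (y : ℝ → TFState n) : Prop :=
  IsFilippovSolution S.region (S.tfField aN) u τf y

/-- The numerical times in `[0, τf]` at which `fc(q) = 0` and `n(q)ᵀ v < 0`. -/
def impactSet (τf : ℝ) (y : ℝ → TFState n) : Set ℝ :=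
  {τ | τ ∈ Icc 0 τf ∧ S.fc (y τ).1 = 0 ∧ S.vn (y τ).1 (y τ).2.1 < 0}

/-- The contact set `{τ ∈ [0, τf] | fc(q(τ)) = 0}` is a finite union of compact intervals
(possibly points), i.e. there are finitely many switches between contact and free flight. -/
def FinitelyManyContactPhases (τf : ℝ) (y : ℝ → TFState n) : Prop :=
  ∃ F : Finset (ℝ × ℝ), {τ | τ ∈ Icc 0 τf ∧ S.fc (y τ).1 = 0} = ⋃ p ∈ F, Icc p.1 p.2

/-- The relation between a time-freezing trajectory `y` and a trajectory `x` of the complementarity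
system with control `u` (a function of physical time). -/
structure SolutionsRelated (aN : ℝ) (u : ℝ → EuclideanSpace ℝ (Fin m)) (τf : ℝ) (y : ℝ → TFState n)
    (x : CLSTrajectory n) : Prop where
  /-- the impact times `t_s` of `x` are the physical times at which `y` has an impact phase -/
  impact_times : (x.J : Set ℝ) = (fun τ => (y τ).2.2) '' S.impactSet τf y
  /-- `x(t(τ)) = R y(τ)` for `t(τ) ≠ t_s` -/
  state : ∀ τ ∈ Icc 0 τf, (y τ).2.2 ∉ x.J →
    (x.q (y τ).2.2, x.v (y τ).2.2) = ((y τ).1, (y τ).2.1)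
  /-- the slip and stick formulas for the contact force, for almost every physical time -/
  force : ∀ᵐ t ∂volume, ∀ τ ∈ Icc 0 τf, (y τ).2.2 = t → t ∉ x.J →
    x.lam t = S.modeForce (y τ).1 (y τ).2.1 (u t)
  /-- the impulses at an impact time `t_s`; `[τs, τr]` is the virtual time interval of the jump -/
  impulse : ∀ ts ∈ x.J, ∃ τs τr : ℝ, τs < τr ∧ τr ≤ τf ∧ S.impactSet τf y = Ico τs τr ∧
    (∀ τ ∈ Icc τs τr, (y τ).2.2 = ts) ∧
    S.fc (y τr).1 = 0 ∧ S.vn (y τr).1 (y τr).2.1 = 0 ∧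
    Tendsto (fun ε => x.forceIntegral (y τf).2.2 0 (ts - ε) (ts + ε)) (𝓝[>] 0)
      (𝓝 (∫ _τ in τs..τr, aN)) ∧
    Tendsto (fun ε => x.absForceIntegral (y τf).2.2 1 (ts - ε) (ts + ε)) (𝓝[>] 0)
      (𝓝 (∫ τ in τs..τr, S.μ * aN * |Real.sign (S.vt (y τ).1 (y τ).2.1)|)) ∧
    ((∀ τ ∈ Ico τs τr, S.vt (y τ).1 (y τ).2.1 ≠ 0) →
      Tendsto (fun ε => x.absForceIntegral (y τf).2.2 1 (ts - ε) (ts + ε)) (𝓝[>] 0)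
        (𝓝 (∫ _τ in τs..τr, S.μ * aN)))

end PlanarCLS

end

noncomputable section

/-! ### Absolutely continuous curves -/

/-! A time-freezing solution is a mechanical motion run with a clock of variable speed. Every
Filippov velocity is free motion at speed `θ` plus a contact force with normal part `(1 - θ) aN` and
a tangential part obeying Coulomb's law (`filippovSet_form`). The gap never becomes negative, so at
an interior contact time it has a minimum, whence `θ * c2 = 0` almost everywhere in contact. If `θ =
0`, the clock and the position stand still and only an impulse acts. If `c2 = 0`, then `c2' = 0`
too, because a derivative vanishes almost everywhere on the zero set of its function; this balance
forces `θ > 0` and turns the auxiliary force, divided by `θ`, into the slip or stick formula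
(`IsTFSolution.ae_cases`).

Existence: the clock is monotone and 1-Lipschitz, and injective except on one interval `[a, b]`, the
impact (`exists_impactPhase`). Inverting it by `lastTime` gives the candidate `unfreeze`. A change
of variables turns the dynamics outside `[a, b]` into the integrated equations of motion, and the
velocity change over `[a, b]` becomes the Dirac impulse (`velocity_jump`). In that interval the
tangential velocity obeys dry friction: its modulus decreases at a constant rate until it sticks at
zero (`dry_friction`). This yields both Coulomb's law with the post-impact velocity and the formula
for the total tangential impulse.

Uniqueness: finitely many contact phases mean that `unfreeze` is, right of every time, either in
contact or in free flight for a while. If it flies, a contact force on a competing motion pushes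
that motion further from the constraint faster than the deviation can act back, so the competitor
flies as well (`fc_le_of_free`, `eq_of_free`). If it is in contact, a competitor that touches again
has zero normal velocity at both ends; the normal velocity then controls the difference of the
normal forces, monotonicity of Coulomb's law controls that of the tangential forces, and a
Gronwall-type absorption on a short interval gives equality (`eq_of_contact`). A competitor that
does not touch is in free flight, and the roles are exchanged. Impacts are unique by
`impact_unique`, and a continuation argument propagates agreement from the initial time
(`IsCLSPair.agree`). -/

theorem AbsolutelyContinuousOnInterval.of_dist_le {X Y : Type*} [PseudoMetricSpace X]
    [PseudoMetricSpace Y] {f : ℝ → X} {g : ℝ → Y} {a b K : ℝ}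
    (hg : AbsolutelyContinuousOnInterval g a b)
    (h : ∀ s ∈ uIcc a b, ∀ t ∈ uIcc a b, dist (f s) (f t) ≤ K * dist (g s) (g t)) :
    AbsolutelyContinuousOnInterval f a b := by
  rw [absolutelyContinuousOnInterval_iff] at hg ⊢
  intro ε hε
  -- `|K| + 1` dominates `K` and is positive for every real `K`.
  obtain ⟨δ, hδ, H⟩ := hg (ε / (|K| + 1)) (by positivity)
  refine ⟨δ, hδ, fun E hE hlt => ?_⟩
  have h1 := H E hE hlt
  calc _ ≤ ∑ i ∈ Finset.range E.1, (|K| + 1) * dist (g (E.2 i).1) (g (E.2 i).2) := by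
        refine Finset.sum_le_sum fun i hi => (h _ (hE.1 i hi).1 _ (hE.1 i hi).2).trans ?_
        gcongr
        linarith [le_abs_self K]
    _ = (|K| + 1) * ∑ i ∈ Finset.range E.1, dist (g (E.2 i).1) (g (E.2 i).2) := by
        rw [Finset.mul_sum]
    _ < (|K| + 1) * (ε / (|K| + 1)) := by gcongr
    _ = ε := by field_simp

/-- A `C¹` map is Lipschitz on the compact image of the curve. -/
theorem AbsolutelyContinuousOnInterval.comp_contDiff {E F : Type*} [NormedAddCommGroup E]
    [NormedSpace ℝ E] [NormedAddCommGroup F] [NormedSpace ℝ F] {g : E → F} {f : ℝ → E} {a b : ℝ}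
    (hf : AbsolutelyContinuousOnInterval f a b) (hg : ContDiff ℝ 1 g) :
    AbsolutelyContinuousOnInterval (fun t => g (f t)) a b := by
  have hc : IsCompact (f '' uIcc a b) := isCompact_uIcc.image_of_continuousOn hf.continuousOn
  obtain ⟨K, hK⟩ := (hg.locallyLipschitz.locallyLipschitzOn
    (s := f '' uIcc a b)).exists_lipschitzOnWith_of_compact hc
  exact hf.of_dist_le fun s hs t ht =>
    hK.dist_le_mul _ (mem_image_of_mem _ hs) _ (mem_image_of_mem _ ht)

theorem AbsolutelyContinuousOnInterval.prodMk {E F : Type*} [NormedAddCommGroup E]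
    [NormedAddCommGroup F] {f : ℝ → E} {g : ℝ → F} {a b : ℝ}
    (hf : AbsolutelyContinuousOnInterval f a b) (hg : AbsolutelyContinuousOnInterval g a b) :
    AbsolutelyContinuousOnInterval (fun t => (f t, g t)) a b := by
  have h := Tendsto.add hf hg
  simp only [add_zero] at h
  refine squeeze_zero (fun E => Finset.sum_nonneg fun _ _ => dist_nonneg) (fun E => ?_) h
  rw [← Finset.sum_add_distrib]
  exact Finset.sum_le_sum fun i _ => max_le_add_of_nonneg dist_nonneg dist_nonneg

/-- Increments of the primitive are dominated by those of the primitive of the norm, which is the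
scalar case. -/
theorem absolutelyContinuousOnInterval_integral {F : Type*} [NormedAddCommGroup F]
    [NormedSpace ℝ F] {f : ℝ → F} {a b : ℝ} (h : IntervalIntegrable f volume a b) :
    AbsolutelyContinuousOnInterval (fun x => ∫ t in a..x, f t) a b := by
  refine (h.norm.absolutelyContinuousOnInterval_intervalIntegral
    left_mem_uIcc).of_dist_le (K := 1) fun s hs t ht => ?_
  have hi : ∀ r ∈ uIcc a b, IntervalIntegrable f volume a r := fun r hr =>
    h.mono_set (uIcc_subset_uIcc left_mem_uIcc hr)
  rw [dist_eq_norm, dist_eq_norm, one_mul, intervalIntegral.integral_interval_sub_left (hi s hs)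
    (hi t ht), intervalIntegral.integral_interval_sub_left (hi s hs).norm (hi t ht).norm,
    Real.norm_eq_abs]
  exact intervalIntegral.norm_integral_le_abs_integral_norm

/-- The fundamental theorem of calculus for absolutely continuous curves. -/
theorem AbsolutelyContinuousOnInterval.integrable_and_integral_eq {F : Type*}
    [NormedAddCommGroup F] [NormedSpace ℝ F] [FiniteDimensional ℝ F] {f g : ℝ → F} {a b : ℝ}
    (hf : AbsolutelyContinuousOnInterval f a b)
    (hg : ∀ᵐ t, t ∈ uIcc a b → HasDerivAt f (g t) t) :
    IntervalIntegrable g volume a b ∧ ∫ t in a..b, g t = f b - f a := by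
  -- Coordinates in a basis reduce the claim to real-valued absolutely continuous functions.
  let B := Module.finBasis ℝ F
  let c := fun i => LinearMap.toContinuousLinearMap (B.coord i)
  have hc : ∀ i, AbsolutelyContinuousOnInterval (fun t => c i (f t)) a b := fun i =>
    hf.comp_contDiff (c i).contDiff
  have hsum : ∀ w : F, ∑ i, c i w • B i = w := fun w => B.sum_repr w
  have heq : ∀ᵐ t, t ∈ uIoc a b → ∑ i, deriv (fun s => c i (f s)) t • B i = g t := by
    filter_upwards [hg] with t ht hm
    rw [← hsum (g t)]
    refine Finset.sum_congr rfl fun i _ => ?_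
    have := ((c i).hasFDerivAt.comp_hasDerivAt t (ht (uIoc_subset_uIcc hm))).deriv
    rw [← this]
    rfl
  have hint : ∀ i, IntervalIntegrable (fun t => deriv (fun s => c i (f s)) t • B i) volume a b :=
    fun i => ⟨Integrable.smul_const (hc i).intervalIntegrable_deriv.1 _,
      Integrable.smul_const (hc i).intervalIntegrable_deriv.2 _⟩
  have hI : IntervalIntegrable (fun t => ∑ i, deriv (fun s => c i (f s)) t • B i) volume a b := by
    have := IntervalIntegrable.sum (μ := volume) (a := a) (b := b) Finset.univ
      (f := fun i t => deriv (fun s => c i (f s)) t • B i) fun i _ => hint i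
    simpa only [Finset.sum_fn] using this
  refine ⟨hI.congr_ae ((ae_restrict_iff' measurableSet_uIoc).2 heq), ?_⟩
  rw [← intervalIntegral.integral_congr_ae heq, intervalIntegral.integral_finsetSum
    fun i _ => hint i]
  simp_rw [intervalIntegral.integral_smul_const, (hc _).integral_deriv_eq_sub, sub_smul]
  rw [Finset.sum_sub_distrib, hsum, hsum]

theorem AbsolutelyContinuousOnInterval.sub_le_integral {f k : ℝ → ℝ} {a b : ℝ} (hab : a ≤ b)
    (hf : AbsolutelyContinuousOnInterval f a b) (hk : IntervalIntegrable k volume a b)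
    (h : ∀ᵐ t, t ∈ Icc a b → ∃ d, HasDerivAt f d t ∧ d ≤ k t) :
    f b - f a ≤ ∫ t in a..b, k t := by
  rw [← hf.integral_deriv_eq_sub]
  refine intervalIntegral.integral_mono_ae_restrict hab hf.intervalIntegrable_deriv hk
    ((ae_restrict_iff' measurableSet_Icc).2 ?_)
  filter_upwards [h] with t ht hm
  obtain ⟨d, hd, hle⟩ := ht hm
  rwa [hd.deriv]

theorem AbsolutelyContinuousOnInterval.monotoneOn {f : ℝ → ℝ} {a b : ℝ}
    (hf : AbsolutelyContinuousOnInterval f a b)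
    (h : ∀ᵐ t, t ∈ Icc a b → ∃ d, HasDerivAt f d t ∧ 0 ≤ d) : MonotoneOn f (Icc a b) := by
  intro s hs t ht hst
  have hsub : Icc s t ⊆ Icc a b := Icc_subset_Icc hs.1 ht.2
  have hab : a ≤ b := hs.1.trans hs.2
  have := (hf.neg.mono (by rwa [uIcc_of_le hab, uIcc_of_le hst])).sub_le_integral hst
    (k := fun _ => 0) intervalIntegrable_const (by
      filter_upwards [h] with r hr hm
      obtain ⟨d, hd, h0⟩ := hr (hsub hm)
      exact ⟨-d, hd.neg, by linarith⟩)
  simp at this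
  linarith

/-- The derivative of a function vanishes almost everywhere on its zero set. -/
theorem ae_hasDerivAt_eq_zero_of_eq_zero (f : ℝ → ℝ) :
    ∀ᵐ t, f t = 0 → ∀ d, HasDerivAt f d t → d = 0 := by
  -- Zeros isolated from the right are countable. At any other zero the difference quotient is `0`
  -- along zeros converging to it, so no regularity of `f` is needed.
  have hc := (countable_setOfPred_isolated_right_within (s := {t | f t = 0})).ae_notMem volume
  filter_upwards [hc] with t ht h0 d hd
  have hne : (𝓝[{t | f t = 0} ∩ Ioi t] t).NeBot := by
    rw [neBot_iff]
    exact fun h => ht ⟨h0, h⟩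
  have hs : 𝓝[{t | f t = 0} ∩ Ioi t] t ≤ 𝓝[≠] t :=
    nhdsWithin_mono _ fun s hs => ne_of_gt hs.2
  have h1 := (hasDerivAt_iff_tendsto_slope.1 hd).mono_left hs
  refine tendsto_nhds_unique h1 (tendsto_const_nhds.congr' ?_)
  filter_upwards [self_mem_nhdsWithin] with s hs
  have h2 : f s = 0 := hs.1
  simp [slope_def_field, h0, h2]

/-- Substitution `t = φ(τ)` for a monotone Lipschitz function `φ`. -/
theorem integral_comp_smul_of_monotoneOn_of_lipschitzOnWith {F : Type*} [NormedAddCommGroup F]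
    [NormedSpace ℝ F] {φ θ : ℝ → ℝ} {a b : ℝ} {K : NNReal} (hab : a ≤ b)
    (hm : MonotoneOn φ (Icc a b)) (hl : LipschitzOnWith K φ (Icc a b))
    (hθ : ∀ᵐ τ, τ ∈ Icc a b → HasDerivAt φ (θ τ) τ) (H : ℝ → F) :
    ∫ t in φ a..φ b, H t = ∫ τ in a..b, θ τ • H (φ τ) := by
  -- The change of variables formula wants a measurable set on which the derivative exists
  -- everywhere. Removing a null set costs nothing on either side, since its Lipschitz image is
  -- null.
  let N := toMeasurable volume {τ | ¬ (τ ∈ Icc a b → HasDerivAt φ (θ τ) τ)}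
  have hN : volume N = 0 := (measure_toMeasurable _).trans hθ
  let A := Icc a b \ N
  have hA : MeasurableSet A := measurableSet_Icc.diff (measurableSet_toMeasurable _ _)
  have hd : ∀ τ ∈ A, HasDerivWithinAt φ (θ τ) A τ := fun τ hτ => by
    have : ¬ ¬ (τ ∈ Icc a b → HasDerivAt φ (θ τ) τ) := fun h =>
      hτ.2 (subset_toMeasurable volume _ h)
    exact (not_not.1 this hτ.1).hasDerivWithinAt
  have himg : φ '' Icc a b = Icc (φ a) (φ b) := hl.continuousOn.image_Icc_of_monotoneOn hab hm
  have hnull : volume (φ '' (N ∩ Icc a b)) = 0 := by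
    have h1 := (hl.mono (inter_subset_right (s := N))).hausdorffMeasure_image_le
      (d := 1) zero_le_one
    rw [hausdorffMeasure_real] at h1
    refine le_antisymm (h1.trans ?_) zero_le
    rw [measure_mono_null inter_subset_left hN, mul_zero]
  have hAe : φ '' A =ᵐ[volume] Icc (φ a) (φ b) := by
    rw [← himg]
    refine (ae_eq_set).2 ⟨?_, measure_mono_null ?_ hnull⟩
    · rw [sdiff_eq_empty.2 (image_mono sdiff_subset), measure_empty]
    · rintro _ ⟨⟨τ, hτ, rfl⟩, hn⟩
      refine mem_image_of_mem _ ⟨?_, hτ⟩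
      by_contra h
      exact hn (mem_image_of_mem _ ⟨hτ, h⟩)
  have hAe' : A =ᵐ[volume] Icc a b := sdiff_null_ae_eq_self hN
  rw [intervalIntegral.integral_of_le (hm (left_mem_Icc.2 hab) (right_mem_Icc.2 hab) hab),
    intervalIntegral.integral_of_le hab, ← integral_Icc_eq_integral_Ioc,
    ← integral_Icc_eq_integral_Ioc, ← setIntegral_congr_set hAe, ← setIntegral_congr_set hAe']
  exact integral_image_eq_integral_deriv_smul_of_monotoneOn hA hd (hm.mono sdiff_subset) H

/-- Lipschitz images of null sets are null. -/
theorem LipschitzOnWith.ae_image {φ : ℝ → ℝ} {s : Set ℝ} {K : NNReal}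
    (hl : LipschitzOnWith K φ s) {p : ℝ → Prop} (hp : ∀ᵐ τ, τ ∈ s → p τ) :
    ∀ᵐ t, t ∈ φ '' s → ∃ τ ∈ s, φ τ = t ∧ p τ := by
  have hN : volume {τ | ¬ (τ ∈ s → p τ)} = 0 := hp
  have hsub : {τ | ¬ (τ ∈ s → p τ)} ⊆ s := fun τ hτ => (Classical.not_imp.1 hτ).1
  have h1 := (hl.mono hsub).hausdorffMeasure_image_le (d := 1) zero_le_one
  rw [hausdorffMeasure_real, hN, mul_zero] at h1
  refine measure_mono_null (fun t ht => ?_) (le_antisymm h1 zero_le)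
  obtain ⟨⟨τ, hτ, rfl⟩, h⟩ := Classical.not_imp.1 ht
  exact mem_image_of_mem _ fun h' => h ⟨τ, hτ, rfl, h' hτ⟩

/-- Derivative of the absolute value off the zero set. -/
theorem HasDerivAt.abs_of_ne_zero {f : ℝ → ℝ} {d t : ℝ} (h : HasDerivAt f d t) (h0 : f t ≠ 0) :
    HasDerivAt (fun s => |f s|) (Real.sign (f t) * d) t := by
  rcases h0.lt_or_gt with h1 | h1
  · rw [Real.sign_of_neg h1]
    refine (h.neg.congr_of_eventuallyEq ?_).congr_deriv (by ring)
    filter_upwards [h.continuousAt.eventually_lt_const h1] with s hs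
    simp [abs_of_neg hs]
  · rw [Real.sign_of_pos h1]
    refine (h.congr_of_eventuallyEq ?_).congr_deriv (by ring)
    filter_upwards [h.continuousAt.eventually_const_lt h1] with s hs
    simp [abs_of_pos hs]

theorem AbsolutelyContinuousOnInterval.abs {f : ℝ → ℝ} {a b : ℝ}
    (hf : AbsolutelyContinuousOnInterval f a b) :
    AbsolutelyContinuousOnInterval (fun t => |f t|) a b :=
  hf.of_dist_le (K := 1) fun s _ t _ => by
    simpa [Real.dist_eq] using abs_abs_sub_abs_le_abs_sub (f s) (f t)

/-- Almost everywhere derivative of the absolute value of an absolutely continuous function. -/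
theorem AbsolutelyContinuousOnInterval.ae_hasDerivAt_abs {f : ℝ → ℝ} {a b : ℝ}
    (hf : AbsolutelyContinuousOnInterval f a b) :
    ∀ᵐ t, t ∈ uIcc a b → ∀ d, HasDerivAt f d t →
      (f t = 0 → d = 0) ∧ HasDerivAt (fun s => |f s|) (Real.sign (f t) * d) t := by
  filter_upwards [hf.abs.ae_differentiableAt, ae_hasDerivAt_eq_zero_of_eq_zero f,
    ae_hasDerivAt_eq_zero_of_eq_zero (fun t => |f t|)] with t h1 h2 h3 hm d hd
  refine ⟨fun h => h2 h d hd, ?_⟩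
  by_cases h0 : f t = 0
  · have := (h1 hm).hasDerivAt
    rw [h3 (by simp [h0]) _ this] at this
    simpa [h0] using this
  · exact hd.abs_of_ne_zero h0

/-- Dry friction: if `f' = -k` where `f > 0`, and `f' = k` where `f < 0`, then `|f|` decreases
with rate `k` until `f` vanishes, and `f` does not change sign. -/
theorem AbsolutelyContinuousOnInterval.dry_friction {f : ℝ → ℝ} {a b k : ℝ} (hab : a ≤ b)
    (hf : AbsolutelyContinuousOnInterval f a b) (hk : 0 ≤ k)
    (h : ∀ᵐ t, t ∈ Icc a b → ∃ d, HasDerivAt f d t ∧ (0 < f t → d = -k) ∧ (f t < 0 → d = k)) :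
    |f b - f a| = ∫ t in a..b, k * |Real.sign (f t)| ∧ |f b - f a| ≤ k * (b - a) ∧
      (0 < f b → f b - f a = -(k * (b - a))) ∧ (f b < 0 → f b - f a = k * (b - a)) := by
  have huI : uIcc a b = Icc a b := uIcc_of_le hab
  -- On the zero set of `f`, where nothing is assumed about `f'`, the derivative of `|f|` is almost
  -- everywhere `0`, which agrees with `sign 0 = 0`.
  have hA : ∀ᵐ t, t ∈ Icc a b → HasDerivAt (fun s => |f s|) (-(k * |Real.sign (f t)|)) t := by
    filter_upwards [h, hf.ae_hasDerivAt_abs] with t h1 h2 hm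
    obtain ⟨d, hd, hp, hn⟩ := h1 hm
    convert (h2 (huI ▸ hm) d hd).2 using 1
    rcases lt_trichotomy (f t) 0 with h0 | h0 | h0
    · rw [Real.sign_of_neg h0, hn h0]; simp
    · simp [h0]
    · rw [Real.sign_of_pos h0, hp h0]; simp
  obtain ⟨hi, hI⟩ := hf.abs.integrable_and_integral_eq (huI.symm ▸ hA)
  rw [intervalIntegral.integral_neg] at hI
  have hanti : ∀ t ∈ Icc a b, |f b| ≤ |f t| := fun t ht => by
    have := hf.abs.neg.monotoneOn (by
      filter_upwards [hA] with t h1 hm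
      exact ⟨_, (h1 hm).neg, by rw [neg_neg]; positivity⟩) ht (right_mem_Icc.2 hab) ht.2
    simpa using this
  have hcont : ContinuousOn f (Icc a b) := huI ▸ hf.continuousOn
  -- As `|f|` is nonincreasing, `f` cannot leave zero once it is there; a nonzero final value
  -- therefore fixes the sign on the whole interval.
  have hsgn : ∀ t ∈ Icc a b, (0 < f b → 0 < f t) ∧ (f b < 0 → f t < 0) := by
    intro t ht
    have hsub : Icc t b ⊆ Icc a b := Icc_subset_Icc_left ht.1
    constructor <;> intro h0 <;> by_contra! hc
    · obtain ⟨r, hr, hr0⟩ := intermediate_value_Icc ht.2 (hcont.mono hsub) ⟨hc, h0.le⟩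
      have := hanti r (hsub hr)
      rw [hr0, abs_zero] at this
      exact h0.ne' (abs_nonpos_iff.1 this)
    · obtain ⟨r, hr, hr0⟩ := intermediate_value_Icc' ht.2 (hcont.mono hsub) ⟨h0.le, hc⟩
      have := hanti r (hsub hr)
      rw [hr0, abs_zero] at this
      exact h0.ne (abs_nonpos_iff.1 this)
  have ha := hsgn a (left_mem_Icc.2 hab)
  have h1 : |f b - f a| = |f a| - |f b| := by
    rcases lt_trichotomy (f b) 0 with h0 | h0 | h0
    · have := hanti a (left_mem_Icc.2 hab)
      rw [abs_of_neg h0, abs_of_neg (ha.2 h0)] at *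
      rw [abs_of_nonneg] <;> linarith
    · simp [h0]
    · have := hanti a (left_mem_Icc.2 hab)
      rw [abs_of_pos h0, abs_of_pos (ha.1 h0)] at *
      rw [abs_of_nonpos] <;> linarith
  have h2 : |f b - f a| = ∫ t in a..b, k * |Real.sign (f t)| := by linarith
  have hconst : (∀ t ∈ Icc a b, f t ≠ 0) → |f b - f a| = k * (b - a) := fun hne => by
    rw [h2, intervalIntegral.integral_congr (g := fun _ => k)]
    · simp [mul_comm]
    · intro t ht
      rcases (hne t (huI ▸ ht)).lt_or_gt with h0 | h0
      · simp [Real.sign_of_neg h0]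
      · simp [Real.sign_of_pos h0]
  refine ⟨h2, ?_, fun h0 => ?_, fun h0 => ?_⟩
  · have hle := hf.abs.neg.sub_le_integral hab (k := fun _ => k) intervalIntegrable_const (by
      filter_upwards [hA] with t h1 hm
      refine ⟨_, (h1 hm).neg, ?_⟩
      rw [neg_neg]
      have : |Real.sign (f t)| ≤ 1 := by
        rcases Real.sign_apply_eq (f t) with h | h | h <;> simp [h]
      nlinarith)
    simp at hle
    linarith
  · have h3 := hconst fun t ht => ((hsgn t ht).1 h0).ne'
    have := hanti a (left_mem_Icc.2 hab)
    rw [abs_of_pos h0, abs_of_pos (ha.1 h0)] at *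
    linarith
  · have h3 := hconst fun t ht => ((hsgn t ht).2 h0).ne
    have := hanti a (left_mem_Icc.2 hab)
    rw [abs_of_neg h0, abs_of_neg (ha.2 h0)] at *
    linarith

/-! ### Algebra and calculus of planar complementarity systems -/

namespace PlanarCLS

variable {n m : ℕ} (S : PlanarCLS n m)

/-- `b(q)ᵀ M(q)⁻¹ b(q)`. -/
def Dtan (q : EuclideanSpace ℝ (Fin n)) : ℝ := inner ℝ (S.b q) (S.invM q (S.b q))

theorem invM_add (q w w' : EuclideanSpace ℝ (Fin n)) :
    S.invM q (w + w') = S.invM q w + S.invM q w' := map_add _ _ _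

theorem invM_smul (q : EuclideanSpace ℝ (Fin n)) (c : ℝ) (w : EuclideanSpace ℝ (Fin n)) :
    S.invM q (c • w) = c • S.invM q w := map_smul _ _ _

theorem inner_invM_comm (q w w' : EuclideanSpace ℝ (Fin n)) :
    inner ℝ w (S.invM q w') = inner ℝ w' (S.invM q w) := by
  have h := (Matrix.isSymmetric_toEuclideanLin_iff.2 (S.M_posDef q).inv.isHermitian) w' w
  rw [real_inner_comm]
  exact h

theorem inner_invM_pos (q : EuclideanSpace ℝ (Fin n)) {w : EuclideanSpace ℝ (Fin n)}
    (hw : w ≠ 0) : 0 < inner ℝ w (S.invM q w) := by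
  have h := (S.M_posDef q).inv.re_dotProduct_pos (x := w.ofLp) (by simpa using hw)
  rw [EuclideanSpace.inner_eq_star_dotProduct, dotProduct_comm]
  simpa [invM, Matrix.toLpLin_apply] using h

theorem D_pos {q : EuclideanSpace ℝ (Fin n)} (h : S.fc q = 0) : 0 < S.D q :=
  S.inner_invM_pos q (S.normal_ne_zero q h)

theorem Dtan_pos {q : EuclideanSpace ℝ (Fin n)} (h : S.fc q = 0) : 0 < S.Dtan q :=
  S.inner_invM_pos q (S.b_ne_zero q h)

theorem inner_b_invM_normal {q : EuclideanSpace ℝ (Fin n)} (h : S.fc q = 0) :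
    inner ℝ (S.b q) (S.invM q (S.normal q)) = 0 := S.orthogonal q h

theorem inner_normal_invM_b {q : EuclideanSpace ℝ (Fin n)} (h : S.fc q = 0) :
    inner ℝ (S.normal q) (S.invM q (S.b q)) = 0 := by
  rw [S.inner_invM_comm, S.inner_b_invM_normal h]

theorem contactAcc_eq (q : EuclideanSpace ℝ (Fin n)) (l : Fin 2 → ℝ) :
    S.contactAcc q l = l 0 • S.invM q (S.normal q) + l 1 • S.invM q (S.b q) := by
  rw [contactAcc, invM_add, invM_smul, invM_smul]

theorem contactAcc_zero (q : EuclideanSpace ℝ (Fin n)) : S.contactAcc q 0 = 0 := by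
  simp [contactAcc_eq]

theorem contactAcc_smul (q : EuclideanSpace ℝ (Fin n)) (c : ℝ) (l : Fin 2 → ℝ) :
    S.contactAcc q (c • l) = c • S.contactAcc q l := by
  simp [contactAcc_eq, mul_smul]

/-- Kinetic orthogonality decouples the two directions at contact points: each force component acts
on its own velocity only, with the positive factors `D` and `Dtan`. -/
theorem inner_normal_contactAcc {q : EuclideanSpace ℝ (Fin n)} (h : S.fc q = 0)
    (l : Fin 2 → ℝ) : inner ℝ (S.normal q) (S.contactAcc q l) = S.D q * l 0 := by
  rw [contactAcc_eq, inner_add_right, inner_smul_right, inner_smul_right,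
    S.inner_normal_invM_b h, D]
  ring

theorem inner_b_contactAcc {q : EuclideanSpace ℝ (Fin n)} (h : S.fc q = 0)
    (l : Fin 2 → ℝ) : inner ℝ (S.b q) (S.contactAcc q l) = S.Dtan q * l 1 := by
  rw [contactAcc_eq, inner_add_right, inner_smul_right, inner_smul_right,
    S.inner_b_invM_normal h, Dtan]
  ring

theorem contactAcc_injective {q : EuclideanSpace ℝ (Fin n)} (h : S.fc q = 0)
    {l l' : Fin 2 → ℝ} (hl : S.contactAcc q l = S.contactAcc q l') : l = l' := by
  have h0 := S.inner_normal_contactAcc h l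
  have h1 := S.inner_b_contactAcc h l
  rw [hl, S.inner_normal_contactAcc h] at h0
  rw [hl, S.inner_b_contactAcc h] at h1
  funext i
  fin_cases i
  · exact (mul_left_cancel₀ (S.D_pos h).ne' h0).symm
  · exact (mul_left_cancel₀ (S.Dtan_pos h).ne' h1).symm

/-- A linear function on an interval is minimised at the end opposite to its slope, or anywhere if
the slope is zero. This makes Coulomb's law a monotone set-valued relation. -/
theorem maxDissipation_iff {a v s : ℝ} : S.MaxDissipation a v s ↔
    |s| ≤ S.μ * a ∧ (0 < v → s = -(S.μ * a)) ∧ (v < 0 → s = S.μ * a) := by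
  simp only [MaxDissipation, isMinOn_iff, mem_ofPred_eq]
  refine and_congr_right fun hs => ⟨fun h => ⟨fun hv => ?_, fun hv => ?_⟩, fun h r hr => ?_⟩
  · have := h (-(S.μ * a)) (by rw [abs_neg, abs_of_nonneg ((abs_nonneg _).trans hs)])
    have := le_of_mul_le_mul_left this hv
    exact le_antisymm this (abs_le.1 hs).1
  · have := h (S.μ * a) (by rw [abs_of_nonneg ((abs_nonneg _).trans hs)])
    nlinarith [(abs_le.1 hs).2]
  · have := abs_le.1 hr
    rcases lt_trichotomy v 0 with hv | hv | hv
    · rw [h.2 hv]; nlinarith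
    · simp [hv]
    · rw [h.1 hv]; nlinarith

/-- Monotonicity of Coulomb's law. -/
theorem MaxDissipation.sub_le {S : PlanarCLS n m} {a v s a' v' s' : ℝ}
    (h : S.MaxDissipation a v s) (h' : S.MaxDissipation a' v' s') (hv : v' < v) :
    s - s' ≤ S.μ * |a - a'| := by
  rw [maxDissipation_iff] at h h'
  have h1 := abs_le.1 h.1
  have h2 := abs_le.1 h'.1
  have hμ := S.μ_pos
  have h3 := le_abs_self (a - a')
  have h4 := neg_abs_le (a - a')
  rcases lt_or_ge 0 v with h0 | h0
  · have := h.2.1 h0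
    nlinarith
  · have := h'.2.2 (by linarith)
    nlinarith

theorem MaxDissipation.nonneg {S : PlanarCLS n m} {a v s : ℝ}
    (h : S.MaxDissipation a v s) : 0 ≤ a := by
  rw [maxDissipation_iff] at h
  exact nonneg_of_mul_nonneg_right ((abs_nonneg _).trans h.1) S.μ_pos

theorem MaxDissipation.smul {S : PlanarCLS n m} {a v s c : ℝ}
    (h : S.MaxDissipation a v s) (hc : 0 ≤ c) : S.MaxDissipation (c * a) v (c * s) := by
  rw [maxDissipation_iff] at h ⊢
  refine ⟨?_, fun hv => ?_, fun hv => ?_⟩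
  · rw [abs_mul, abs_of_nonneg hc]
    nlinarith [h.1]
  · rw [h.2.1 hv]; ring
  · rw [h.2.2 hv]; ring

/-- The post-impact velocity and the impulse are determined by the state before the impact. -/
theorem impact_unique {q w v v' : EuclideanSpace ℝ (Fin n)} {P P' : Fin 2 → ℝ} (h : S.fc q = 0)
    (hv : v = w + S.contactAcc q P) (hv' : v' = w + S.contactAcc q P')
    (hn : S.vn q v = 0) (hn' : S.vn q v' = 0)
    (hf : S.MaxDissipation (P 0) (S.vt q v) (P 1))
    (hf' : S.MaxDissipation (P' 0) (S.vt q v') (P' 1)) : P = P' := by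
  have hD := S.D_pos h
  have hDt := S.Dtan_pos h
  have e1 : S.D q * P 0 = S.D q * P' 0 := by
    rw [vn, hv, inner_add_right, S.inner_normal_contactAcc h] at hn
    rw [vn, hv', inner_add_right, S.inner_normal_contactAcc h] at hn'
    linarith
  have e0 : P 0 = P' 0 := mul_left_cancel₀ hD.ne' e1
  have e2 : S.vt q v - S.vt q v' = S.Dtan q * (P 1 - P' 1) := by
    rw [vt, vt, hv, hv', inner_add_right, S.inner_b_contactAcc h, inner_add_right,
      S.inner_b_contactAcc h]
    ring
  funext i
  fin_cases i
  · exact e0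
  · change P 1 = P' 1
    -- With equal normal impulses, a larger tangential velocity comes with a smaller or equal
    -- tangential impulse, whereas the jump relation `e2` with `Dtan > 0` asks for a larger one.
    rcases lt_trichotomy (S.vt q v) (S.vt q v') with hlt | heq | hlt
    · have := hf'.sub_le hf hlt
      rw [e0, sub_self, abs_zero, mul_zero] at this
      nlinarith
    · rw [heq, sub_self] at e2
      rcases mul_eq_zero.1 e2.symm with h0 | h0 <;> linarith
    · have := hf.sub_le hf' hlt
      rw [e0, sub_self, abs_zero, mul_zero] at this
      nlinarith

/-! Smoothness -/

theorem normal_contDiff : ContDiff ℝ 2 S.normal := by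
  have h : ContDiff ℝ 2 (fderiv ℝ S.fc) := S.fc_smooth.fderiv_right (by norm_num)
  exact (InnerProductSpace.toDual ℝ (EuclideanSpace ℝ (Fin n))).symm.contDiff.comp h

theorem col_contDiff (i : Fin 2) : ContDiff ℝ 2 (S.col i) := by
  fin_cases i
  · exact S.normal_contDiff
  · exact S.b_smooth

/-- Cramer's rule: the adjugate is polynomial in the entries, and the determinant of a positive
definite matrix does not vanish. -/
theorem inv_entry_contDiff (i j : Fin n) : ContDiff ℝ 2 (fun q => (S.M q)⁻¹ i j) := by
  have hdet : ∀ A : EuclideanSpace ℝ (Fin n) → Matrix (Fin n) (Fin n) ℝ,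
      (∀ i j, ContDiff ℝ 2 fun q => A q i j) → ContDiff ℝ 2 fun q => (A q).det := by
    intro A hA
    simp only [Matrix.det_apply]
    exact ContDiff.sum fun σ _ => (contDiff_prod fun k _ => hA _ _).const_smul _
  have hne : ∀ q, (S.M q).det ≠ 0 := fun q => (S.M_posDef q).det_pos.ne'
  have hadj : ContDiff ℝ 2 fun q => (S.M q).adjugate i j := by
    simp only [Matrix.adjugate_apply]
    refine hdet _ fun k l => ?_
    by_cases hk : k = j
    · subst hk
      simpa using contDiff_const
    · simpa [Matrix.updateRow_apply, hk] using S.M_smooth k l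
  simp only [Matrix.inv_def, Matrix.smul_apply, Ring.inverse_eq_inv', smul_eq_mul]
  exact ((hdet _ S.M_smooth).inv hne).mul hadj

theorem invM_contDiff {X : Type*} [NormedAddCommGroup X] [NormedSpace ℝ X]
    {Q w : X → EuclideanSpace ℝ (Fin n)} (hQ : ContDiff ℝ 2 Q) (hw : ContDiff ℝ 2 w) :
    ContDiff ℝ 2 (fun x => S.invM (Q x) (w x)) := by
  rw [contDiff_euclidean]
  intro i
  simp only [invM, Matrix.toLpLin_apply, Matrix.mulVec, dotProduct]
  exact ContDiff.sum fun j _ =>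
    ((S.inv_entry_contDiff i j).comp hQ).mul (contDiff_euclidean.1 hw j)

theorem invM_normal_contDiff : ContDiff ℝ 2 (fun q => S.invM q (S.normal q)) :=
  S.invM_contDiff contDiff_id S.normal_contDiff

theorem invM_b_contDiff : ContDiff ℝ 2 (fun q => S.invM q (S.b q)) :=
  S.invM_contDiff contDiff_id S.b_smooth

theorem D_contDiff : ContDiff ℝ 2 S.D := S.normal_contDiff.inner ℝ S.invM_normal_contDiff

theorem Dtan_contDiff : ContDiff ℝ 2 S.Dtan := S.b_smooth.inner ℝ S.invM_b_contDiff

/-- `∇_q(colᵢ(q)ᵀ v)ᵀ w` in terms of the derivative of the column. -/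
theorem inner_gradient_col (i : Fin 2) (q v w : EuclideanSpace ℝ (Fin n)) :
    inner ℝ (gradient (fun p => inner ℝ (S.col i p) v) q) w =
      inner ℝ (fderiv ℝ (S.col i) q w) v := by
  have hd : DifferentiableAt ℝ (S.col i) q :=
    (S.col_contDiff i).contDiffAt.differentiableAt (by norm_num)
  rw [inner_gradient_left, fderiv_inner_apply ℝ hd (differentiableAt_const v)]
  simp

theorem phitilde_eq (i : Fin 2) (q v : EuclideanSpace ℝ (Fin n)) (u : EuclideanSpace ℝ (Fin m)) :
    S.phitilde q v u i = inner ℝ (S.col i q) (S.fv q v u) +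
      inner ℝ (fderiv ℝ (S.col i) q v) v := by
  rw [phitilde, inner_gradient_col]

theorem phi_eq (q v : EuclideanSpace ℝ (Fin n)) (u : EuclideanSpace ℝ (Fin m)) :
    S.phi q v u = S.phitilde q v u 0 := rfl

theorem phitilde_contDiff (i : Fin 2) : ContDiff ℝ 1
    (fun p : EuclideanSpace ℝ (Fin n) × EuclideanSpace ℝ (Fin n) × EuclideanSpace ℝ (Fin m) =>
      S.phitilde p.1 p.2.1 p.2.2 i) := by
  simp only [phitilde_eq]
  have h1 : ContDiff ℝ 1 (fderiv ℝ (S.col i)) := (S.col_contDiff i).fderiv_right (by norm_num)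
  have h2 := ((S.col_contDiff i).of_le (m := 1) (by norm_num)).comp
    (contDiff_fst (E := EuclideanSpace ℝ (Fin n))
      (F := EuclideanSpace ℝ (Fin n) × EuclideanSpace ℝ (Fin m)))
  have h3 := S.fv_smooth.of_le (m := 1) (by norm_num)
  have hv : ContDiff ℝ 1 (fun p : EuclideanSpace ℝ (Fin n) × EuclideanSpace ℝ (Fin n) ×
    EuclideanSpace ℝ (Fin m) => p.2.1) := contDiff_fst.comp contDiff_snd
  exact (h2.inner ℝ h3).add (((h1.comp contDiff_fst).clm_apply hv).inner ℝ hv)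

/-! Derivatives along curves -/

theorem hasDerivAt_fc {q : ℝ → EuclideanSpace ℝ (Fin n)} {q' : EuclideanSpace ℝ (Fin n)} {t : ℝ}
    (hq : HasDerivAt q q' t) : HasDerivAt (fun s => S.fc (q s)) (S.vn (q t) q') t := by
  have hd : DifferentiableAt ℝ S.fc (q t) :=
    S.fc_smooth.contDiffAt.differentiableAt (by norm_num)
  have := hd.hasFDerivAt.comp_hasDerivAt t hq
  rwa [← inner_gradient_left] at this

theorem hasDerivAt_col {q v : ℝ → EuclideanSpace ℝ (Fin n)} {q' v' : EuclideanSpace ℝ (Fin n)}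
    {t : ℝ} (i : Fin 2) (hq : HasDerivAt q q' t) (hv : HasDerivAt v v' t) :
    HasDerivAt (fun s => inner ℝ (S.col i (q s)) (v s))
      (inner ℝ (S.col i (q t)) v' + inner ℝ (fderiv ℝ (S.col i) (q t) q') (v t)) t := by
  have hd : DifferentiableAt ℝ (S.col i) (q t) :=
    (S.col_contDiff i).contDiffAt.differentiableAt (by norm_num)
  exact (hd.hasFDerivAt.comp_hasDerivAt t hq).inner ℝ hv

/-- Derivative of the normal and tangential velocities along a time-scaled motion. -/
theorem hasDerivAt_col_motion {q v : ℝ → EuclideanSpace ℝ (Fin n)}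
    {a : EuclideanSpace ℝ (Fin n)} {u : EuclideanSpace ℝ (Fin m)} {t θ : ℝ} (i : Fin 2)
    (hq : HasDerivAt q (θ • v t) t) (hv : HasDerivAt v (θ • S.fv (q t) (v t) u + a) t) :
    HasDerivAt (fun s => inner ℝ (S.col i (q s)) (v s))
      (θ * S.phitilde (q t) (v t) u i + inner ℝ (S.col i (q t)) a) t := by
  convert S.hasDerivAt_col i hq hv using 1
  rw [phitilde_eq, inner_add_right, inner_smul_right, map_smul, inner_smul_left]
  simp only [conj_trivial]
  ring

/-! The force law -/

/-- Orthogonality makes `Dtilde` diagonal. Hence sticking and slipping have the same normal force,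
and only the tangential component depends on the mode. -/
theorem stickForce_eq {q : EuclideanSpace ℝ (Fin n)} (h : S.fc q = 0)
    (v : EuclideanSpace ℝ (Fin n)) (u : EuclideanSpace ℝ (Fin m)) :
    S.stickForce q v u =
      ![-((S.D q)⁻¹ * S.phi q v u), -((S.Dtan q)⁻¹ * S.phitilde q v u 1)] := by
  have hD := (S.D_pos h).ne'
  have hT := (S.Dtan_pos h).ne'
  have hM : S.Dtilde q = Matrix.diagonal ![S.D q, S.Dtan q] := by
    ext i j
    fin_cases i <;> fin_cases j
    · simp [Dtilde, col, D]
    · simpa [Dtilde, col] using S.inner_normal_invM_b h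
    · simpa [Dtilde, col] using S.inner_b_invM_normal h
    · simp [Dtilde, col, Dtan]
  have hinv : (S.Dtilde q)⁻¹ = Matrix.diagonal ![(S.D q)⁻¹, (S.Dtan q)⁻¹] := by
    rw [hM]
    refine Matrix.inv_eq_right_inv ?_
    rw [Matrix.diagonal_mul_diagonal, ← Matrix.diagonal_one]
    congr 1
    ext i
    fin_cases i <;> simp [hD, hT]
  funext i
  rw [stickForce, hinv]
  fin_cases i <;> simp [phi_eq]

theorem modeForce_of_not {q v : EuclideanSpace ℝ (Fin n)} (h : ¬ (S.fc q = 0 ∧ S.vn q v = 0))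
    (u : EuclideanSpace ℝ (Fin m)) : S.modeForce q v u = 0 := if_neg h

open Classical in
theorem modeForce_eq (q v : EuclideanSpace ℝ (Fin n)) (u : EuclideanSpace ℝ (Fin m)) :
    S.modeForce q v u = if S.fc q = 0 ∧ S.vn q v = 0 then
      ![-((S.D q)⁻¹ * S.phi q v u), if S.vt q v = 0 then -((S.Dtan q)⁻¹ * S.phitilde q v u 1)
        else (S.D q)⁻¹ * S.phi q v u * (S.μ * Real.sign (S.vt q v))] else 0 := by
  by_cases h : S.fc q = 0 ∧ S.vn q v = 0
  · rw [modeForce, if_pos h, if_pos h]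
    by_cases h0 : S.vt q v = 0
    · simp [h0, S.stickForce_eq h.1]
    · funext i
      fin_cases i <;> simp [h0, slipForce]
  · rw [modeForce, if_neg h, if_neg h]

end PlanarCLS

/-! ### Structure of the solutions of the time-freezing system -/

namespace PlanarCLS

variable {n m : ℕ} (S : PlanarCLS n m)

theorem vn_contDiff : ContDiff ℝ 2
    (fun p : EuclideanSpace ℝ (Fin n) × EuclideanSpace ℝ (Fin n) => S.vn p.1 p.2) :=
  (S.normal_contDiff.comp contDiff_fst).inner ℝ contDiff_snd

theorem vt_contDiff : ContDiff ℝ 2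
    (fun p : EuclideanSpace ℝ (Fin n) × EuclideanSpace ℝ (Fin n) => S.vt p.1 p.2) :=
  (S.b_smooth.comp contDiff_fst).inner ℝ contDiff_snd

theorem c1_continuous : Continuous S.c1 := S.fc_smooth.continuous.comp continuous_fst

theorem c2_continuous : Continuous S.c2 :=
  S.vn_contDiff.continuous.comp (continuous_fst.prodMk (continuous_fst.comp continuous_snd))

theorem c3_continuous : Continuous S.c3 :=
  S.vt_contDiff.continuous.comp (continuous_fst.prodMk (continuous_fst.comp continuous_snd))

/-- Outer estimates of the closures suffice, since they only serve to show that certain Filippov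
weights vanish. -/
theorem closure_region_zero : closure (S.region 0) ⊆ {y | 0 ≤ S.c1 y} ∪ {y | 0 ≤ S.c2 y} :=
  closure_minimal (fun y hy => hy.elim (fun h => Or.inl (show 0 ≤ S.c1 y from le_of_lt h)) fun h => Or.inr h.2.le)
    ((isClosed_le continuous_const S.c1_continuous).union
      (isClosed_le continuous_const S.c2_continuous))

theorem closure_region_one :
    closure (S.region 1) ⊆ ({y | S.c1 y ≤ 0} ∩ {y | S.c2 y ≤ 0}) ∩ {y | 0 ≤ S.c3 y} :=
  closure_minimal (fun y hy => ⟨⟨hy.1.1.le, hy.1.2.le⟩, show 0 ≤ S.c3 y from le_of_lt hy.2⟩)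
    (((isClosed_le S.c1_continuous continuous_const).inter
      (isClosed_le S.c2_continuous continuous_const)).inter
      (isClosed_le continuous_const S.c3_continuous))

theorem closure_region_two :
    closure (S.region 2) ⊆ ({y | S.c1 y ≤ 0} ∩ {y | S.c2 y ≤ 0}) ∩ {y | S.c3 y ≤ 0} :=
  closure_minimal (fun y hy => ⟨⟨hy.1.1.le, hy.1.2.le⟩, show S.c3 y ≤ 0 from le_of_lt hy.2⟩)
    (((isClosed_le S.c1_continuous continuous_const).inter
      (isClosed_le S.c2_continuous continuous_const)).inter
      (isClosed_le S.c3_continuous continuous_const))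

/-- The elements of the Filippov set are mixtures of free motion at speed `θ` and of accelerations
by contact forces that obey Coulomb's law. -/
theorem filippovSet_form {aN : ℝ} (haN : 0 < aN) {y w : TFState n} {u : EuclideanSpace ℝ (Fin m)}
    (hw : w ∈ FilippovSet S.region (S.tfField aN) y u) :
    ∃ θ s : ℝ, 0 ≤ θ ∧ θ ≤ 1 ∧
      w = (θ • y.2.1, θ • S.fv y.1 y.2.1 u + S.contactAcc y.1 ![(1 - θ) * aN, s], θ) ∧
      S.MaxDissipation ((1 - θ) * aN) (S.c3 y) s ∧
      (0 < S.c1 y → θ = 1) ∧ (0 < S.c2 y → θ = 1) ∧ (S.c1 y < 0 → S.c2 y < 0 → θ = 0) := by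
  obtain ⟨θ, hsum, hpos, hcl, rfl⟩ := hw
  rw [Fin.sum_univ_three] at hsum
  have h0 := hpos 0
  have h1 := hpos 1
  have h2 := hpos 2
  have hμ := S.μ_pos
  have k1 : (0 < S.c1 y ∨ 0 < S.c2 y ∨ S.c3 y < 0) → θ 1 = 0 := fun h => hcl 1 fun hc => by
    obtain ⟨⟨ha, hb⟩, hc⟩ := S.closure_region_one hc
    simp only [mem_ofPred_eq] at ha hb hc
    rcases h with h | h | h <;> linarith
  have k2 : (0 < S.c1 y ∨ 0 < S.c2 y ∨ 0 < S.c3 y) → θ 2 = 0 := fun h => hcl 2 fun hc => by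
    obtain ⟨⟨ha, hb⟩, hc⟩ := S.closure_region_two hc
    simp only [mem_ofPred_eq] at ha hb hc
    rcases h with h | h | h <;> linarith
  -- The two auxiliary fields share the normal force and have opposite friction forces. With total
  -- weight `1 - θ 0` the mixture fills the friction cone; off `c3 = 0` one of them drops out and
  -- the force is at an end of the cone.
  refine ⟨θ 0, (θ 2 - θ 1) * (S.μ * aN), h0, by linarith, ?_, ?_, fun h => ?_, fun h => ?_,
    fun h h' => ?_⟩
  · rw [Fin.sum_univ_three]
    have e : 1 - θ 0 = θ 1 + θ 2 := by linarith
    simp only [tfField, fAuxN, fAuxTplus, fAuxTminus, contactAcc_eq, invM_smul, e]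
    refine Prod.ext ?_ (Prod.ext ?_ ?_)
    · simp
    · simp
      module
    · simp
  · rw [maxDissipation_iff]
    have hK : 0 < S.μ * aN := mul_pos hμ haN
    refine ⟨?_, fun h => ?_, fun h => ?_⟩
    · rw [abs_le]
      constructor <;> nlinarith
    · rw [k2 (Or.inr (Or.inr h))] at hsum ⊢
      rw [show (1 : ℝ) - θ 0 = θ 1 by linarith]; ring
    · rw [k1 (Or.inr (Or.inr h))] at hsum ⊢
      rw [show (1 : ℝ) - θ 0 = θ 2 by linarith]; ring
  · linarith [k1 (Or.inl h), k2 (Or.inl h)]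
  · linarith [k1 (Or.inr (Or.inl h)), k2 (Or.inr (Or.inl h))]
  · refine hcl 0 fun hc => ?_
    rcases S.closure_region_zero hc with hc | hc <;> simp only [mem_ofPred_eq] at hc <;> linarith

variable {S}

section TimeFreezing

variable {aN τf : ℝ} {q₀ v₀ : EuclideanSpace ℝ (Fin n)} {uτ u : ℝ → EuclideanSpace ℝ (Fin m)}
  {y : ℝ → TFState n}

/-- The derivative of a solution of the time-freezing system. -/
theorem IsTFSolution.ae_form (hy : S.IsTFSolution aN uτ τf y) (haN : 0 < aN) :
    ∀ᵐ τ, τ ∈ Icc 0 τf → ∃ θ s : ℝ, 0 ≤ θ ∧ θ ≤ 1 ∧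
      HasDerivAt (fun σ => (y σ).1) (θ • (y τ).2.1) τ ∧
      HasDerivAt (fun σ => (y σ).2.1) (θ • S.fv (y τ).1 (y τ).2.1 (uτ τ) +
        S.contactAcc (y τ).1 ![(1 - θ) * aN, s]) τ ∧
      HasDerivAt (fun σ => (y σ).2.2) θ τ ∧
      S.MaxDissipation ((1 - θ) * aN) (S.c3 (y τ)) s ∧
      (0 < S.c1 (y τ) → θ = 1) ∧ (0 < S.c2 (y τ) → θ = 1) ∧
      (S.c1 (y τ) < 0 → S.c2 (y τ) < 0 → θ = 0) := by
  filter_upwards [hy.inclusion] with τ hτ hm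
  obtain ⟨w, hw, hd⟩ := hτ hm
  obtain ⟨θ, s, h0, h1, rfl, h2⟩ := S.filippovSet_form haN hw
  have hfst := (ContinuousLinearMap.fst ℝ (EuclideanSpace ℝ (Fin n))
    (EuclideanSpace ℝ (Fin n) × ℝ)).hasFDerivAt.comp_hasDerivAt τ hd
  have hsnd := (ContinuousLinearMap.snd ℝ (EuclideanSpace ℝ (Fin n))
    (EuclideanSpace ℝ (Fin n) × ℝ)).hasFDerivAt.comp_hasDerivAt τ hd
  exact ⟨θ, s, h0, h1, hfst, (ContinuousLinearMap.fst ℝ (EuclideanSpace ℝ (Fin n))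
    ℝ).hasFDerivAt.comp_hasDerivAt τ hsnd, (ContinuousLinearMap.snd ℝ (EuclideanSpace ℝ (Fin n))
    ℝ).hasFDerivAt.comp_hasDerivAt τ hsnd, h2⟩

theorem IsTFSolution.absCont_comp {F : Type*} [NormedAddCommGroup F] [NormedSpace ℝ F]
    (hy : S.IsTFSolution aN uτ τf y) {g : TFState n → F} (hg : ContDiff ℝ 1 g) {a b : ℝ}
    (ha : 0 ≤ a) (hab : a ≤ b) (hb : b ≤ τf) :
    AbsolutelyContinuousOnInterval (fun τ => g (y τ)) a b :=
  AbsolutelyContinuousOnInterval.comp_contDiff (hy.absCont.mono (by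
    rw [uIcc_of_le hab, uIcc_of_le (ha.trans (hab.trans hb))]
    exact Icc_subset_Icc ha hb)) hg

theorem IsTFSolution.continuousOn (hy : S.IsTFSolution aN uτ τf y) (hτf : 0 ≤ τf) :
    ContinuousOn y (Icc 0 τf) := by
  have := hy.absCont.continuousOn
  rwa [uIcc_of_le hτf] at this

theorem c1_contDiff : ContDiff ℝ 1 S.c1 :=
  (S.fc_smooth.of_le (by norm_num)).comp contDiff_fst

theorem c2_contDiff : ContDiff ℝ 1 S.c2 :=
  (S.vn_contDiff.of_le (by norm_num)).comp
    (contDiff_fst.prodMk (contDiff_fst.comp contDiff_snd))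

theorem c3_contDiff : ContDiff ℝ 1 S.c3 :=
  (S.vt_contDiff.of_le (by norm_num)).comp
    (contDiff_fst.prodMk (contDiff_fst.comp contDiff_snd))

/-- The gap stays nonnegative along solutions of the time-freezing system. -/
theorem IsTFSolution.gap_nonneg (hy : S.IsTFSolution aN uτ τf y) (haN : 0 < aN) (hτf : 0 < τf)
    (h0 : 0 ≤ S.fc (y 0).1) : ∀ τ ∈ Icc 0 τf, 0 ≤ S.c1 (y τ) := by
  intro τ hτ
  by_contra! hneg
  have hcont : ContinuousOn (fun σ => S.c1 (y σ)) (Icc 0 τf) :=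
    S.c1_continuous.comp_continuousOn (hy.continuousOn hτf.le)
  -- After the last time in `[0, τ]` with nonnegative gap, motion into the constraint is frozen (`θ
  -- = 0` where `c2 < 0`), so the gap cannot decrease below zero.
  let Z := Icc 0 τ ∩ (fun σ => S.c1 (y σ)) ⁻¹' Ici 0
  have hcont' : ContinuousOn (fun σ => S.c1 (y σ)) (Icc 0 τ) :=
    hcont.mono (Icc_subset_Icc_right hτ.2)
  have hZ : IsCompact Z :=
    isCompact_Icc.of_isClosed_subset (hcont'.preimage_isClosed_of_isClosed isClosed_Icc
      isClosed_Ici) inter_subset_left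
  have hne : Z.Nonempty := ⟨0, ⟨le_rfl, hτ.1⟩, h0⟩
  obtain ⟨⟨hs1, hs2⟩, hs3⟩ := hZ.sSup_mem hne
  set s := sSup Z
  have hlt : ∀ r ∈ Ioc s τ, S.c1 (y r) < 0 := fun r hr => by
    by_contra! hc
    exact absurd (le_csSup hZ.bddAbove ⟨⟨hs1.trans hr.1.le, hr.2⟩, hc⟩) (not_le.2 hr.1)
  have hmono := (hy.absCont_comp (c1_contDiff (S := S)) hs1 hs2 hτ.2).monotoneOn (by
    filter_upwards [hy.ae_form haN, Measure.ae_ne volume s] with r hr hrs hm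
    obtain ⟨θ, _, h1, _, hq, _, _, _, _, _, h5⟩ := hr ⟨hs1.trans hm.1, hm.2.trans hτ.2⟩
    refine ⟨_, S.hasDerivAt_fc hq, ?_⟩
    have hv : S.vn (y r).1 (θ • (y r).2.1) = θ * S.c2 (y r) := inner_smul_right _ _ _
    rw [hv]
    rcases lt_or_ge (S.c2 (y r)) 0 with h | h
    · rw [h5 (hlt r ⟨lt_of_le_of_ne hm.1 hrs.symm, hm.2⟩) h, zero_mul]
    · positivity)
  have := hmono ⟨le_rfl, hs2⟩ ⟨hs2, le_rfl⟩ hs2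
  have hs3' : 0 ≤ S.c1 (y s) := hs3
  linarith

/-- Almost everywhere, a solution of the time-freezing system is either in an impact, with frozen
time, or it is a time-scaled motion of the complementarity system. -/
theorem IsTFSolution.ae_cases (hy : S.IsTFSolution aN uτ τf y) (haN : 0 < aN) (hτf : 0 < τf)
    (h0 : 0 ≤ S.fc (y 0).1) :
    ∀ᵐ τ, τ ∈ Icc 0 τf →
      (τ ∈ S.impactSet τf y ∧ HasDerivAt (fun σ => (y σ).1) 0 τ ∧
        HasDerivAt (fun σ => (y σ).2.2) 0 τ ∧ ∃ s : ℝ, S.MaxDissipation aN (S.c3 (y τ)) s ∧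
        HasDerivAt (fun σ => (y σ).2.1) (S.contactAcc (y τ).1 ![aN, s]) τ) ∨
      (τ ∉ S.impactSet τf y ∧ ∃ θ : ℝ, 0 < θ ∧ θ ≤ 1 ∧
        HasDerivAt (fun σ => (y σ).1) (θ • (y τ).2.1) τ ∧
        HasDerivAt (fun σ => (y σ).2.1) (θ • (S.fv (y τ).1 (y τ).2.1 (uτ τ) +
          S.contactAcc (y τ).1 (S.modeForce (y τ).1 (y τ).2.1 (uτ τ)))) τ ∧
        HasDerivAt (fun σ => (y σ).2.2) θ τ ∧
        S.MaxDissipation (S.modeForce (y τ).1 (y τ).2.1 (uτ τ) 0) (S.c3 (y τ))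
          (S.modeForce (y τ).1 (y τ).2.1 (uτ τ) 1)) := by
  filter_upwards [hy.ae_form haN, Measure.ae_ne volume 0, Measure.ae_ne volume τf,
    ae_hasDerivAt_eq_zero_of_eq_zero (fun σ => S.c2 (y σ)),
    ae_hasDerivAt_eq_zero_of_eq_zero (fun σ => S.c3 (y σ))] with τ hτ hne0 hnef hz2 hz3 hm
  obtain ⟨θ, s, hθ0, hθ1, hq, hv, ht, hmd, k1, k2, -⟩ := hτ hm
  have hgap := hy.gap_nonneg haN hτf h0
  have hvn : S.vn (y τ).1 (θ • (y τ).2.1) = θ * S.c2 (y τ) := inner_smul_right _ _ _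
  rcases (hgap τ hm).lt_or_eq with hc1 | hc1
  · -- free flight
    have hθ : θ = 1 := k1 hc1
    subst hθ
    have hmf : S.modeForce (y τ).1 (y τ).2.1 (uτ τ) = 0 :=
      S.modeForce_of_not (fun h => hc1.ne' h.1) _
    have hs : s = 0 := by
      have := (S.maxDissipation_iff.1 hmd).1
      simpa using this
    refine Or.inr ⟨fun h => hc1.ne' h.2.1, 1, one_pos, le_rfl, hq, ?_, ht, ?_⟩
    · rw [hmf, contactAcc_zero, add_zero]
      have e : (![(1 - 1) * aN, s] : Fin 2 → ℝ) = 0 := by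
        funext i; fin_cases i <;> simp [hs]
      rwa [e, contactAcc_zero, add_zero] at hv
    · rw [hmf]
      simpa [hs] using hmd
  have hc1' : S.fc (y τ).1 = 0 := hc1.symm
  -- At an interior contact time the nonnegative gap has a local minimum, and its derivative is `θ *
  -- c2`.
  have hd0 : θ * S.c2 (y τ) = 0 := by
    have hmin : IsLocalMin (fun σ => S.fc (y σ).1) τ := by
      filter_upwards [Icc_mem_nhds (lt_of_le_of_ne hm.1 hne0.symm) (lt_of_le_of_ne hm.2 hnef)]
        with σ hσ
      rw [hc1']
      exact hgap σ hσ
    have := hmin.hasDerivAt_eq_zero (S.hasDerivAt_fc hq)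
    rwa [hvn] at this
  have hD := S.D_pos hc1'
  have hT := S.Dtan_pos hc1'
  rcases mul_eq_zero.1 hd0 with hθ | hc2
  · -- impact
    subst hθ
    have hle : S.c2 (y τ) ≤ 0 := by
      by_contra! h
      exact zero_ne_one (k2 h)
    have hlt : S.c2 (y τ) < 0 := by
      -- With the clock stopped, `c2` grows at the rate `D * aN > 0`, which almost everywhere
      -- excludes `c2 = 0`.
      refine lt_of_le_of_ne hle fun h => ?_
      have h1 := hz2 h _ (S.hasDerivAt_col_motion 0 hq hv)
      rw [zero_mul, zero_add] at h1
      have h2 := S.inner_normal_contactAcc hc1' ![(1 - 0) * aN, s]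
      rw [show S.normal (y τ).1 = S.col 0 (y τ).1 from rfl, h1] at h2
      have : 0 < S.D (y τ).1 * aN := by positivity
      simp at h2
      rcases h2 with h2 | h2 <;> linarith
    refine Or.inl ⟨⟨hm, hc1', hlt⟩, ?_, ht, s, ?_, ?_⟩
    · simpa using hq
    · simpa using hmd
    · simpa using hv
  · -- persistent contact
    -- Since `c2' = 0` on the zero set of `c2`, we have `θ φ + (1 - θ) D aN = 0`. This rules out `θ
    -- = 0` and determines the normal force.
    have h1 := hz2 hc2 _ (S.hasDerivAt_col_motion 0 hq hv)
    have h2 := S.inner_normal_contactAcc hc1' ![(1 - θ) * aN, s]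
    rw [show S.normal (y τ).1 = S.col 0 (y τ).1 from rfl] at h2
    rw [h2] at h1
    simp only [Matrix.cons_val_zero] at h1
    have hθ : 0 < θ := by
      refine lt_of_le_of_ne hθ0 fun h => ?_
      rw [← h] at h1
      have : 0 < S.D (y τ).1 * aN := by positivity
      linarith
    -- The clock runs at the rate `θ`, so the force per unit of physical time is the auxiliary force
    -- over `θ`. Its tangential part is fixed by Coulomb's law when `v_t ≠ 0`, and by `c3' = 0` on
    -- the zero set of `c3` when `v_t = 0`.
    have hmf : S.modeForce (y τ).1 (y τ).2.1 (uτ τ) = θ⁻¹ • ![(1 - θ) * aN, s] := by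
      rw [modeForce_eq, if_pos ⟨hc1', hc2⟩]
      have e0 : -((S.D (y τ).1)⁻¹ * S.phi (y τ).1 (y τ).2.1 (uτ τ)) = θ⁻¹ * ((1 - θ) * aN) := by
        rw [phi_eq]
        field_simp
        linarith
      funext i
      fin_cases i
      · simpa using e0
      · have hmd' := S.maxDissipation_iff.1 hmd
        simp only [Matrix.smul_cons, smul_eq_mul]
        split_ifs with h3
        · have h4 := hz3 h3 _ (S.hasDerivAt_col_motion 1 hq hv)
          have h5 := S.inner_b_contactAcc hc1' ![(1 - θ) * aN, s]
          rw [show S.b (y τ).1 = S.col 1 (y τ).1 from rfl] at h5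
          rw [h5] at h4
          simp at h4 ⊢
          field_simp
          linarith
        · have e1 : (S.D (y τ).1)⁻¹ * S.phi (y τ).1 (y τ).2.1 (uτ τ) =
            -(θ⁻¹ * ((1 - θ) * aN)) := by linarith
          simp only [e1]
          rcases lt_or_gt_of_ne h3 with h | h
          · simp [Real.sign_of_neg h, hmd'.2.2 h]; ring
          · simp [Real.sign_of_pos h, hmd'.2.1 h]; ring
    have hni : τ ∉ S.impactSet τf y := fun h => h.2.2.ne hc2
    refine Or.inr ⟨hni, θ, hθ, hθ1, hq, ?_, ht, ?_⟩
    · rw [hmf, contactAcc_smul, smul_add, smul_inv_smul₀ hθ.ne']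
      exact hv
    · rw [hmf]
      exact hmd.smul (inv_nonneg.2 hθ.le)

end TimeFreezing

end PlanarCLS

/-! ### The impact phase of a time-freezing trajectory -/

/-- `[a, b]` is the virtual time interval of the impact (`a = b` if there is no impact). -/
structure IsImpactPhase {n m : ℕ} (S : PlanarCLS n m) (τf : ℝ) (y : ℝ → TFState n) (a b : ℝ) :
    Prop where
  nonneg : 0 ≤ a
  le : a ≤ b
  le_end : b ≤ τf
  impactSet_eq : S.impactSet τf y = Ico a b
  time_eq : ∀ τ ∈ Icc a b, (y τ).2.2 = (y a).2.2
  time_inj : ∀ τ ∈ Icc 0 τf, ∀ σ ∈ Icc 0 τf, (y τ).2.2 = (y σ).2.2 →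
    τ = σ ∨ (τ ∈ Icc a b ∧ σ ∈ Icc a b)
  position_eq : ∀ τ ∈ Icc a b, (y τ).1 = (y a).1
  contact : a < b → S.fc (y a).1 = 0
  vn_end : a < b → S.vn (y b).1 (y b).2.1 = 0

namespace PlanarCLS

variable {n m : ℕ} {S : PlanarCLS n m} {aN τf : ℝ} {uτ : ℝ → EuclideanSpace ℝ (Fin m)}
  {y : ℝ → TFState n}

theorem IsTFSolution.absCont_time (hy : S.IsTFSolution aN uτ τf y) {a b : ℝ}
    (ha : 0 ≤ a) (hab : a ≤ b) (hb : b ≤ τf) :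
    AbsolutelyContinuousOnInterval (fun τ => (y τ).2.2) a b :=
  hy.absCont_comp (contDiff_snd.comp contDiff_snd) ha hab hb

theorem IsTFSolution.time_monotoneOn (hy : S.IsTFSolution aN uτ τf y) (haN : 0 < aN)
    (hτf : 0 ≤ τf) : MonotoneOn (fun τ => (y τ).2.2) (Icc 0 τf) :=
  (hy.absCont_time le_rfl hτf le_rfl).monotoneOn (by
    filter_upwards [hy.ae_form haN] with r hr hm
    obtain ⟨θ, _, h0, _, _, _, ht, _⟩ := hr hm
    exact ⟨θ, ht, h0⟩)

theorem IsTFSolution.time_lipschitzOn (hy : S.IsTFSolution aN uτ τf y) (haN : 0 < aN)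
    (hτf : 0 ≤ τf) : LipschitzOnWith 1 (fun τ => (y τ).2.2) (Icc 0 τf) := by
  have key : ∀ s ∈ Icc 0 τf, ∀ t ∈ Icc 0 τf, s ≤ t → dist (y s).2.2 (y t).2.2 ≤ dist s t := by
    intro s hs t ht hst
    have h1 := hy.time_monotoneOn haN hτf hs ht hst
    have h2 := (hy.absCont_time hs.1 hst ht.2).sub_le_integral hst (k := fun _ => 1)
      intervalIntegrable_const (by
        filter_upwards [hy.ae_form haN] with r hr hm
        obtain ⟨θ, _, _, h0, _, _, ht', _⟩ := hr ⟨hs.1.trans hm.1, hm.2.trans ht.2⟩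
        exact ⟨θ, ht', h0⟩)
    simp only [intervalIntegral.integral_const, smul_eq_mul, mul_one] at h1 h2
    rw [dist_comm, Real.dist_eq, dist_comm, Real.dist_eq, abs_of_nonneg (by linarith),
      abs_of_nonneg (by linarith)]
    exact h2
  refine LipschitzOnWith.of_dist_le_mul fun s hs t ht => ?_
  rw [NNReal.coe_one, one_mul]
  rcases le_total s t with h | h
  · exact key s hs t ht h
  · rw [dist_comm, dist_comm s]
    exact key t ht s hs h

/-- While time is frozen, the position is fixed at a contact point, and the normal velocity
increases at a constant rate and is negative, except possibly at the end. -/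
theorem IsTFSolution.frozen (hy : S.IsTFSolution aN uτ τf y) (haN : 0 < aN) (hτf : 0 < τf)
    (h0 : 0 ≤ S.fc (y 0).1) {a b : ℝ} (ha : 0 ≤ a) (hab : a < b) (hb : b ≤ τf)
    (heq : (y a).2.2 = (y b).2.2) :
    (∀ τ ∈ Icc a b, (y τ).2.2 = (y a).2.2) ∧ (∀ τ ∈ Icc a b, (y τ).1 = (y a).1) ∧
      S.fc (y a).1 = 0 ∧ ∀ τ ∈ Ico a b, S.c2 (y τ) < 0 := by
  have hsub : Icc a b ⊆ Icc 0 τf := Icc_subset_Icc ha hb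
  have hmono := (hy.time_monotoneOn haN hτf.le).mono hsub
  have htime : ∀ τ ∈ Icc a b, (y τ).2.2 = (y a).2.2 := fun τ hτ =>
    le_antisymm ((hmono hτ (right_mem_Icc.2 hab.le) hτ.2).trans heq.ge)
      (hmono (left_mem_Icc.2 hab.le) hτ hτ.1)
  -- A constant clock excludes the alternative of `ae_cases` with `θ > 0`.
  have hae : ∀ᵐ τ, τ ∈ Icc a b → τ ∈ S.impactSet τf y ∧ HasDerivAt (fun σ => (y σ).1) 0 τ ∧
      ∃ s : ℝ, HasDerivAt (fun σ => (y σ).2.1) (S.contactAcc (y τ).1 ![aN, s]) τ := by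
    filter_upwards [hy.ae_cases haN hτf h0, Measure.ae_ne volume a, Measure.ae_ne volume b]
      with τ hτ hna hnb hm
    rcases hτ (hsub hm) with h | ⟨_, θ, hθ, _, _, _, ht, _⟩
    · obtain ⟨h1, h2, -, s, -, h3⟩ := h
      exact ⟨h1, h2, s, h3⟩
    · have hc : HasDerivAt (fun σ => (y σ).2.2) 0 τ := by
        refine (hasDerivAt_const τ (y a).2.2).congr_of_eventuallyEq ?_
        filter_upwards [Icc_mem_nhds (lt_of_le_of_ne hm.1 hna.symm) (lt_of_le_of_ne hm.2 hnb)]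
          with σ hσ using htime σ hσ
      exact absurd (ht.unique hc) hθ.ne'
  have hpos : ∀ τ ∈ Icc a b, (y τ).1 = (y a).1 := by
    have h1 : AbsolutelyContinuousOnInterval (fun τ => (y τ).1) a b :=
      hy.absCont_comp contDiff_fst ha hab.le hb
    obtain ⟨C, hC⟩ := h1.const_of_ae_hasDerivAt_zero (by
      filter_upwards [hae] with τ h hm
      exact (h (by rwa [uIcc_of_le hab.le] at hm)).2.1)
    rw [uIcc_of_le hab.le] at hC
    intro τ hτ
    exact (hC τ hτ).trans (hC a (left_mem_Icc.2 hab.le)).symm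
  -- every subinterval contains an impact point
  have hex : ∀ c d, a ≤ c → c < d → d ≤ b → ∃ τ ∈ Ioo c d, τ ∈ S.impactSet τf y := by
    intro c d hc hcd hd
    by_contra! hcon
    have hnull : volume (Ioo c d) = 0 := by
      refine measure_mono_null (fun τ hτ => ?_) hae
      exact fun h => hcon τ hτ (h ⟨hc.trans hτ.1.le, hτ.2.le.trans hd⟩).1
    rw [Real.volume_Ioo, ENNReal.ofReal_eq_zero] at hnull
    linarith
  have hfc : S.fc (y a).1 = 0 := by
    obtain ⟨τ, hτ, hi⟩ := hex a b le_rfl hab le_rfl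
    rw [← hpos τ ⟨hτ.1.le, hτ.2.le⟩]
    exact hi.2.1
  -- Impact points, where `c2 < 0`, are dense in `[a, b]`; by monotonicity `c2` is negative at every
  -- time before `b`.
  have hmono2 : MonotoneOn (fun τ => S.c2 (y τ)) (Icc a b) :=
    (hy.absCont_comp (c2_contDiff (S := S)) ha hab.le hb).monotoneOn (by
      filter_upwards [hae] with τ h hm
      obtain ⟨⟨_, hf, _⟩, hq, s, hv⟩ := h hm
      refine ⟨_, S.hasDerivAt_col 0 hq hv, ?_⟩
      rw [show S.col 0 (y τ).1 = S.normal (y τ).1 from rfl, S.inner_normal_contactAcc hf]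
      have := S.D_pos hf
      simp
      positivity)
  refine ⟨htime, hpos, hfc, fun τ hτ => ?_⟩
  obtain ⟨σ, hσ, hi⟩ := hex τ b hτ.1 hτ.2 le_rfl
  exact (hmono2 ⟨hτ.1, hτ.2.le⟩ ⟨hτ.1.trans hσ.1.le, hσ.2.le⟩ hσ.1.le).trans_lt hi.2.2

/-- Time is frozen for a while after any impact point. -/
theorem IsTFSolution.exists_frozen (hy : S.IsTFSolution aN uτ τf y) (haN : 0 < aN) (hτf : 0 < τf)
    (h0 : 0 ≤ S.fc (y 0).1) (hend : 0 ≤ S.vn (y τf).1 (y τf).2.1) {τ : ℝ}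
    (hτ : τ ∈ S.impactSet τf y) : ∃ σ, τ < σ ∧ σ ≤ τf ∧ (y σ).2.2 = (y τ).2.2 := by
  -- The end condition guarantees that an impact is not cut off at `τf`.
  have hlt : τ < τf := lt_of_le_of_ne hτ.1.2 fun h => by
    have := hτ.2.2
    rw [h] at this
    linarith
  have hcont : ContinuousWithinAt (fun r => S.c2 (y r)) (Icc 0 τf) τ :=
    (S.c2_continuous.comp_continuousOn (hy.continuousOn hτf.le)) τ hτ.1
  have hnear : ∀ᶠ r in 𝓝[>] τ, S.c2 (y r) < 0 ∧ r ≤ τf := by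
    have h1 := hcont.eventually_lt_const hτ.2.2
    have h2 : 𝓝[>] τ ≤ 𝓝[Icc 0 τf] τ := by
      rw [← nhdsWithin_Ioc_eq_nhdsGT hlt]
      exact nhdsWithin_mono _ fun r hr => ⟨hτ.1.1.trans hr.1.le, hr.2⟩
    filter_upwards [h2 h1, h2 self_mem_nhdsWithin] with r hr hr' using ⟨hr, hr'.2⟩
  obtain ⟨σ, hσ, hin⟩ := (mem_nhdsGT_iff_exists_Ioc_subset).1 hnear
  have hσ' : τ < σ := hσ
  have hσf : σ ≤ τf := (hin ⟨hσ', le_rfl⟩).2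
  have hsub : Icc τ σ ⊆ Icc 0 τf := Icc_subset_Icc hτ.1.1 hσf
  have hc2 : ∀ r ∈ Icc τ σ, S.c2 (y r) < 0 := fun r hr => by
    rcases hr.1.eq_or_lt with h | h
    · rw [← h]; exact hτ.2.2
    · exact (hin ⟨h, hr.2⟩).1
  have hanti := (hy.absCont_comp (c1_contDiff (S := S)) hτ.1.1 hσ'.le hσf).neg.monotoneOn (by
    filter_upwards [hy.ae_form haN] with r hr hm
    obtain ⟨θ, _, h1, _, hq, _⟩ := hr (hsub hm)
    refine ⟨_, (S.hasDerivAt_fc hq).neg, ?_⟩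
    have hv : S.vn (y r).1 (θ • (y r).2.1) = θ * S.c2 (y r) := inner_smul_right _ _ _
    rw [hv]
    nlinarith [hc2 r hm])
  -- While `c2 < 0` the gap is nonincreasing; it starts at `0` and cannot be negative. So all of
  -- `[τ, σ]` consists of impact points, and the clock does not move.
  have hc1 : ∀ r ∈ Icc τ σ, S.fc (y r).1 = 0 := fun r hr => by
    have h1 := hanti (left_mem_Icc.2 hσ'.le) hr hr.1
    have h2 : S.c1 (y τ) = 0 := hτ.2.1
    simp only [Pi.neg_apply, h2] at h1
    have h3 : S.c1 (y r) ≤ 0 := by simpa using h1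
    exact le_antisymm h3 (hy.gap_nonneg haN hτf h0 r (hsub hr))
  obtain ⟨C, hC⟩ := (hy.absCont_time hτ.1.1 hσ'.le hσf).const_of_ae_hasDerivAt_zero (by
    rw [uIcc_of_le hσ'.le]
    filter_upwards [hy.ae_cases haN hτf h0] with r hr hm
    rcases hr (hsub hm) with h | h
    · exact h.2.2.1
    · exact absurd ⟨hsub hm, hc1 r hm, hc2 r hm⟩ h.1)
  rw [uIcc_of_le hσ'.le] at hC
  exact ⟨σ, hσ', hσf, (hC σ (right_mem_Icc.2 hσ'.le)).trans (hC τ (left_mem_Icc.2 hσ'.le)).symm⟩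

/-- The interval `[a, b]` is the level set of the clock at the impact time. By `honce` it contains
all impact points, and by `frozen` all of `[a, b)` is impact. The point `b` is not, because the
clock would stay frozen beyond it. -/
theorem IsTFSolution.exists_impactPhase (hy : S.IsTFSolution aN uτ τf y) (haN : 0 < aN)
    (hτf : 0 < τf) (h0 : 0 ≤ S.fc (y 0).1) (hend : 0 ≤ S.vn (y τf).1 (y τf).2.1)
    (honce : ∀ τ ∈ S.impactSet τf y, ∀ σ ∈ S.impactSet τf y, (y τ).2.2 = (y σ).2.2) :
    ∃ a b, IsImpactPhase S τf y a b := by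
  -- if two points have the same time then the first one is an impact point
  have himp : ∀ τ ∈ Icc 0 τf, ∀ σ ∈ Icc 0 τf, τ < σ → (y τ).2.2 = (y σ).2.2 →
      τ ∈ S.impactSet τf y := fun τ hτ σ hσ hlt he => by
    obtain ⟨-, -, h1, h2⟩ := hy.frozen haN hτf h0 hτ.1 hlt hσ.2 he
    exact ⟨hτ, h1, h2 τ ⟨le_rfl, hlt⟩⟩
  rcases (S.impactSet τf y).eq_empty_or_nonempty with hemp | ⟨τ₀, hτ₀⟩
  · refine ⟨0, 0, le_rfl, le_rfl, hτf.le, by simp [hemp], ?_, fun τ hτ σ hσ he => Or.inl ?_, ?_,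
      fun h => absurd h (lt_irrefl _), fun h => absurd h (lt_irrefl _)⟩
    · intro τ hτ
      rw [le_antisymm hτ.2 hτ.1]
    · rcases lt_trichotomy τ σ with h | h | h
      · have := himp τ hτ σ hσ h he
        simp [hemp] at this
      · exact h
      · have := himp σ hσ τ hτ h he.symm
        simp [hemp] at this
    · intro τ hτ
      rw [le_antisymm hτ.2 hτ.1]
  · let Z := Icc 0 τf ∩ (fun τ => (y τ).2.2) ⁻¹' {(y τ₀).2.2}
    have hcont : ContinuousOn (fun τ => (y τ).2.2) (Icc 0 τf) :=
      (continuous_snd.comp continuous_snd).comp_continuousOn (hy.continuousOn hτf.le)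
    have hZ : IsCompact Z := isCompact_Icc.of_isClosed_subset
      (hcont.preimage_isClosed_of_isClosed isClosed_Icc isClosed_singleton) inter_subset_left
    have hne : Z.Nonempty := ⟨τ₀, hτ₀.1, rfl⟩
    obtain ⟨haI, hat⟩ := hZ.sInf_mem hne
    obtain ⟨hbI, hbt⟩ := hZ.sSup_mem hne
    have hle : ∀ τ ∈ Z, τ ∈ Icc (sInf Z) (sSup Z) := fun τ hτ =>
      ⟨csInf_le hZ.bddBelow hτ, le_csSup hZ.bddAbove hτ⟩
    set a := sInf Z
    set b := sSup Z
    replace hat : (y a).2.2 = (y τ₀).2.2 := hat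
    replace hbt : (y b).2.2 = (y τ₀).2.2 := hbt
    have hnext : ∀ τ ∈ S.impactSet τf y, ∃ σ ∈ Z, τ < σ := fun τ hτ => by
      obtain ⟨σ, h1, h2, h3⟩ := hy.exists_frozen haN hτf h0 hend hτ
      exact ⟨σ, ⟨⟨hτ.1.1.trans h1.le, h2⟩, h3.trans (honce τ hτ τ₀ hτ₀)⟩, h1⟩
    have hab : a < b := by
      obtain ⟨σ, hσ, hlt⟩ := hnext τ₀ hτ₀
      exact ((hle τ₀ ⟨hτ₀.1, rfl⟩).1.trans_lt hlt).trans_le (hle σ hσ).2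
    obtain ⟨h1, h2, h3, h4⟩ := hy.frozen haN hτf h0 haI.1 hab hbI.2 (hat.trans hbt.symm)
    have hmemZ : ∀ τ ∈ S.impactSet τf y, τ ∈ Z := fun τ hτ => ⟨hτ.1, honce τ hτ τ₀ hτ₀⟩
    have hbn : b ∉ S.impactSet τf y := fun h => by
      obtain ⟨σ, hσ, hlt⟩ := hnext b h
      exact absurd (hle σ hσ).2 (not_le.2 hlt)
    have hset : S.impactSet τf y = Ico a b := by
      ext τ
      refine ⟨fun h => ⟨(hle τ (hmemZ τ h)).1, lt_of_le_of_ne (hle τ (hmemZ τ h)).2 fun he =>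
        hbn (he ▸ h)⟩, fun h => ?_⟩
      refine ⟨⟨haI.1.trans h.1, h.2.le.trans hbI.2⟩, ?_, h4 τ h⟩
      rw [h2 τ ⟨h.1, h.2.le⟩, h3]
    refine ⟨a, b, haI.1, hab.le, hbI.2, hset, h1, fun τ hτ σ hσ he => ?_, h2, fun _ => h3,
      fun _ => ?_⟩
    · rcases lt_trichotomy τ σ with h | h | h
      · have h5 := hmemZ _ (himp τ hτ σ hσ h he)
        exact Or.inr ⟨hle τ h5, hle σ ⟨hσ, he.symm.trans h5.2⟩⟩
      · exact Or.inl h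
      · have h5 := hmemZ _ (himp σ hσ τ hτ h he.symm)
        exact Or.inr ⟨hle τ ⟨hτ, he.trans h5.2⟩, hle σ h5⟩
    · have hfb : S.fc (y b).1 = 0 := by rw [h2 b ⟨hab.le, le_rfl⟩, h3]
      -- `b` is a contact point outside the impact set, so `c2 ≥ 0` there; as a limit of negative
      -- values it is also `≤ 0`.
      have hge : 0 ≤ S.c2 (y b) := by
        by_contra! h
        exact hbn ⟨hbI, hfb, h⟩
      refine le_antisymm ?_ hge
      have hcw : ContinuousWithinAt (fun r => S.c2 (y r)) (Ico a b) b :=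
        ((S.c2_continuous.comp_continuousOn (hy.continuousOn hτf.le)) b hbI).mono fun r hr =>
          ⟨haI.1.trans hr.1, hr.2.le.trans hbI.2⟩
      have hmem : b ∈ closure (Ico a b) := by
        rw [closure_Ico hab.ne]; exact ⟨hab.le, le_rfl⟩
      have : (𝓝[Ico a b] b).NeBot := mem_closure_iff_nhdsWithin_neBot.1 hmem
      refine le_of_tendsto hcw ?_
      filter_upwards [self_mem_nhdsWithin] with r hr using (h4 r hr).le

end PlanarCLS

/-! ### Uniform constants on bounded sets -/

/-- `L` bounds the data of the system, their Lipschitz constants, and the inverses of `D` and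
`Dtan` at contact points, on the set of states and controls of norm at most `R`. -/
structure PlanarCLS.HasBounds {n m : ℕ} (S : PlanarCLS n m) (R L : ℝ) : Prop where
  one_le : 1 ≤ L
  fv_bd : ∀ q v u, ‖q‖ ≤ R → ‖v‖ ≤ R → ‖u‖ ≤ R → ‖S.fv q v u‖ ≤ L
  phi_bd : ∀ q v u i, ‖q‖ ≤ R → ‖v‖ ≤ R → ‖u‖ ≤ R → |S.phitilde q v u i| ≤ L
  nacc_bd : ∀ q, ‖q‖ ≤ R → ‖S.invM q (S.normal q)‖ ≤ L
  bacc_bd : ∀ q, ‖q‖ ≤ R → ‖S.invM q (S.b q)‖ ≤ L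
  Dtan_bd : ∀ q, ‖q‖ ≤ R → S.Dtan q ≤ L
  D_lower : ∀ q, ‖q‖ ≤ R → S.fc q = 0 → 1 ≤ L * S.D q
  Dtan_lower : ∀ q, ‖q‖ ≤ R → S.fc q = 0 → 1 ≤ L * S.Dtan q
  fv_lip : ∀ q v q' v' u e, ‖q‖ ≤ R → ‖v‖ ≤ R → ‖q'‖ ≤ R → ‖v'‖ ≤ R → ‖u‖ ≤ R →
    ‖q - q'‖ ≤ e → ‖v - v'‖ ≤ e → ‖S.fv q v u - S.fv q' v' u‖ ≤ L * e
  phi_lip : ∀ q v q' v' u i e, ‖q‖ ≤ R → ‖v‖ ≤ R → ‖q'‖ ≤ R → ‖v'‖ ≤ R → ‖u‖ ≤ R →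
    ‖q - q'‖ ≤ e → ‖v - v'‖ ≤ e → |S.phitilde q v u i - S.phitilde q' v' u i| ≤ L * e
  D_lip : ∀ q q' e, ‖q‖ ≤ R → ‖q'‖ ≤ R → ‖q - q'‖ ≤ e → |S.D q - S.D q'| ≤ L * e
  Dtan_lip : ∀ q q' e, ‖q‖ ≤ R → ‖q'‖ ≤ R → ‖q - q'‖ ≤ e → |S.Dtan q - S.Dtan q'| ≤ L * e
  nacc_lip : ∀ q q' e, ‖q‖ ≤ R → ‖q'‖ ≤ R → ‖q - q'‖ ≤ e →
    ‖S.invM q (S.normal q) - S.invM q' (S.normal q')‖ ≤ L * e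
  bacc_lip : ∀ q q' e, ‖q‖ ≤ R → ‖q'‖ ≤ R → ‖q - q'‖ ≤ e →
    ‖S.invM q (S.b q) - S.invM q' (S.b q')‖ ≤ L * e

namespace PlanarCLS

variable {n m : ℕ} (S : PlanarCLS n m)

/-- Compactness of the contact set in a ball. Positivity is known at contact points only, which is
why the bound is restricted to them. -/
theorem exists_contact_lower_bound (R : ℝ) : ∃ c > 0, ∀ q, ‖q‖ ≤ R → S.fc q = 0 →
    c ≤ S.D q ∧ c ≤ S.Dtan q := by
  have hK : IsCompact (Metric.closedBall (0 : EuclideanSpace ℝ (Fin n)) R ∩ S.fc ⁻¹' {0}) :=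
    (isCompact_closedBall _ _).inter_right (isClosed_singleton.preimage S.fc_smooth.continuous)
  have hmem : ∀ q, ‖q‖ ≤ R → S.fc q = 0 →
      q ∈ Metric.closedBall (0 : EuclideanSpace ℝ (Fin n)) R ∩ S.fc ⁻¹' {0} := fun q hq h =>
    ⟨by simpa using hq, h⟩
  rcases (Metric.closedBall (0 : EuclideanSpace ℝ (Fin n)) R ∩
    S.fc ⁻¹' {0}).eq_empty_or_nonempty with he | hne
  · exact ⟨1, one_pos, fun q hq h => absurd (hmem q hq h) (by simp [he])⟩
  · obtain ⟨q₁, h1, h1'⟩ := hK.exists_isMinOn hne S.D_contDiff.continuous.continuousOn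
    obtain ⟨q₂, h2, h2'⟩ := hK.exists_isMinOn hne S.Dtan_contDiff.continuous.continuousOn
    exact ⟨min (S.D q₁) (S.Dtan q₂), lt_min (S.D_pos h1.2) (S.Dtan_pos h2.2), fun q hq h =>
      ⟨(min_le_left _ _).trans (h1' (hmem q hq h)), (min_le_right _ _).trans (h2' (hmem q hq h))⟩⟩

theorem exists_hasBounds (R : ℝ) : ∃ L, S.HasBounds R L := by
  obtain ⟨c, hc, hlow⟩ := S.exists_contact_lower_bound R
  -- Bundling all data in one `C¹` map gives every bound and every Lipschitz estimate from a single
  -- compactness argument on a ball.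
  let G : EuclideanSpace ℝ (Fin n) × EuclideanSpace ℝ (Fin n) × EuclideanSpace ℝ (Fin m) →
      EuclideanSpace ℝ (Fin n) × (ℝ × ℝ) × (ℝ × ℝ) × EuclideanSpace ℝ (Fin n) ×
        EuclideanSpace ℝ (Fin n) := fun p =>
    (S.fv p.1 p.2.1 p.2.2, (S.phitilde p.1 p.2.1 p.2.2 0, S.phitilde p.1 p.2.1 p.2.2 1),
      (S.D p.1, S.Dtan p.1), S.invM p.1 (S.normal p.1), S.invM p.1 (S.b p.1))
  have hG : ContDiff ℝ 1 G := by
    have h12 : (1 : WithTop ℕ∞) ≤ 2 := by norm_num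
    refine (S.fv_smooth.of_le h12).prodMk (((S.phitilde_contDiff 0).prodMk
      (S.phitilde_contDiff 1)).prodMk (((((S.D_contDiff.of_le h12).comp contDiff_fst).prodMk
      ((S.Dtan_contDiff.of_le h12).comp contDiff_fst))).prodMk
      (((S.invM_normal_contDiff.of_le h12).comp contDiff_fst).prodMk
      ((S.invM_b_contDiff.of_le h12).comp contDiff_fst))))
  have hK := isCompact_closedBall (0 : EuclideanSpace ℝ (Fin n) × EuclideanSpace ℝ (Fin n) ×
    EuclideanSpace ℝ (Fin m)) R
  obtain ⟨B, hB⟩ := hK.exists_bound_of_continuousOn hG.continuous.continuousOn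
  obtain ⟨K, hKl⟩ := (hG.locallyLipschitz.locallyLipschitzOn
    (s := Metric.closedBall 0 R)).exists_lipschitzOnWith_of_compact hK
  have hmem : ∀ q v u, ‖q‖ ≤ R → ‖v‖ ≤ R → ‖u‖ ≤ R → ((q, v, u) : EuclideanSpace ℝ (Fin n) ×
      EuclideanSpace ℝ (Fin n) × EuclideanSpace ℝ (Fin m)) ∈ Metric.closedBall 0 R := by
    intro q v u hq hv hu
    rw [mem_closedBall_zero_iff, norm_prod_le_iff, norm_prod_le_iff]
    exact ⟨hq, hv, hu⟩
  let L := 1 + |B| + K + c⁻¹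
  have hBL : B ≤ L := by
    have := le_abs_self B
    have := inv_pos.2 hc
    have := K.2
    simp only [L]
    linarith [K.coe_nonneg]
  have hKL : (K : ℝ) ≤ L := by
    have := abs_nonneg B
    have := inv_pos.2 hc
    simp only [L]
    linarith
  have hcL : c⁻¹ ≤ L := by
    have := abs_nonneg B
    simp only [L]
    linarith [K.coe_nonneg]
  have hbd : ∀ q v u, ‖q‖ ≤ R → ‖v‖ ≤ R → ‖u‖ ≤ R → ‖G (q, v, u)‖ ≤ L := fun q v u hq hv hu =>
    (hB _ (hmem q v u hq hv hu)).trans hBL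
  have hlip : ∀ q v q' v' u e, ‖q‖ ≤ R → ‖v‖ ≤ R → ‖q'‖ ≤ R → ‖v'‖ ≤ R → ‖u‖ ≤ R →
      ‖q - q'‖ ≤ e → ‖v - v'‖ ≤ e → ‖G (q, v, u) - G (q', v', u)‖ ≤ L * e := by
    intro q v q' v' u e hq hv hq' hv' hu h1 h2
    have := hKl.norm_sub_le (hmem q v u hq hv hu) (hmem q' v' u hq' hv' hu)
    have he : 0 ≤ e := (norm_nonneg _).trans h1
    refine this.trans (mul_le_mul hKL ?_ (norm_nonneg _) (K.coe_nonneg.trans hKL))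
    rw [Prod.mk_sub_mk, Prod.mk_sub_mk, norm_prod_le_iff, norm_prod_le_iff]
    exact ⟨h1, h2, by simpa using he⟩
  have hR : ∀ q : EuclideanSpace ℝ (Fin n), ‖q‖ ≤ R → (0 : ℝ) ≤ R := fun q hq =>
    (norm_nonneg _).trans hq
  simp only [G, Prod.mk_sub_mk, norm_prod_le_iff, Real.norm_eq_abs] at hbd hlip
  have hz : ∀ {k : ℕ} {q : EuclideanSpace ℝ (Fin n)}, ‖q‖ ≤ R →
      ‖(0 : EuclideanSpace ℝ (Fin k))‖ ≤ R := fun hq => by rw [norm_zero]; exact hR _ hq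
  have hz' : ∀ {q q' : EuclideanSpace ℝ (Fin n)} {e : ℝ}, ‖q - q'‖ ≤ e →
      ‖(0 : EuclideanSpace ℝ (Fin n)) - 0‖ ≤ e := fun h => by
    rw [sub_zero, norm_zero]; exact (norm_nonneg _).trans h
  have hlow' : ∀ x, c ≤ x → 1 ≤ L * x := fun x hx => by
    calc (1 : ℝ) = c⁻¹ * c := (inv_mul_cancel₀ hc.ne').symm
      _ ≤ L * x := mul_le_mul hcL hx hc.le ((inv_pos.2 hc).le.trans hcL)
  refine ⟨L, ?_, fun q v u hq hv hu => (hbd q v u hq hv hu).1, fun q v u i hq hv hu => ?_,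
    fun q hq => (hbd q 0 0 hq (hz hq) (hz hq)).2.2.2.1,
    fun q hq => (hbd q 0 0 hq (hz hq) (hz hq)).2.2.2.2,
    fun q hq => (le_abs_self _).trans (hbd q 0 0 hq (hz hq) (hz hq)).2.2.1.2,
    fun q hq h => hlow' _ (hlow q hq h).1, fun q hq h => hlow' _ (hlow q hq h).2,
    fun q v q' v' u e hq hv hq' hv' hu h1 h2 => (hlip q v q' v' u e hq hv hq' hv' hu h1 h2).1,
    fun q v q' v' u i e hq hv hq' hv' hu h1 h2 => ?_,
    fun q q' e hq hq' h => (hlip q 0 q' 0 0 e hq (hz hq) hq' (hz hq) (hz hq) h (hz' h)).2.2.1.1,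
    fun q q' e hq hq' h => (hlip q 0 q' 0 0 e hq (hz hq) hq' (hz hq) (hz hq) h (hz' h)).2.2.1.2,
    fun q q' e hq hq' h => (hlip q 0 q' 0 0 e hq (hz hq) hq' (hz hq) (hz hq) h (hz' h)).2.2.2.1,
    fun q q' e hq hq' h => (hlip q 0 q' 0 0 e hq (hz hq) hq' (hz hq) (hz hq) h (hz' h)).2.2.2.2⟩
  · have := abs_nonneg B
    have := inv_pos.2 hc
    simp only [L]
    linarith [K.coe_nonneg]
  · have := (hbd q v u hq hv hu).2.1
    fin_cases i
    · exact this.1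
    · exact this.2
  · have := (hlip q v q' v' u e hq hv hq' hv' hu h1 h2).2.1
    fin_cases i
    · exact this.1
    · exact this.2

theorem HasBounds.contactAcc_le {S : PlanarCLS n m} {R L : ℝ} (h : S.HasBounds R L)
    {q : EuclideanSpace ℝ (Fin n)} (hq : ‖q‖ ≤ R) (l : Fin 2 → ℝ) :
    ‖S.contactAcc q l‖ ≤ L * (|l 0| + |l 1|) := by
  rw [contactAcc_eq]
  refine (norm_add_le _ _).trans ?_
  rw [norm_smul, norm_smul, Real.norm_eq_abs, Real.norm_eq_abs]
  nlinarith [h.nacc_bd q hq, h.bacc_bd q hq, abs_nonneg (l 0), abs_nonneg (l 1)]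

/-- The normal component is enough: along solutions Coulomb's law bounds the tangential one. -/
theorem HasBounds.modeForce_zero_le {S : PlanarCLS n m} {R L : ℝ} (h : S.HasBounds R L)
    {q v : EuclideanSpace ℝ (Fin n)} {u : EuclideanSpace ℝ (Fin m)} (hq : ‖q‖ ≤ R) (hv : ‖v‖ ≤ R)
    (hu : ‖u‖ ≤ R) : |S.modeForce q v u 0| ≤ L * L := by
  have h1 := h.one_le
  by_cases hc : S.fc q = 0 ∧ S.vn q v = 0
  · have hD := S.D_pos hc.1
    have h2 := h.D_lower q hq hc.1
    have h3 := h.phi_bd q v u 0 hq hv hu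
    rw [modeForce_eq, if_pos hc]
    simp only [Matrix.cons_val_zero, abs_neg, abs_mul, phi_eq, abs_inv, abs_of_pos hD]
    refine mul_le_mul ?_ h3 (abs_nonneg _) (by linarith)
    rw [inv_le_iff_one_le_mul₀ hD]
    exact h2
  · rw [S.modeForce_of_not hc]
    simpa using mul_self_nonneg L

theorem measurable_sign : Measurable Real.sign := by
  unfold Real.sign
  exact Measurable.ite measurableSet_Iio measurable_const
    (Measurable.ite measurableSet_Ioi measurable_const measurable_const)

theorem measurable_modeForce : Measurable
    (fun p : EuclideanSpace ℝ (Fin n) × EuclideanSpace ℝ (Fin n) × EuclideanSpace ℝ (Fin m) =>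
      S.modeForce p.1 p.2.1 p.2.2) := by
  classical
  have hfc : Measurable fun p : EuclideanSpace ℝ (Fin n) × EuclideanSpace ℝ (Fin n) ×
      EuclideanSpace ℝ (Fin m) => S.fc p.1 := S.fc_smooth.continuous.measurable.comp measurable_fst
  have hqv : Continuous fun p : EuclideanSpace ℝ (Fin n) × EuclideanSpace ℝ (Fin n) ×
      EuclideanSpace ℝ (Fin m) => (p.1, p.2.1) :=
    continuous_fst.prodMk (continuous_fst.comp continuous_snd)
  have hvn : Measurable fun p : EuclideanSpace ℝ (Fin n) × EuclideanSpace ℝ (Fin n) ×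
      EuclideanSpace ℝ (Fin m) => S.vn p.1 p.2.1 := (S.vn_contDiff.continuous.comp hqv).measurable
  have hvt : Measurable fun p : EuclideanSpace ℝ (Fin n) × EuclideanSpace ℝ (Fin n) ×
      EuclideanSpace ℝ (Fin m) => S.vt p.1 p.2.1 := (S.vt_contDiff.continuous.comp hqv).measurable
  have hD : Measurable fun p : EuclideanSpace ℝ (Fin n) × EuclideanSpace ℝ (Fin n) ×
      EuclideanSpace ℝ (Fin m) => S.D p.1 :=
    S.D_contDiff.continuous.measurable.comp measurable_fst
  have hT : Measurable fun p : EuclideanSpace ℝ (Fin n) × EuclideanSpace ℝ (Fin n) ×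
      EuclideanSpace ℝ (Fin m) => S.Dtan p.1 :=
    S.Dtan_contDiff.continuous.measurable.comp measurable_fst
  have hp := fun i => (S.phitilde_contDiff i).continuous.measurable
  have hset : MeasurableSet {p : EuclideanSpace ℝ (Fin n) × EuclideanSpace ℝ (Fin n) ×
      EuclideanSpace ℝ (Fin m) | S.fc p.1 = 0 ∧ S.vn p.1 p.2.1 = 0} :=
    (hfc (measurableSet_singleton 0)).inter (hvn (measurableSet_singleton 0))
  simp only [modeForce_eq, phi_eq]
  refine Measurable.ite hset (measurable_pi_iff.2 fun i => ?_) measurable_const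
  fin_cases i
  · exact (hD.inv.mul (hp 0)).neg
  · refine Measurable.ite (hvt (measurableSet_singleton 0)) (hT.inv.mul (hp 1)).neg ?_
    exact (hD.inv.mul (hp 0)).mul ((measurable_sign.comp hvt).const_mul _)

end PlanarCLS

/-! ### From numerical time to physical time -/

/-- The last numerical time in `[0, τf]` whose physical time is at most `t`. -/
def lastTime {n : ℕ} (τf : ℝ) (y : ℝ → TFState n) (t : ℝ) : ℝ :=
  sSup {τ | τ ∈ Icc 0 τf ∧ (y τ).2.2 ≤ t}

/-- A solution of the time-freezing system with impact phase `[a, b]`, whose control comes from the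
control `u` in physical time. -/
structure IsTFMotion {n m : ℕ} (S : PlanarCLS n m) (aN τf : ℝ)
    (uτ u : ℝ → EuclideanSpace ℝ (Fin m)) (y : ℝ → TFState n) (a b : ℝ) : Prop where
  aN_pos : 0 < aN
  τf_pos : 0 < τf
  sol : S.IsTFSolution aN uτ τf y
  gap_zero : 0 ≤ S.fc (y 0).1
  time_zero : (y 0).2.2 = 0
  u_meas : Measurable u
  u_bdd : ∃ C, ∀ t ∈ Icc 0 (y τf).2.2, ‖u t‖ ≤ C
  u_eq : ∀ᵐ τ ∂volume, τ ∈ Icc 0 τf → 0 < deriv (fun σ => (y σ).2.2) τ → uτ τ = u (y τ).2.2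
  phase : IsImpactPhase S τf y a b

namespace IsTFMotion

variable {n m : ℕ} {S : PlanarCLS n m} {aN τf a b : ℝ} {uτ u : ℝ → EuclideanSpace ℝ (Fin m)}
  {y : ℝ → TFState n} (h : IsTFMotion S aN τf uτ u y a b)

include h

theorem monotoneOn : MonotoneOn (fun τ => (y τ).2.2) (Icc 0 τf) :=
  h.sol.time_monotoneOn h.aN_pos h.τf_pos.le

theorem lipschitzOn : LipschitzOnWith 1 (fun τ => (y τ).2.2) (Icc 0 τf) :=
  h.sol.time_lipschitzOn h.aN_pos h.τf_pos.le

theorem continuousOn : ContinuousOn y (Icc 0 τf) := h.sol.continuousOn h.τf_pos.le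

theorem time_mem {τ : ℝ} (hτ : τ ∈ Icc 0 τf) : (y τ).2.2 ∈ Icc 0 (y τf).2.2 := by
  have h0 : (0 : ℝ) ∈ Icc 0 τf := ⟨le_rfl, h.τf_pos.le⟩
  refine ⟨?_, h.monotoneOn hτ ⟨h.τf_pos.le, le_rfl⟩ hτ.2⟩
  have := h.monotoneOn h0 hτ hτ.1
  simpa [h.time_zero] using this

theorem image_time : (fun τ => (y τ).2.2) '' Icc 0 τf = Icc 0 (y τf).2.2 := by
  have := h.lipschitzOn.continuousOn.image_Icc_of_monotoneOn h.τf_pos.le h.monotoneOn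
  rwa [h.time_zero] at this

theorem end_nonneg : 0 ≤ (y τf).2.2 := (h.time_mem ⟨h.τf_pos.le, le_rfl⟩).1

theorem lastTime_mem (t : ℝ) : lastTime τf y t ∈ Icc 0 τf :=
  ⟨Real.sSup_nonneg fun _ hτ => hτ.1.1, Real.sSup_le (fun _ hτ => hτ.1.2) h.τf_pos.le⟩

theorem le_lastTime {τ t : ℝ} (hτ : τ ∈ Icc 0 τf) (ht : (y τ).2.2 ≤ t) : τ ≤ lastTime τf y t :=
  le_csSup ⟨τf, fun _ hσ => hσ.1.2⟩ ⟨hτ, ht⟩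

theorem lastTime_monotone : Monotone (lastTime τf y) := fun s t hst => by
  -- For negative `s` the set is empty and its supremum is `0` by convention, which keeps `lastTime`
  -- monotone on all of `ℝ`.
  rcases {τ | τ ∈ Icc 0 τf ∧ (y τ).2.2 ≤ s}.eq_empty_or_nonempty with he | hne
  · rw [lastTime, he, Real.sSup_empty]
    exact (h.lastTime_mem t).1
  · exact csSup_le hne fun τ hτ => h.le_lastTime hτ.1 (hτ.2.trans hst)

theorem time_lastTime {t : ℝ} (ht : t ∈ Icc 0 (y τf).2.2) : (y (lastTime τf y t)).2.2 = t := by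
  have h0 : (0 : ℝ) ∈ Icc 0 τf := ⟨le_rfl, h.τf_pos.le⟩
  have hK : IsCompact (Icc 0 τf ∩ (fun τ => (y τ).2.2) ⁻¹' Iic t) :=
    isCompact_Icc.of_isClosed_subset (h.lipschitzOn.continuousOn.preimage_isClosed_of_isClosed
      isClosed_Icc isClosed_Iic) inter_subset_left
  have hmem := hK.sSup_mem ⟨0, h0, by
    have := ht.1
    simpa [h.time_zero] using this⟩
  refine le_antisymm hmem.2 ?_
  rw [← h.image_time] at ht
  obtain ⟨τ, hτ, he⟩ := ht
  have he' : (y τ).2.2 = t := he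
  have := h.monotoneOn hτ (h.lastTime_mem t) (h.le_lastTime hτ he'.le)
  rw [← he']
  simpa [he'] using this

theorem subset : Icc a b ⊆ Icc 0 τf := Icc_subset_Icc h.phase.nonneg h.phase.le_end

/-- The clock is injective off the impact phase, and within the phase the last time is `b`. Hence
`unfreeze` takes the post-impact state at the impact time. -/
theorem lastTime_time {τ : ℝ} (hτ : τ ∈ Icc 0 τf) (hn : τ ∉ Ico a b) :
    lastTime τf y (y τ).2.2 = τ := by
  have h1 := h.le_lastTime hτ le_rfl
  rcases h.phase.time_inj _ (h.lastTime_mem (y τ).2.2) τ hτ (h.time_lastTime (h.time_mem hτ))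
    with h2 | ⟨h2, h3⟩
  · exact h2
  · have : τ = b := by
      by_contra hne
      exact hn ⟨h3.1, lt_of_le_of_ne h3.2 hne⟩
    exact le_antisymm (this ▸ h2.2) h1

theorem lastTime_impact : lastTime τf y (y a).2.2 = b := by
  have hb : b ∈ Icc a b := ⟨h.phase.le, le_rfl⟩
  rw [← h.phase.time_eq b hb]
  exact h.lastTime_time (h.subset hb) fun hc => lt_irrefl _ hc.2

/-- The derivative of a solution in terms of the control `u` in physical time. -/
theorem ae_cases :
    ∀ᵐ τ, τ ∈ Icc 0 τf →
      (τ ∈ Ico a b ∧ HasDerivAt (fun σ => (y σ).1) 0 τ ∧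
        HasDerivAt (fun σ => (y σ).2.2) 0 τ ∧ ∃ s : ℝ, S.MaxDissipation aN (S.c3 (y τ)) s ∧
        HasDerivAt (fun σ => (y σ).2.1) (S.contactAcc (y τ).1 ![aN, s]) τ) ∨
      (τ ∉ Ico a b ∧ ∃ θ : ℝ, 0 < θ ∧ θ ≤ 1 ∧
        HasDerivAt (fun σ => (y σ).1) (θ • (y τ).2.1) τ ∧
        HasDerivAt (fun σ => (y σ).2.1) (θ • (S.fv (y τ).1 (y τ).2.1 (u (y τ).2.2) +
          S.contactAcc (y τ).1 (S.modeForce (y τ).1 (y τ).2.1 (u (y τ).2.2)))) τ ∧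
        HasDerivAt (fun σ => (y σ).2.2) θ τ ∧
        S.MaxDissipation (S.modeForce (y τ).1 (y τ).2.1 (u (y τ).2.2) 0) (S.c3 (y τ))
          (S.modeForce (y τ).1 (y τ).2.1 (u (y τ).2.2) 1)) := by
  filter_upwards [h.sol.ae_cases h.aN_pos h.τf_pos h.gap_zero, h.u_eq] with τ hτ hu hm
  rw [h.phase.impactSet_eq] at hτ
  refine (hτ hm).imp id fun ⟨h1, θ, h2, h3, h4, h5, h6, h7⟩ => ?_
  have hc := hu hm (by rw [h6.deriv]; exact h2)
  rw [hc] at h5 h7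
  exact ⟨h1, θ, h2, h3, h4, h5, h6, h7⟩

/-- Almost everywhere properties in numerical time, off the impact phase, transfer to physical
time. -/
theorem ae_transfer {p : ℝ → Prop} (hp : ∀ᵐ τ, τ ∈ Icc 0 τf → τ ∉ Ico a b → p τ) :
    ∀ᵐ t, t ∈ Icc 0 (y τf).2.2 → p (lastTime τf y t) := by
  filter_upwards [h.lipschitzOn.ae_image hp, Measure.ae_ne volume (y a).2.2] with t ht hne hm
  rw [← h.image_time] at hm
  obtain ⟨τ, hτ, he, hpt⟩ := ht hm
  have hn : τ ∉ Ico a b := fun hc => hne (he ▸ h.phase.time_eq τ ⟨hc.1, hc.2.le⟩)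
  have he' : (y τ).2.2 = t := he
  rw [← he', h.lastTime_time hτ hn]
  exact hpt hn

theorem measurable_state : Measurable fun t => y (lastTime τf y t) := by
  have hc : Continuous (IccExtend h.τf_pos.le ((Icc 0 τf).domRestrict y)) :=
    continuous_IccExtend_iff.2 (continuousOn_iff_continuous_domRestrict.1 h.continuousOn)
  have := hc.measurable.comp h.lastTime_monotone.measurable
  convert this using 1
  funext t
  simp only [Function.comp_apply]
  rw [IccExtend_of_mem _ _ (h.lastTime_mem t)]
  rfl

end IsTFMotion

open Classical in
/-- The trajectory of the complementarity system obtained from a time-freezing trajectory with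
impact phase `[a, b]`. -/
def unfreeze {n m : ℕ} (S : PlanarCLS n m) (aN τf : ℝ) (u : ℝ → EuclideanSpace ℝ (Fin m))
    (y : ℝ → TFState n) (a b : ℝ) : CLSTrajectory n where
  q t := (y (lastTime τf y t)).1
  v t := (y (lastTime τf y t)).2.1
  lam t := S.modeForce (y (lastTime τf y t)).1 (y (lastTime τf y t)).2.1 (u t)
  J := if a < b then {(y a).2.2} else ∅
  P _ := ![aN * (b - a), (S.c3 (y b) - S.c3 (y a)) / S.Dtan (y a).1]

/-! ### The equations of motion of the unfrozen trajectory -/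

namespace IsTFMotion

variable {n m : ℕ} {S : PlanarCLS n m} {aN τf a b : ℝ} {uτ u : ℝ → EuclideanSpace ℝ (Fin m)}
  {y : ℝ → TFState n} (h : IsTFMotion S aN τf uτ u y a b)

theorem mem_J {t : ℝ} : t ∈ (unfreeze S aN τf u y a b).J ↔ a < b ∧ t = (y a).2.2 := by
  unfold unfreeze
  by_cases hab : a < b <;> simp [hab]

include h

theorem measurable_q : Measurable (unfreeze S aN τf u y a b).q :=
  measurable_fst.comp h.measurable_state

theorem measurable_v : Measurable (unfreeze S aN τf u y a b).v :=
  measurable_fst.comp (measurable_snd.comp h.measurable_state)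

theorem measurable_lam : Measurable (unfreeze S aN τf u y a b).lam :=
  S.measurable_modeForce.comp (h.measurable_q.prodMk (h.measurable_v.prodMk h.u_meas))

/-- A common bound for states and controls. -/
theorem exists_bound : ∃ R, ∀ t ∈ Icc 0 (y τf).2.2,
    ‖(unfreeze S aN τf u y a b).q t‖ ≤ R ∧ ‖(unfreeze S aN τf u y a b).v t‖ ≤ R ∧ ‖u t‖ ≤ R := by
  obtain ⟨C, hC⟩ := isCompact_Icc.exists_bound_of_continuousOn h.continuousOn
  obtain ⟨C', hC'⟩ := h.u_bdd
  refine ⟨max C C', fun t ht => ?_⟩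
  have h1 := hC _ (h.lastTime_mem t)
  exact ⟨(norm_fst_le _).trans (h1.trans (le_max_left _ _)),
    (norm_fst_le _).trans ((norm_snd_le _).trans (h1.trans (le_max_left _ _))),
    (hC' t ht).trans (le_max_right _ _)⟩

theorem ae_maxDissipation : ∀ᵐ t, t ∈ Icc 0 (y τf).2.2 →
    S.MaxDissipation ((unfreeze S aN τf u y a b).lam t 0)
      (S.vt ((unfreeze S aN τf u y a b).q t) ((unfreeze S aN τf u y a b).v t))
      ((unfreeze S aN τf u y a b).lam t 1) := by
  have := h.ae_transfer (p := fun τ => S.MaxDissipation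
    (S.modeForce (y τ).1 (y τ).2.1 (u (y τ).2.2) 0) (S.c3 (y τ))
      (S.modeForce (y τ).1 (y τ).2.1 (u (y τ).2.2) 1)) (by
    filter_upwards [h.ae_cases] with τ hτ hm hn
    rcases hτ hm with h1 | ⟨_, θ, _, _, _, _, _, h2⟩
    · exact absurd h1.1 hn
    · exact h2)
  filter_upwards [this] with t ht hm
  have h1 := ht hm
  rw [h.time_lastTime hm] at h1
  exact h1

theorem integrableOn_of_bounded {F : Type*} [NormedAddCommGroup F] {f : ℝ → F} {C : ℝ}
    (hf : AEStronglyMeasurable f volume)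
    (hC : ∀ᵐ t, t ∈ Icc 0 (y τf).2.2 → ‖f t‖ ≤ C) : IntegrableOn f (Icc 0 (y τf).2.2) := by
  refine Measure.integrableOn_of_bounded (M := C) (by simp) hf ?_
  exact (ae_restrict_iff' measurableSet_Icc).2 hC

theorem v_integrable : IntegrableOn (unfreeze S aN τf u y a b).v (Icc 0 (y τf).2.2) := by
  obtain ⟨R, hR⟩ := h.exists_bound
  exact h.integrableOn_of_bounded h.measurable_v.aestronglyMeasurable
    (Eventually.of_forall fun t ht => (hR t ht).2.1)

theorem fv_integrable : IntegrableOn (fun s => S.fv ((unfreeze S aN τf u y a b).q s)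
    ((unfreeze S aN τf u y a b).v s) (u s)) (Icc 0 (y τf).2.2) := by
  obtain ⟨R, hR⟩ := h.exists_bound
  obtain ⟨L, hL⟩ := S.exists_hasBounds R
  refine h.integrableOn_of_bounded (C := L) ?_ (Eventually.of_forall fun t ht =>
    hL.fv_bd _ _ _ (hR t ht).1 (hR t ht).2.1 (hR t ht).2.2)
  exact (S.fv_smooth.continuous.measurable.comp
    (h.measurable_q.prodMk (h.measurable_v.prodMk h.u_meas))).aestronglyMeasurable

theorem ae_lam_bound : ∃ C, ∀ᵐ t, t ∈ Icc 0 (y τf).2.2 →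
    |(unfreeze S aN τf u y a b).lam t 0| ≤ C ∧ |(unfreeze S aN τf u y a b).lam t 1| ≤ C := by
  obtain ⟨R, hR⟩ := h.exists_bound
  obtain ⟨L, hL⟩ := S.exists_hasBounds R
  have hμ := S.μ_pos
  refine ⟨max (L * L) (S.μ * (L * L)), ?_⟩
  filter_upwards [h.ae_maxDissipation] with t ht hm
  have h1 : |(unfreeze S aN τf u y a b).lam t 0| ≤ L * L :=
    hL.modeForce_zero_le (hR t hm).1 (hR t hm).2.1 (hR t hm).2.2
  have h2 := (S.maxDissipation_iff.1 (ht hm)).1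
  refine ⟨h1.trans (le_max_left _ _), h2.trans (le_trans ?_ (le_max_right _ _))⟩
  have := le_abs_self ((unfreeze S aN τf u y a b).lam t 0)
  exact mul_le_mul_of_nonneg_left (this.trans h1) hμ.le

theorem lam_integrable : IntegrableOn (unfreeze S aN τf u y a b).lam (Icc 0 (y τf).2.2) := by
  obtain ⟨C, hC⟩ := h.ae_lam_bound
  refine h.integrableOn_of_bounded (C := C) h.measurable_lam.aestronglyMeasurable ?_
  filter_upwards [hC] with t ht hm
  rw [pi_norm_le_iff_of_nonempty]
  intro i
  fin_cases i
  · exact (ht hm).1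
  · exact (ht hm).2

theorem acc_integrable : IntegrableOn (fun s => S.fv ((unfreeze S aN τf u y a b).q s)
    ((unfreeze S aN τf u y a b).v s) (u s) + S.contactAcc ((unfreeze S aN τf u y a b).q s)
      ((unfreeze S aN τf u y a b).lam s)) (Icc 0 (y τf).2.2) := by
  refine h.fv_integrable.add ?_
  obtain ⟨R, hR⟩ := h.exists_bound
  obtain ⟨L, hL⟩ := S.exists_hasBounds R
  obtain ⟨C, hC⟩ := h.ae_lam_bound
  refine h.integrableOn_of_bounded (C := L * (C + C)) ?_ ?_
  · simp only [S.contactAcc_eq]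
    have hl := measurable_pi_iff.1 h.measurable_lam
    exact (((hl 0).smul (S.invM_normal_contDiff.continuous.measurable.comp h.measurable_q)).add
      ((hl 1).smul (S.invM_b_contDiff.continuous.measurable.comp
        h.measurable_q))).aestronglyMeasurable
  · filter_upwards [hC] with t ht hm
    refine (hL.contactAcc_le (hR t hm).1 _).trans ?_
    have := hL.one_le
    exact mul_le_mul_of_nonneg_left (add_le_add (ht hm).1 (ht hm).2) (by linarith)

/-- Integration in physical time along a piece of the time-freezing trajectory. -/
theorem sub_eq_integral {F : Type*} [NormedAddCommGroup F] [NormedSpace ℝ F]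
    [FiniteDimensional ℝ F] {g : ℝ → F} {H : ℝ → F} {c d : ℝ} (hc : 0 ≤ c) (hcd : c ≤ d)
    (hd : d ≤ τf) (hg : AbsolutelyContinuousOnInterval g c d)
    (hH : ∀ᵐ τ, τ ∈ Icc c d → ∃ θ, HasDerivAt (fun σ => (y σ).2.2) θ τ ∧
      HasDerivAt g (θ • H (y τ).2.2) τ) :
    g d - g c = ∫ t in (y c).2.2..(y d).2.2, H t := by
  have hsub : Icc c d ⊆ Icc 0 τf := Icc_subset_Icc hc hd
  rw [integral_comp_smul_of_monotoneOn_of_lipschitzOnWith (φ := fun τ => (y τ).2.2)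
    (θ := deriv fun σ => (y σ).2.2) hcd (h.monotoneOn.mono hsub) (h.lipschitzOn.mono hsub) ?_ H]
  · refine (hg.integrable_and_integral_eq ?_).2.symm
    rw [uIcc_of_le hcd]
    filter_upwards [hH] with τ hτ hm
    obtain ⟨θ, h1, h2⟩ := hτ hm
    rwa [h1.deriv]
  · filter_upwards [hH] with τ hτ hm
    obtain ⟨θ, h1, h2⟩ := hτ hm
    rwa [h1.deriv]

theorem position {t : ℝ} (ht : t ∈ Icc 0 (y τf).2.2) : (unfreeze S aN τf u y a b).q t =
    (y 0).1 + ∫ s in (0 : ℝ)..t, (unfreeze S aN τf u y a b).v s := by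
  have hm := h.lastTime_mem t
  have := h.sub_eq_integral (g := fun τ => (y τ).1) (H := (unfreeze S aN τf u y a b).v) le_rfl
    hm.1 hm.2 (h.sol.absCont_comp contDiff_fst le_rfl hm.1 hm.2) (by
      filter_upwards [h.ae_cases] with τ hτ hτm
      have hτm' : τ ∈ Icc 0 τf := ⟨hτm.1, hτm.2.trans hm.2⟩
      rcases hτ hτm' with ⟨_, h1, h2, _⟩ | ⟨hn, θ, _, _, h1, _, h2, _⟩
      -- During the impact both the clock and the position rest, so the value of the integrand at
      -- the impact time is irrelevant.
      · exact ⟨0, h2, by simpa using h1⟩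
      · refine ⟨θ, h2, ?_⟩
        simp only [unfreeze]
        rw [h.lastTime_time hτm' hn]
        exact h1)
  rw [h.time_zero, h.time_lastTime ht] at this
  rw [← this]
  simp [unfreeze]

/-- The right end `d` may belong to the impact phase, so that a segment can stop exactly at `a`. -/
theorem velocity_segment {c d : ℝ} (hc : 0 ≤ c) (hcd : c ≤ d) (hd : d ≤ τf)
    (hn : ∀ τ ∈ Icc c d, τ ≠ d → τ ∉ Ico a b) : (y d).2.1 - (y c).2.1 =
    ∫ s in (y c).2.2..(y d).2.2, (S.fv ((unfreeze S aN τf u y a b).q s)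
      ((unfreeze S aN τf u y a b).v s) (u s) + S.contactAcc ((unfreeze S aN τf u y a b).q s)
        ((unfreeze S aN τf u y a b).lam s)) := by
  refine h.sub_eq_integral (g := fun τ => (y τ).2.1) (H := fun s =>
    S.fv ((unfreeze S aN τf u y a b).q s) ((unfreeze S aN τf u y a b).v s) (u s) +
      S.contactAcc ((unfreeze S aN τf u y a b).q s) ((unfreeze S aN τf u y a b).lam s)) hc hcd hd
    (h.sol.absCont_comp (contDiff_fst.comp contDiff_snd) hc hcd hd) ?_
  filter_upwards [h.ae_cases, Measure.ae_ne volume d] with τ hτ hne hτm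
  have hτm' : τ ∈ Icc 0 τf := ⟨hc.trans hτm.1, hτm.2.trans hd⟩
  have hni := hn τ hτm hne
  rcases hτ hτm' with ⟨h1, _⟩ | ⟨_, θ, _, _, _, h1, h2, _⟩
  · exact absurd h1 hni
  · refine ⟨θ, h2, ?_⟩
    simp only [unfreeze]
    rw [h.lastTime_time hτm' hni]
    exact h1

/-- Almost everywhere derivative during the impact phase. -/
theorem ae_impact : ∀ᵐ τ, τ ∈ Icc a b → ∃ s : ℝ, S.MaxDissipation aN (S.c3 (y τ)) s ∧
    HasDerivAt (fun σ => (y σ).2.1) (S.contactAcc (y a).1 ![aN, s]) τ ∧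
    HasDerivAt (fun σ => S.c3 (y σ)) (S.Dtan (y a).1 * s) τ := by
  filter_upwards [h.ae_cases, Measure.ae_ne volume b] with τ hτ hne hm
  have hI : τ ∈ Ico a b := ⟨hm.1, lt_of_le_of_ne hm.2 hne⟩
  rcases hτ (h.subset hm) with ⟨_, h1, _, s, h2, h3⟩ | h1
  · have hq := h.phase.position_eq τ hm
    have hf : S.fc (y τ).1 = 0 := by rw [hq, h.phase.contact (hI.1.trans_lt hI.2)]
    have h4 := S.hasDerivAt_col 1 h1 h3
    rw [show S.col 1 (y τ).1 = S.b (y τ).1 from rfl, S.inner_b_contactAcc hf] at h4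
    simp only [map_zero, inner_zero_left, add_zero, Matrix.cons_val_one,
      Matrix.cons_val_fin_one] at h4
    exact ⟨s, h2, hq ▸ h3, hq ▸ h4⟩
  · exact absurd hI h1.1

/-- At frozen position `c3` has slope `Dtan * s` with `s` obeying Coulomb's law for the constant
normal force `aN`: dry friction with the constant rate `Dtan * μ * aN`. -/
theorem impact_friction_dry (hab : a < b) :
    |S.c3 (y b) - S.c3 (y a)| =
      ∫ τ in a..b, S.Dtan (y a).1 * (S.μ * aN) * |Real.sign (S.c3 (y τ))| ∧
    |S.c3 (y b) - S.c3 (y a)| ≤ S.Dtan (y a).1 * (S.μ * aN) * (b - a) ∧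
    (0 < S.c3 (y b) → S.c3 (y b) - S.c3 (y a) = -(S.Dtan (y a).1 * (S.μ * aN) * (b - a))) ∧
    (S.c3 (y b) < 0 → S.c3 (y b) - S.c3 (y a) = S.Dtan (y a).1 * (S.μ * aN) * (b - a)) := by
  have hT := S.Dtan_pos (h.phase.contact hab)
  have hμ := S.μ_pos
  have ha := h.aN_pos
  refine (h.sol.absCont_comp (PlanarCLS.c3_contDiff (S := S)) h.phase.nonneg hab.le
    h.phase.le_end).dry_friction hab.le (by positivity) ?_
  filter_upwards [h.ae_impact] with τ hτ hm
  obtain ⟨s, h1, _, h2⟩ := hτ hm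
  rw [S.maxDissipation_iff] at h1
  exact ⟨_, h2, fun h3 => by rw [h1.2.1 h3]; ring, fun h3 => by rw [h1.2.2 h3]⟩

/-- The accumulated tangential impulse can be read off from the change of `c3`. Subtracting it and
the linearly growing normal impulse from the velocity leaves a curve with zero derivative, so the
unknown friction selection need not be integrated. -/
theorem velocity_jump (hab : a < b) : (y b).2.1 - (y a).2.1 =
    S.contactAcc (y a).1 ![aN * (b - a), (S.c3 (y b) - S.c3 (y a)) / S.Dtan (y a).1] := by
  have hT := S.Dtan_pos (h.phase.contact hab)
  have hac : AbsolutelyContinuousOnInterval (fun τ => (y τ).2.1 -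
      (τ * aN) • S.invM (y a).1 (S.normal (y a).1) -
      (S.c3 (y τ) / S.Dtan (y a).1) • S.invM (y a).1 (S.b (y a).1)) a b := by
    have h1 : AbsolutelyContinuousOnInterval (fun τ => (y τ).2.1) a b :=
      h.sol.absCont_comp (contDiff_fst.comp contDiff_snd) h.phase.nonneg hab.le h.phase.le_end
    have h2 : AbsolutelyContinuousOnInterval (fun τ : ℝ =>
        (τ * aN) • S.invM (y a).1 (S.normal (y a).1)) a b :=
      ContDiffOn.absolutelyContinuousOnInterval
        ((contDiff_id.mul contDiff_const).smul contDiff_const).contDiffOn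
    have h3 : AbsolutelyContinuousOnInterval (fun τ =>
        (S.c3 (y τ) / S.Dtan (y a).1) • S.invM (y a).1 (S.b (y a).1)) a b :=
      h.sol.absCont_comp (g := fun z => (S.c3 z / S.Dtan (y a).1) • S.invM (y a).1 (S.b (y a).1))
        (((PlanarCLS.c3_contDiff (S := S)).div_const _).smul contDiff_const) h.phase.nonneg hab.le
        h.phase.le_end
    exact (h1.sub h2).sub h3
  obtain ⟨C, hC⟩ := hac.const_of_ae_hasDerivAt_zero (by
    rw [uIcc_of_le hab.le]
    filter_upwards [h.ae_impact] with τ hτ hm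
    obtain ⟨s, _, h1, h2⟩ := hτ hm
    refine ((h1.sub (((hasDerivAt_id τ).mul_const aN).smul_const
      (S.invM (y a).1 (S.normal (y a).1)))).sub ((h2.div_const (S.Dtan (y a).1)).smul_const
      (S.invM (y a).1 (S.b (y a).1)))).congr_deriv ?_
    rw [S.contactAcc_eq, mul_div_cancel_left₀ _ hT.ne']
    simp)
  rw [uIcc_of_le hab.le] at hC
  have e := (hC b (right_mem_Icc.2 hab.le)).trans (hC a (left_mem_Icc.2 hab.le)).symm
  rw [S.contactAcc_eq]
  simp only [Matrix.cons_val_zero, Matrix.cons_val_one, sub_div, mul_sub, sub_smul]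
  rw [← sub_eq_zero] at e ⊢
  rw [← e, mul_comm b, mul_comm a]
  abel

/-- Beyond the impact the numerical interval splits at `a` and `b` into two smooth segments, which
are adjacent in physical time, and the jump between them. -/
theorem velocity {t : ℝ} (ht : t ∈ Icc 0 (y τf).2.2) : (unfreeze S aN τf u y a b).v t = (y 0).2.1 +
    (∫ s in (0 : ℝ)..t, (S.fv ((unfreeze S aN τf u y a b).q s)
      ((unfreeze S aN τf u y a b).v s) (u s) + S.contactAcc ((unfreeze S aN τf u y a b).q s)
        ((unfreeze S aN τf u y a b).lam s))) +
    ∑ s ∈ (unfreeze S aN τf u y a b).J.filter (fun s => s ≤ t),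
      S.contactAcc ((unfreeze S aN τf u y a b).q s) ((unfreeze S aN τf u y a b).P s) := by
  have hm := h.lastTime_mem t
  have haf : a ∈ Icc 0 τf := h.subset ⟨le_rfl, h.phase.le⟩
  have hbf : b ∈ Icc 0 τf := h.subset ⟨h.phase.le, le_rfl⟩
  by_cases hc : a < b ∧ (y a).2.2 ≤ t
  · obtain ⟨hab, hat⟩ := hc
    have hbt : b ≤ lastTime τf y t := by
      rw [← h.lastTime_impact]
      exact h.lastTime_monotone hat
    have hb : (y b).2.2 = (y a).2.2 := h.phase.time_eq b ⟨hab.le, le_rfl⟩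
    have hJ : (unfreeze S aN τf u y a b).J.filter (fun s => s ≤ t) = {(y a).2.2} := by
      ext s
      rw [Finset.mem_filter, mem_J, Finset.mem_singleton]
      exact ⟨fun hs => hs.1.2, fun hs => ⟨⟨hab, hs⟩, hs ▸ hat⟩⟩
    have h1 := h.velocity_segment (c := 0) (d := a) le_rfl haf.1 haf.2 fun τ hτ hne hI =>
      hne (le_antisymm hτ.2 hI.1)
    have h2 := h.velocity_segment (c := b) (d := lastTime τf y t) hbf.1 hbt hm.2 fun τ hτ _ hI =>
      absurd hI.2 (not_lt.2 hτ.1)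
    have h3 := h.velocity_jump hab
    have hq : (unfreeze S aN τf u y a b).q (y a).2.2 = (y a).1 := by
      simp only [unfreeze]
      rw [h.lastTime_impact, h.phase.position_eq b ⟨hab.le, le_rfl⟩]
    have hint : ∀ r ∈ Icc 0 (y τf).2.2, ∀ r' ∈ Icc 0 (y τf).2.2, IntervalIntegrable (fun s =>
        S.fv ((unfreeze S aN τf u y a b).q s) ((unfreeze S aN τf u y a b).v s) (u s) +
        S.contactAcc ((unfreeze S aN τf u y a b).q s) ((unfreeze S aN τf u y a b).lam s))
        volume r r' := fun r hr r' hr' =>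
      (h.acc_integrable.mono_set (uIcc_subset_Icc hr hr')).intervalIntegrable
    rw [hJ, Finset.sum_singleton, hq, show (unfreeze S aN τf u y a b).P (y a).2.2 =
      ![aN * (b - a), (S.c3 (y b) - S.c3 (y a)) / S.Dtan (y a).1] from rfl, ← h3]
    rw [h.time_zero] at h1
    rw [hb, h.time_lastTime ht] at h2
    rw [← intervalIntegral.integral_add_adjacent_intervals
      (hint 0 ⟨le_rfl, h.end_nonneg⟩ _ (h.time_mem haf)) (hint _ (h.time_mem haf) t ht), ← h1, ← h2]
    simp only [unfreeze]
    abel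
  · have hJ : (unfreeze S aN τf u y a b).J.filter (fun s => s ≤ t) = ∅ := by
      ext s
      rw [Finset.mem_filter, mem_J]
      refine ⟨fun hs => absurd ⟨hs.1.1, hs.1.2 ▸ hs.2⟩ hc, fun hs => by simp at hs⟩
    have h1 := h.velocity_segment (c := 0) (d := lastTime τf y t) le_rfl hm.1 hm.2
      fun τ hτ _ hI => hc ⟨hI.1.trans_lt hI.2, by
        rw [← h.phase.time_eq τ ⟨hI.1, hI.2.le⟩, ← h.time_lastTime ht]
        exact h.monotoneOn ⟨hτ.1, hτ.2.trans hm.2⟩ hm hτ.2⟩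
    rw [h.time_zero, h.time_lastTime ht] at h1
    rw [hJ, Finset.sum_empty, add_zero, ← h1]
    simp [unfreeze]

end IsTFMotion

/-- Near a time `ts`, the contact force has the atom at `ts` only. -/
theorem CLSTrajectory.tendsto_integral_add_sum {n : ℕ} (x : CLSTrajectory n) {T ts : ℝ}
    {f g : ℝ → ℝ} (hf : IntegrableOn f (Icc 0 T)) (hts : ts ∈ x.J) :
    Tendsto (fun ε => (∫ s in Icc (ts - ε) (ts + ε) ∩ Icc 0 T, f s) +
      ∑ s ∈ x.J.filter (fun s => s ∈ Icc (ts - ε) (ts + ε)), g s) (𝓝[>] 0) (𝓝 (g ts)) := by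
  -- The regular part disappears by absolute continuity of the integral; as `x.J` is finite, small
  -- windows contain no other atom.
  have h1 : Tendsto (fun ε => ∫ s in Icc (ts - ε) (ts + ε) ∩ Icc 0 T, f s) (𝓝[>] 0) (𝓝 0) := by
    have hvol : Tendsto (fun ε : ℝ => volume.restrict (Icc 0 T) (Icc (ts - ε) (ts + ε)))
        (𝓝[>] 0) (𝓝 0) := by
      have hle : Tendsto (fun ε : ℝ => ENNReal.ofReal (2 * ε)) (𝓝[>] 0) (𝓝 0) := by
        have : Tendsto (fun ε : ℝ => ENNReal.ofReal (2 * ε)) (𝓝 0) (𝓝 (ENNReal.ofReal (2 * 0))) :=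
          (ENNReal.continuous_ofReal.comp (continuous_const.mul continuous_id)).tendsto 0
        rw [mul_zero, ENNReal.ofReal_zero] at this
        exact this.mono_left nhdsWithin_le_nhds
      refine tendsto_of_tendsto_of_tendsto_of_le_of_le tendsto_const_nhds hle
        (fun _ => zero_le) fun ε => ?_
      refine (Measure.restrict_apply_le _ _).trans ?_
      rw [Real.volume_Icc]
      exact ENNReal.ofReal_le_ofReal (by linarith)
    have := Integrable.tendsto_setIntegral_nhds_zero (μ := volume.restrict (Icc 0 T)) hf
      (s := fun ε : ℝ => Icc (ts - ε) (ts + ε)) hvol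
    refine this.congr fun ε => ?_
    rw [Measure.restrict_restrict measurableSet_Icc]
  have h2 : ∀ᶠ ε in 𝓝[>] (0 : ℝ), ∑ s ∈ x.J.filter (fun s => s ∈ Icc (ts - ε) (ts + ε)), g s =
      g ts := by
    have hfar : ∀ᶠ ε in 𝓝[>] (0 : ℝ), ∀ s ∈ x.J, s ≠ ts → ε < |s - ts| := by
      refine nhdsWithin_le_nhds ((Filter.eventually_all_finset x.J).2 fun s _ => ?_)
      by_cases hs : s = ts
      · exact Eventually.of_forall fun _ h => absurd hs h
      · filter_upwards [gt_mem_nhds (abs_pos.2 (sub_ne_zero.2 hs))] with ε hε _ using hε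
    filter_upwards [hfar, self_mem_nhdsWithin] with ε hε hpos
    have hpos' : 0 < ε := hpos
    have : x.J.filter (fun s => s ∈ Icc (ts - ε) (ts + ε)) = {ts} := by
      ext s
      rw [Finset.mem_filter, Finset.mem_singleton]
      constructor
      · rintro ⟨hs, h1, h2⟩
        by_contra hne
        have := hε s hs hne
        rcases abs_cases (s - ts) with h | h <;> linarith
      · rintro rfl
        exact ⟨hts, by linarith, by linarith⟩
    rw [this, Finset.sum_singleton]
  have := h1.add (tendsto_const_nhds.congr' (h2.mono fun _ h => h.symm))
  rwa [zero_add] at this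

/-! ### Left limits, the impact law and the relation to the time-freezing trajectory -/

namespace IsTFMotion

variable {n m : ℕ} {S : PlanarCLS n m} {aN τf a b : ℝ} {uτ u : ℝ → EuclideanSpace ℝ (Fin m)}
  {y : ℝ → TFState n} (h : IsTFMotion S aN τf uτ u y a b)

include h

/-- The left limit at `t` is the state at the first numerical time with physical time `t`. -/
theorem tendsto_left {t r : ℝ} (ht : t ∈ Icc 0 (y τf).2.2) (ht0 : 0 < t) (hr : r ∈ Icc 0 τf)
    (hrt : (y r).2.2 = t) (hmin : ∀ τ ∈ Icc 0 τf, (y τ).2.2 = t → r ≤ τ) :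
    Tendsto (fun s => y (lastTime τf y s)) (𝓝[<] t) (𝓝 (y r)) := by
  have hlim : Tendsto (lastTime τf y) (𝓝[<] t) (𝓝[Icc 0 τf] r) := by
    refine tendsto_nhdsWithin_iff.2 ⟨?_, Eventually.of_forall h.lastTime_mem⟩
    have hr0 : 0 < r := by
      refine lt_of_le_of_ne hr.1 fun he => ?_
      rw [← he, h.time_zero] at hrt
      exact ht0.ne hrt
    refine tendsto_order.2 ⟨fun l hl => ?_, fun l hl => ?_⟩
    · have hτ : max l 0 ∈ Icc 0 τf := ⟨le_max_right _ _, max_le (hl.le.trans hr.2) (hr.1.trans hr.2)⟩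
      obtain ⟨k, hk1, hk2⟩ := exists_between (max_lt hl hr0)
      have hk : k ∈ Icc 0 τf := ⟨hτ.1.trans hk1.le, hk2.le.trans hr.2⟩
      have hlt : (y k).2.2 < t := by
        have := h.monotoneOn hk hr hk2.le
        refine lt_of_le_of_ne (hrt ▸ this) fun he => ?_
        exact absurd (hmin k hk he) (not_le.2 hk2)
      filter_upwards [nhdsWithin_le_nhds (lt_mem_nhds hlt)] with s hs
      exact ((le_max_left _ _).trans_lt hk1).trans_le (h.le_lastTime hk hs.le)
    · filter_upwards [self_mem_nhdsWithin, nhdsWithin_le_nhds (lt_mem_nhds ht0)] with s hs hs0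
      refine lt_of_le_of_lt ?_ hl
      have hst : s < t := hs
      have hs' : s ∈ Icc 0 (y τf).2.2 := ⟨le_of_lt hs0, hst.le.trans ht.2⟩
      by_contra! hc
      have h1 := h.monotoneOn hr (h.lastTime_mem s) hc.le
      simp only [hrt, h.time_lastTime hs'] at h1
      exact absurd h1 (not_le.2 hst)
  exact (h.continuousOn r hr).tendsto.comp hlim

theorem leftVel_eq {t r : ℝ} (ht : t ∈ Icc 0 (y τf).2.2) (hr : r ∈ Icc 0 τf)
    (hrt : (y r).2.2 = t) (hmin : ∀ τ ∈ Icc 0 τf, (y τ).2.2 = t → r ≤ τ) :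
    (unfreeze S aN τf u y a b).leftVel (y 0).2.1 t = (y r).2.1 := by
  unfold CLSTrajectory.leftVel
  split_ifs with h0
  · have h1 := hmin 0 ⟨le_rfl, h.τf_pos.le⟩ (h.time_zero.trans (le_antisymm ht.1 h0))
    rw [le_antisymm h1 hr.1]
  · exact leftLim_eq_of_tendsto (((continuous_fst.comp continuous_snd).tendsto _).comp
      (h.tendsto_left ht (not_le.1 h0) hr hrt hmin))

theorem leftVel_impact :
    (unfreeze S aN τf u y a b).leftVel (y 0).2.1 (y a).2.2 = (y a).2.1 := by
  have ha := h.subset ⟨le_rfl, h.phase.le⟩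
  refine h.leftVel_eq (h.time_mem ha) ha rfl fun τ hτ he => ?_
  rcases h.phase.time_inj τ hτ a ha he with h1 | h1
  · exact h1.ge
  · exact h1.1.1

/-- Away from the impact, the first and the last numerical time with a given physical time coincide,
so the velocity is left continuous. -/
theorem leftVel_of_notMem {t : ℝ} (ht : t ∈ Icc 0 (y τf).2.2)
    (hJ : t ∉ (unfreeze S aN τf u y a b).J) :
    (unfreeze S aN τf u y a b).leftVel (y 0).2.1 t = (unfreeze S aN τf u y a b).v t := by
  refine h.leftVel_eq ht (h.lastTime_mem t) (h.time_lastTime ht) fun τ hτ he => ?_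
  rcases h.phase.time_inj τ hτ _ (h.lastTime_mem t) (he.trans (h.time_lastTime ht).symm)
    with h1 | ⟨h1, h2⟩
  · exact h1.ge
  · rw [mem_J, not_and] at hJ
    by_cases hab : a < b
    · exact absurd (he.symm.trans (h.phase.time_eq τ h1)) (hJ hab)
    · linarith [h1.1, h2.2]

theorem q_impact : (unfreeze S aN τf u y a b).q (y a).2.2 = (y a).1 := by
  simp only [unfreeze]
  rw [h.lastTime_impact, h.phase.position_eq b ⟨h.phase.le, le_rfl⟩]

theorem v_impact : (unfreeze S aN τf u y a b).v (y a).2.2 = (y b).2.1 := by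
  simp only [unfreeze]
  rw [h.lastTime_impact]

theorem isCLSSolution : IsCLSSolution S u (y τf).2.2 (y 0).1 (y 0).2.1
    (unfreeze S aN τf u y a b) where
  lam_integrable := h.lam_integrable
  fv_integrable := h.fv_integrable
  position _ ht := h.position ht
  velocity _ ht := h.velocity ht
  gap_nonneg t _ := h.sol.gap_nonneg h.aN_pos h.τf_pos h.gap_zero _ (h.lastTime_mem t)
  complementarity := by
    filter_upwards [h.ae_maxDissipation] with t ht hm
    refine ⟨(ht hm).nonneg, ?_⟩
    by_cases h0 : S.fc ((unfreeze S aN τf u y a b).q t) = 0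
    · rw [h0, mul_zero]
    · have : (unfreeze S aN τf u y a b).lam t = 0 := S.modeForce_of_not (fun hc => h0 hc.1) _
      rw [this]
      simp
  friction := h.ae_maxDissipation
  mem_J t := by
    refine ⟨fun hJ => ?_, fun ⟨ht, h1, h2⟩ => ?_⟩
    · obtain ⟨hab, rfl⟩ := mem_J.1 hJ
      have ha := h.subset ⟨le_rfl, h.phase.le⟩
      refine ⟨h.time_mem ha, ?_, ?_⟩
      · rw [h.q_impact, h.phase.contact hab]
      · rw [h.q_impact, h.leftVel_impact]
        have : a ∈ S.impactSet τf y := by rw [h.phase.impactSet_eq]; exact ⟨le_rfl, hab⟩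
        exact this.2.2
    -- Outside `J` the left velocity is the velocity, so `lastTime τf y t` would be an impact point,
    -- whose physical time belongs to `J`.
    · by_contra hJ
      rw [h.leftVel_of_notMem ht hJ] at h2
      have : lastTime τf y t ∈ S.impactSet τf y := ⟨h.lastTime_mem t, h1, h2⟩
      rw [h.phase.impactSet_eq] at this
      refine hJ (mem_J.2 ⟨this.1.trans_lt this.2, ?_⟩)
      rw [← h.phase.time_eq _ ⟨this.1, this.2.le⟩, h.time_lastTime ht]
  impact_normal t hJ := by
    obtain ⟨hab, rfl⟩ := mem_J.1 hJ
    rw [h.q_impact, h.v_impact, ← h.phase.position_eq b ⟨h.phase.le, le_rfl⟩]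
    exact h.phase.vn_end hab
  impulse_nonneg t hJ := by
    obtain ⟨hab, -⟩ := mem_J.1 hJ
    exact mul_nonneg h.aN_pos.le (sub_nonneg.2 hab.le)
  impact_friction t hJ := by
    obtain ⟨hab, rfl⟩ := mem_J.1 hJ
    -- A nonzero post-impact `v_t` means slip of constant sign throughout the phase, hence the full
    -- friction impulse. If `v_t` ends at zero, only the cone bound is required.
    obtain ⟨-, h1, h2, h3⟩ := h.impact_friction_dry hab
    have hT := S.Dtan_pos (h.phase.contact hab)
    have hvt : S.vt ((unfreeze S aN τf u y a b).q (y a).2.2)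
        ((unfreeze S aN τf u y a b).v (y a).2.2) = S.c3 (y b) := by
      rw [h.q_impact, h.v_impact, ← h.phase.position_eq b ⟨h.phase.le, le_rfl⟩]
      rfl
    rw [hvt, S.maxDissipation_iff]
    change |(S.c3 (y b) - S.c3 (y a)) / S.Dtan (y a).1| ≤ S.μ * (aN * (b - a)) ∧
      (_ → (S.c3 (y b) - S.c3 (y a)) / S.Dtan (y a).1 = -(S.μ * (aN * (b - a)))) ∧
      (_ → (S.c3 (y b) - S.c3 (y a)) / S.Dtan (y a).1 = S.μ * (aN * (b - a)))
    refine ⟨?_, fun hp => ?_, fun hp => ?_⟩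
    · rw [abs_div, abs_of_pos hT, div_le_iff₀ hT]
      linarith
    · rw [h2 hp, div_eq_iff hT.ne']
      ring
    · rw [h3 hp, div_eq_iff hT.ne']
      ring

/-- Relation of the time-freezing trajectory with trajectories that agree with `unfreeze`. -/
theorem solutionsRelated_of_eq {x : CLSTrajectory n}
    (hJ : x.J = (unfreeze S aN τf u y a b).J)
    (hlam : IntegrableOn x.lam (Icc 0 (y τf).2.2))
    (hq : ∀ t ∈ Icc 0 (y τf).2.2, x.q t = (unfreeze S aN τf u y a b).q t)
    (hv : ∀ t ∈ Icc 0 (y τf).2.2, x.v t = (unfreeze S aN τf u y a b).v t)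
    (hl : ∀ᵐ t, t ∈ Icc 0 (y τf).2.2 → x.lam t = (unfreeze S aN τf u y a b).lam t)
    (hP : ∀ t ∈ x.J, x.P t = (unfreeze S aN τf u y a b).P t) :
    S.SolutionsRelated aN u τf y x := by
  have hlast : ∀ τ ∈ Icc 0 τf, (y τ).2.2 ∉ x.J → lastTime τf y (y τ).2.2 = τ := by
    intro τ hτ hn
    refine h.lastTime_time hτ fun hI => hn ?_
    rw [hJ, mem_J]
    exact ⟨hI.1.trans_lt hI.2, h.phase.time_eq τ ⟨hI.1, hI.2.le⟩⟩
  refine ⟨?_, fun τ hτ hn => ?_, ?_, fun ts hts => ?_⟩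
  · ext t
    rw [Finset.mem_coe, hJ, mem_J, h.phase.impactSet_eq]
    constructor
    · rintro ⟨hab, rfl⟩
      exact ⟨a, ⟨le_rfl, hab⟩, rfl⟩
    · rintro ⟨τ, hτ, rfl⟩
      exact ⟨hτ.1.trans_lt hτ.2, h.phase.time_eq τ ⟨hτ.1, hτ.2.le⟩⟩
  · have ht := h.time_mem hτ
    rw [hq _ ht, hv _ ht]
    simp only [unfreeze]
    rw [hlast τ hτ hn]
  · filter_upwards [hl] with t ht τ hτ he hn
    subst he
    rw [ht (h.time_mem hτ)]
    simp only [unfreeze]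
    rw [hlast τ hτ hn]
  · obtain ⟨hab, rfl⟩ := mem_J.1 (hJ ▸ hts)
    have hT := S.Dtan_pos (h.phase.contact hab)
    have hμ := S.μ_pos
    have haN := h.aN_pos
    have hb : b ∈ Icc a b := ⟨hab.le, le_rfl⟩
    have hi := fun i : Fin 2 => (integrable_pi_iff.1 hlam i)
    have hP0 : x.P (y a).2.2 0 = ∫ _τ in a..b, aN := by
      rw [hP _ hts, intervalIntegral.integral_const, smul_eq_mul, mul_comm]
      rfl
    have hP1 : |x.P (y a).2.2 1| =
        ∫ τ in a..b, S.μ * aN * |Real.sign (S.vt (y τ).1 (y τ).2.1)| := by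
      have e := (h.impact_friction_dry hab).1
      have e1 : ∀ τ, S.Dtan (y a).1 * (S.μ * aN) * |Real.sign (S.c3 (y τ))| =
          S.Dtan (y a).1 * (S.μ * aN * |Real.sign (S.vt (y τ).1 (y τ).2.1)|) := fun τ => by
        rw [mul_assoc]
        rfl
      simp only [e1, intervalIntegral.integral_const_mul] at e
      rw [hP _ hts]
      change |(S.c3 (y b) - S.c3 (y a)) / S.Dtan (y a).1| = _
      rw [abs_div, abs_of_pos hT, e, mul_div_cancel_left₀ _ hT.ne',
        intervalIntegral.integral_const_mul]
    have hlim := x.tendsto_integral_add_sum (T := (y τf).2.2) (f := fun s => |x.lam s 1|)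
      (g := fun s => |x.P s 1|) (hi 1).abs hts
    refine ⟨a, b, hab, h.phase.le_end, h.phase.impactSet_eq, h.phase.time_eq, ?_,
      h.phase.vn_end hab, ?_, ?_, fun hne => ?_⟩
    · rw [h.phase.position_eq b hb, h.phase.contact hab]
    · rw [← hP0]
      exact x.tendsto_integral_add_sum (f := fun s => x.lam s 0) (g := fun s => x.P s 0) (hi 0) hts
    · rw [← hP1]
      exact hlim
    · have e : ∫ τ in a..b, S.μ * aN * |Real.sign (S.vt (y τ).1 (y τ).2.1)| =
          ∫ _τ in a..b, S.μ * aN := by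
        refine intervalIntegral.integral_congr_ae ?_
        filter_upwards [Measure.ae_ne volume b] with τ hτ hm
        rw [uIoc_of_le hab.le] at hm
        have := hne τ ⟨hm.1.le, lt_of_le_of_ne hm.2 hτ⟩
        rcases this.lt_or_gt with h0 | h0
        · simp [Real.sign_of_neg h0]
        · simp [Real.sign_of_pos h0]
      rw [← e, ← hP1]
      exact hlim

end IsTFMotion

/-! ### Uniqueness for impact-free motions -/

theorem AbsolutelyContinuousOnInterval.norm_sub_le_integral {F : Type*} [NormedAddCommGroup F]
    [NormedSpace ℝ F] [FiniteDimensional ℝ F] {f g : ℝ → F} {k : ℝ → ℝ} {a b : ℝ} (hab : a ≤ b)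
    (hf : AbsolutelyContinuousOnInterval f a b)
    (hg : ∀ᵐ t, t ∈ Icc a b → HasDerivAt f (g t) t) (hk : IntervalIntegrable k volume a b)
    (h : ∀ᵐ t, t ∈ Icc a b → ‖g t‖ ≤ k t) : ∀ t ∈ Icc a b, ‖f t - f a‖ ≤ ∫ s in a..b, k s := by
  intro t ht
  have hsub : Icc a t ⊆ Icc a b := Icc_subset_Icc_right ht.2
  have husub : uIcc a t ⊆ uIcc a b := by rwa [uIcc_of_le hab, uIcc_of_le ht.1]
  obtain ⟨hi, he⟩ := (hf.mono husub).integrable_and_integral_eq (g := g) (by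
    rw [uIcc_of_le ht.1]
    filter_upwards [hg] with s hs hm using hs (hsub hm))
  rw [← he]
  have hk0 : 0 ≤ᵐ[volume.restrict (Ioc a b)] k := by
    refine (ae_restrict_iff' measurableSet_Ioc).2 ?_
    filter_upwards [h] with s hs hm
    exact (norm_nonneg _).trans (hs (Ioc_subset_Icc_self hm))
  refine (intervalIntegral.norm_integral_le_of_norm_le ht.1 ?_ (hk.mono_set husub)).trans ?_
  · filter_upwards [h] with s hs hm
    exact hs (hsub (Ioc_subset_Icc_self hm))
  · exact intervalIntegral.integral_mono_interval le_rfl ht.1 ht.2 hk0 hk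

/-- A motion of the complementarity system without impacts on `[a, c]`. -/
structure IsSmoothPhase {n m : ℕ} (S : PlanarCLS n m) (u : ℝ → EuclideanSpace ℝ (Fin m)) (a c : ℝ)
    (q v : ℝ → EuclideanSpace ℝ (Fin n)) (lam : ℝ → Fin 2 → ℝ) : Prop where
  q_ac : AbsolutelyContinuousOnInterval q a c
  v_ac : AbsolutelyContinuousOnInterval v a c
  lam_int : ∀ i, IntervalIntegrable (fun t => lam t i) volume a c
  deriv : ∀ᵐ t, t ∈ Icc a c → HasDerivAt q (v t) t ∧
    HasDerivAt v (S.fv (q t) (v t) (u t) + S.contactAcc (q t) (lam t)) t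
  gap : ∀ t ∈ Icc a c, 0 ≤ S.fc (q t)
  compl : ∀ᵐ t, t ∈ Icc a c → lam t 0 * S.fc (q t) = 0
  friction : ∀ᵐ t, t ∈ Icc a c → S.MaxDissipation (lam t 0) (S.vt (q t) (v t)) (lam t 1)

namespace IsSmoothPhase

variable {n m : ℕ} {S : PlanarCLS n m} {u : ℝ → EuclideanSpace ℝ (Fin m)} {a c : ℝ}
  {q v : ℝ → EuclideanSpace ℝ (Fin n)} {lam : ℝ → Fin 2 → ℝ}

theorem mono (h : IsSmoothPhase S u a c q v lam) {t : ℝ} (ht : t ∈ Icc a c) :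
    IsSmoothPhase S u a t q v lam := by
  have hsub : Icc a t ⊆ Icc a c := Icc_subset_Icc_right ht.2
  have husub : uIcc a t ⊆ uIcc a c := by
    rwa [uIcc_of_le (ht.1.trans ht.2), uIcc_of_le ht.1]
  exact ⟨h.q_ac.mono husub, h.v_ac.mono husub, fun i => (h.lam_int i).mono_set husub,
    h.deriv.mono fun s hs hm => hs (hsub hm), fun s hs => h.gap s (hsub hs),
    h.compl.mono fun s hs hm => hs (hsub hm), h.friction.mono fun s hs hm => hs (hsub hm)⟩

theorem vn_ac (h : IsSmoothPhase S u a c q v lam) :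
    AbsolutelyContinuousOnInterval (fun t => S.vn (q t) (v t)) a c := by
  have h1 := h.q_ac.prodMk h.v_ac
  have h2 : ContDiff ℝ 1
      (fun p : EuclideanSpace ℝ (Fin n) × EuclideanSpace ℝ (Fin n) => S.vn p.1 p.2) :=
    S.vn_contDiff.of_le one_le_two
  have h3 := h1.comp_contDiff h2
  exact h3

theorem vt_ac (h : IsSmoothPhase S u a c q v lam) :
    AbsolutelyContinuousOnInterval (fun t => S.vt (q t) (v t)) a c := by
  have h1 := h.q_ac.prodMk h.v_ac
  have h2 : ContDiff ℝ 1
      (fun p : EuclideanSpace ℝ (Fin n) × EuclideanSpace ℝ (Fin n) => S.vt p.1 p.2) :=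
    S.vt_contDiff.of_le one_le_two
  have h3 := h1.comp_contDiff h2
  exact h3

theorem fc_ac (h : IsSmoothPhase S u a c q v lam) :
    AbsolutelyContinuousOnInterval (fun t => S.fc (q t)) a c :=
  h.q_ac.comp_contDiff (S.fc_smooth.of_le (by norm_num))

/-- The zero-set lemma, applied to the gap and then to the normal velocity, gives the contact
balance `φ + D λ_n = 0`. Orthogonality is available in contact only, but in free flight the force
vanishes and the formulas hold trivially. -/
theorem ae_facts (h : IsSmoothPhase S u a c q v lam) : ∀ᵐ t, t ∈ Icc a c →
    HasDerivAt (fun s => S.vn (q s) (v s))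
      (S.phitilde (q t) (v t) (u t) 0 + S.D (q t) * lam t 0) t ∧
    HasDerivAt (fun s => S.vt (q s) (v s))
      (S.phitilde (q t) (v t) (u t) 1 + S.Dtan (q t) * lam t 1) t ∧
    (0 < S.fc (q t) → lam t 0 = 0 ∧ lam t 1 = 0) ∧
    (S.fc (q t) = 0 → S.vn (q t) (v t) = 0 ∧
      S.phitilde (q t) (v t) (u t) 0 + S.D (q t) * lam t 0 = 0) ∧
    0 ≤ lam t 0 ∧ |lam t 1| ≤ S.μ * lam t 0 := by
  filter_upwards [h.deriv, h.compl, h.friction, ae_hasDerivAt_eq_zero_of_eq_zero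
    fun t => S.fc (q t), ae_hasDerivAt_eq_zero_of_eq_zero fun t => S.vn (q t) (v t)]
    with t hd hc hf hz1 hz2 hm
  obtain ⟨h1, h2⟩ := hd hm
  have h3 := (S.maxDissipation_iff.1 (hf hm)).1
  have hfree : 0 < S.fc (q t) → lam t 0 = 0 ∧ lam t 1 = 0 := fun hp => by
    have h0 : lam t 0 = 0 := (mul_eq_zero.1 (hc hm)).resolve_right hp.ne'
    rw [h0, mul_zero] at h3
    exact ⟨h0, abs_nonpos_iff.1 h3⟩
  have hcol : ∀ i, HasDerivAt (fun s => inner ℝ (S.col i (q s)) (v s))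
      (S.phitilde (q t) (v t) (u t) i + inner ℝ (S.col i (q t)) (S.contactAcc (q t) (lam t))) t :=
    fun i => by
      have := S.hasDerivAt_col_motion (θ := 1) (u := u t)
        (a := S.contactAcc (q t) (lam t)) i (by simpa using h1) (by simpa using h2)
      rwa [one_mul] at this
  have hin : inner ℝ (S.normal (q t)) (S.contactAcc (q t) (lam t)) = S.D (q t) * lam t 0 ∧
      inner ℝ (S.b (q t)) (S.contactAcc (q t) (lam t)) = S.Dtan (q t) * lam t 1 := by
    rcases (h.gap t hm).lt_or_eq with hp | hp
    · obtain ⟨e0, e1⟩ := hfree hp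
      rw [S.contactAcc_eq, e0, e1]
      simp
    · exact ⟨S.inner_normal_contactAcc hp.symm _, S.inner_b_contactAcc hp.symm _⟩
  have hv0 := hcol 0
  rw [show S.col 0 (q t) = S.normal (q t) from rfl, hin.1] at hv0
  have hv1 := hcol 1
  rw [show S.col 1 (q t) = S.b (q t) from rfl, hin.2] at hv1
  refine ⟨hv0, hv1, hfree, fun hp => ?_, (hf hm).nonneg, h3⟩
  have h4 : S.vn (q t) (v t) = 0 := hz1 hp _ (S.hasDerivAt_fc h1)
  exact ⟨h4, hz2 h4 _ hv0⟩

end IsSmoothPhase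

theorem PlanarCLS.HasBounds.contactAcc_sub_le {n m : ℕ} {S : PlanarCLS n m} {R L : ℝ}
    (h : S.HasBounds R L) {q q' : EuclideanSpace ℝ (Fin n)} {e : ℝ} (hq : ‖q‖ ≤ R) (hq' : ‖q'‖ ≤ R)
    (he : ‖q - q'‖ ≤ e) (l l' : Fin 2 → ℝ) :
    ‖S.contactAcc q l - S.contactAcc q' l'‖ ≤
      L * e * (|l 0| + |l 1|) + L * (|l 0 - l' 0| + |l 1 - l' 1|) := by
  have e1 : S.contactAcc q l - S.contactAcc q' l' =
      (l 0 • (S.invM q (S.normal q) - S.invM q' (S.normal q')) +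
        l 1 • (S.invM q (S.b q) - S.invM q' (S.b q'))) +
      ((l 0 - l' 0) • S.invM q' (S.normal q') + (l 1 - l' 1) • S.invM q' (S.b q')) := by
    rw [S.contactAcc_eq, S.contactAcc_eq]
    module
  rw [e1]
  refine (norm_add_le _ _).trans ((add_le_add (norm_add_le _ _) (norm_add_le _ _)).trans ?_)
  simp only [norm_smul, Real.norm_eq_abs]
  have h1 := mul_le_mul_of_nonneg_left (h.nacc_lip q q' e hq hq' he) (abs_nonneg (l 0))
  have h2 := mul_le_mul_of_nonneg_left (h.bacc_lip q q' e hq hq' he) (abs_nonneg (l 1))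
  have h3 := mul_le_mul_of_nonneg_left (h.nacc_bd q' hq') (abs_nonneg (l 0 - l' 0))
  have h4 := mul_le_mul_of_nonneg_left (h.bacc_bd q' hq') (abs_nonneg (l 1 - l' 1))
  linarith

/-- Two impact-free motions with the same initial state, bounded by `R`. -/
structure IsPhasePair {n m : ℕ} (S : PlanarCLS n m) (u : ℝ → EuclideanSpace ℝ (Fin m)) (R L a c : ℝ)
    (q v : ℝ → EuclideanSpace ℝ (Fin n)) (lam : ℝ → Fin 2 → ℝ)
    (q' v' : ℝ → EuclideanSpace ℝ (Fin n)) (lam' : ℝ → Fin 2 → ℝ) : Prop where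
  le : a ≤ c
  fst : IsSmoothPhase S u a c q v lam
  snd : IsSmoothPhase S u a c q' v' lam'
  bounds : S.HasBounds R L
  u_le : ∀ t ∈ Icc a c, ‖u t‖ ≤ R
  fst_le : ∀ t ∈ Icc a c, ‖q t‖ ≤ R ∧ ‖v t‖ ≤ R
  snd_le : ∀ t ∈ Icc a c, ‖q' t‖ ≤ R ∧ ‖v' t‖ ≤ R
  q_eq : q a = q' a
  v_eq : v a = v' a

/-! ### Deviation estimates and uniqueness of free flight -/

namespace IsPhasePair

variable {n m : ℕ} {S : PlanarCLS n m} {u : ℝ → EuclideanSpace ℝ (Fin m)} {R L a c : ℝ}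
  {q v : ℝ → EuclideanSpace ℝ (Fin n)} {lam : ℝ → Fin 2 → ℝ}
  {q' v' : ℝ → EuclideanSpace ℝ (Fin n)} {lam' : ℝ → Fin 2 → ℝ}

theorem symm (h : IsPhasePair S u R L a c q v lam q' v' lam') :
    IsPhasePair S u R L a c q' v' lam' q v lam :=
  ⟨h.le, h.snd, h.fst, h.bounds, h.u_le, h.snd_le, h.fst_le, h.q_eq.symm, h.v_eq.symm⟩

theorem mono (h : IsPhasePair S u R L a c q v lam q' v' lam') {t : ℝ} (ht : t ∈ Icc a c) :
    IsPhasePair S u R L a t q v lam q' v' lam' := by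
  have hsub : Icc a t ⊆ Icc a c := Icc_subset_Icc_right ht.2
  exact ⟨ht.1, h.fst.mono ht, h.snd.mono ht, h.bounds, fun s hs => h.u_le s (hsub hs),
    fun s hs => h.fst_le s (hsub hs), fun s hs => h.snd_le s (hsub hs), h.q_eq, h.v_eq⟩

/-- The largest deviation of the two motions. -/
theorem exists_max (h : IsPhasePair S u R L a c q v lam q' v' lam') :
    ∃ e, 0 ≤ e ∧ (∀ t ∈ Icc a c, ‖q t - q' t‖ ≤ e ∧ ‖v t - v' t‖ ≤ e) ∧
      ∀ B, 0 ≤ B → (∀ t ∈ Icc a c, ‖q t - q' t‖ ≤ B ∧ ‖v t - v' t‖ ≤ B) → e ≤ B := by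
  have hc : ContinuousOn (fun t => max ‖q t - q' t‖ ‖v t - v' t‖) (Icc a c) := by
    have h1 := h.fst.q_ac.continuousOn
    have h2 := h.fst.v_ac.continuousOn
    have h3 := h.snd.q_ac.continuousOn
    have h4 := h.snd.v_ac.continuousOn
    rw [uIcc_of_le h.le] at h1 h2 h3 h4
    exact ContinuousOn.sup (ContinuousOn.norm (h1.sub h3)) (ContinuousOn.norm (h2.sub h4))
  obtain ⟨t, ht, hmax⟩ := isCompact_Icc.exists_isMaxOn (nonempty_Icc.2 h.le) hc
  refine ⟨max ‖q t - q' t‖ ‖v t - v' t‖, le_max_of_le_left (norm_nonneg _), fun s hs => ?_,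
    fun B _ hB => max_le (hB t ht).1 (hB t ht).2⟩
  have := hmax hs
  exact ⟨(le_max_left _ _).trans this, (le_max_right _ _).trans this⟩

theorem norm_q_le (h : IsPhasePair S u R L a c q v lam q' v' lam') {e : ℝ}
    (he : ∀ t ∈ Icc a c, ‖q t - q' t‖ ≤ e ∧ ‖v t - v' t‖ ≤ e) {t : ℝ} (ht : t ∈ Icc a c) :
    ‖q t - q' t‖ ≤ e * (c - a) := by
  have := (h.fst.q_ac.sub h.snd.q_ac).norm_sub_le_integral h.le (g := fun t => v t - v' t)
    (k := fun _ => e) (by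
      filter_upwards [h.fst.deriv, h.snd.deriv] with s h1 h2 hm
      exact (h1 hm).1.sub (h2 hm).1) intervalIntegrable_const
    (Eventually.of_forall fun s hs => (he s hs).2) t ht
  simpa [h.q_eq, mul_comm] using this

theorem norm_v_le (h : IsPhasePair S u R L a c q v lam q' v' lam') {k : ℝ → ℝ}
    (hk : IntervalIntegrable k volume a c)
    (hle : ∀ᵐ t, t ∈ Icc a c → ‖(S.fv (q t) (v t) (u t) + S.contactAcc (q t) (lam t)) -
      (S.fv (q' t) (v' t) (u t) + S.contactAcc (q' t) (lam' t))‖ ≤ k t)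
    {t : ℝ} (ht : t ∈ Icc a c) : ‖v t - v' t‖ ≤ ∫ s in a..c, k s := by
  have := (h.fst.v_ac.sub h.snd.v_ac).norm_sub_le_integral h.le
    (g := fun t => (S.fv (q t) (v t) (u t) + S.contactAcc (q t) (lam t)) -
      (S.fv (q' t) (v' t) (u t) + S.contactAcc (q' t) (lam' t))) (by
      filter_upwards [h.fst.deriv, h.snd.deriv] with s h1 h2 hm
      exact (h1 hm).2.sub (h2 hm).2) hk hle t ht
  simpa [h.v_eq] using this

theorem ae_lam_of_free (h : IsSmoothPhase S u a c q v lam)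
    (hfree : ∀ t ∈ Ioo a c, 0 < S.fc (q t)) :
    ∀ᵐ t, t ∈ Icc a c → lam t 0 = 0 ∧ lam t 1 = 0 := by
  filter_upwards [h.ae_facts, Measure.ae_ne volume a, Measure.ae_ne volume c] with t ht h1 h2 hm
  exact (ht hm).2.2.1 (hfree t ⟨lt_of_le_of_ne hm.1 h1.symm, lt_of_le_of_ne hm.2 h2⟩)

/-- If the second motion is a free flight, the deviation of the first motion is controlled by the
normal impulse of the first motion. -/
theorem dev_le_of_free (h : IsPhasePair S u R L a c q v lam q' v' lam')
    (hfree : ∀ t ∈ Ioo a c, 0 < S.fc (q' t)) (hδ : 2 * L * (c - a) ≤ 1) :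
    ∀ t ∈ Icc a c, ‖q t - q' t‖ ≤ 2 * (L * (1 + S.μ)) * ∫ s in a..c, lam s 0 ∧
      ‖v t - v' t‖ ≤ 2 * (L * (1 + S.μ)) * ∫ s in a..c, lam s 0 := by
  obtain ⟨e, he0, he, hmax⟩ := h.exists_max
  have hL := h.bounds.one_le
  have hμ := S.μ_pos
  have hac := h.le
  have hN : 0 ≤ ∫ s in a..c, lam s 0 := by
    refine intervalIntegral.integral_nonneg_of_ae_restrict h.le
      ((ae_restrict_iff' measurableSet_Icc).2 ?_)
    filter_upwards [h.fst.ae_facts] with s hs hm using (hs hm).2.2.2.2.1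
  set N := ∫ s in a..c, lam s 0
  have hki : IntervalIntegrable (fun s => L * e + L * (1 + S.μ) * lam s 0) volume a c :=
    intervalIntegrable_const.add ((h.fst.lam_int 0).const_mul _)
  have hv : ∀ t ∈ Icc a c, ‖v t - v' t‖ ≤ L * e * (c - a) + L * (1 + S.μ) * N := fun t ht => by
    have := h.norm_v_le hki (by
      filter_upwards [h.fst.ae_facts, ae_lam_of_free h.snd hfree] with s h1 h2 hm
      obtain ⟨-, -, -, -, h3, h4⟩ := h1 hm
      have e0 : lam' s = 0 := by
        funext i
        fin_cases i
        · exact (h2 hm).1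
        · exact (h2 hm).2
      rw [e0, S.contactAcc_zero, add_zero, add_sub_right_comm]
      refine (norm_add_le _ _).trans (add_le_add (h.bounds.fv_lip _ _ _ _ _ _ (h.fst_le s hm).1
        (h.fst_le s hm).2 (h.snd_le s hm).1 (h.snd_le s hm).2 (h.u_le s hm) (he s hm).1
        (he s hm).2) ((h.bounds.contactAcc_le (h.fst_le s hm).1 _).trans ?_))
      rw [abs_of_nonneg h3, mul_assoc]
      exact mul_le_mul_of_nonneg_left (by linarith) (by linarith)) ht
    rw [intervalIntegral.integral_add intervalIntegrable_const ((h.fst.lam_int 0).const_mul _),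
      intervalIntegral.integral_const, intervalIntegral.integral_const_mul, smul_eq_mul] at this
    linarith
  have hB : e ≤ L * e * (c - a) + L * (1 + S.μ) * N := by
    have hκN : 0 ≤ L * (1 + S.μ) * N := by positivity
    have hLe : 0 ≤ L * e * (c - a) := mul_nonneg (by positivity) (by linarith)
    refine hmax _ (by linarith) fun t ht => ⟨?_, hv t ht⟩
    have h1 := h.norm_q_le he ht
    have h2 : e * (c - a) ≤ L * e * (c - a) := by
      rw [mul_assoc]
      exact le_mul_of_one_le_left (mul_nonneg he0 (by linarith)) hL
    linarith
  -- The short interval allows the term `L * e * (c - a) ≤ e / 2` to be absorbed.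
  have h3 : e ≤ 2 * (L * (1 + S.μ)) * N := by nlinarith
  exact fun t ht => ⟨(he t ht).1.trans h3, (he t ht).2.trans h3⟩

/-- Over short times, the first motion is above the second one if the second one is a free
flight. -/
theorem fc_le_of_free (h : IsPhasePair S u R L a c q v lam q' v' lam')
    (hfree : ∀ t ∈ Ioo a c, 0 < S.fc (q' t)) (hδ : 24 * L ^ 7 * (1 + S.μ) * (c - a) ≤ 1) :
    ∀ t ∈ Icc a c, S.fc (q' t) ≤ S.fc (q t) := by
  have hL := h.bounds.one_le
  have hμ := S.μ_pos
  have hac := h.le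
  have hL3 : L ^ 3 ≤ L ^ 7 := pow_le_pow_right₀ hL (by norm_num)
  have hL1 : L ≤ L ^ 7 := le_self_pow₀ hL (by norm_num)
  have hca : 0 ≤ c - a := by linarith
  have hL0 : 0 < L := by linarith
  have hp : 0 ≤ L ^ 7 * (c - a) := by positivity
  have hδ1 : 2 * L * (c - a) ≤ 1 := by
    have : L * (c - a) ≤ L ^ 7 * (c - a) := mul_le_mul_of_nonneg_right hL1 hca
    nlinarith
  have hδ2 : 2 * (L * (1 + S.μ)) * L * L * (c - a) ≤ 1 := by
    have : L ^ 3 * ((1 + S.μ) * (c - a)) ≤ L ^ 7 * ((1 + S.μ) * (c - a)) :=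
      mul_le_mul_of_nonneg_right hL3 (by positivity)
    have h4 : 0 ≤ L ^ 7 * ((1 + S.μ) * (c - a)) := by positivity
    nlinarith
  -- A normal impulse `N` raises the normal velocity of the first motion by at least `N / L`. The
  -- deviation it causes is `O(N)` and feeds back through `phitilde` by `O((t - a) * N)` only, which
  -- is smaller for short times.
  have hvn : ∀ t ∈ Icc a c, S.vn (q' t) (v' t) ≤ S.vn (q t) (v t) := by
    intro t ht
    have ht' := h.mono ht
    have hfree' : ∀ s ∈ Ioo a t, 0 < S.fc (q' s) := fun s hs => hfree s ⟨hs.1, hs.2.trans_le ht.2⟩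
    have hdev := ht'.dev_le_of_free hfree' (by nlinarith [ht.2])
    have hN : 0 ≤ ∫ s in a..t, lam s 0 := by
      refine intervalIntegral.integral_nonneg_of_ae_restrict ht.1
        ((ae_restrict_iff' measurableSet_Icc).2 ?_)
      filter_upwards [ht'.fst.ae_facts] with s hs hm using (hs hm).2.2.2.2.1
    set N := ∫ s in a..t, lam s 0
    have hki : IntervalIntegrable (fun s => L * (2 * (L * (1 + S.μ)) * N) - L⁻¹ * lam s 0)
        volume a t := intervalIntegrable_const.sub ((ht'.fst.lam_int 0).const_mul _)
    have := (ht'.snd.vn_ac.sub ht'.fst.vn_ac).sub_le_integral ht.1 hki (by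
      filter_upwards [ht'.fst.ae_facts, ht'.snd.ae_facts, ae_lam_of_free ht'.snd hfree']
        with s h1 h2 h3 hm
      obtain ⟨h4, -, h5, h6, h7, -⟩ := h1 hm
      obtain ⟨h8, -⟩ := h2 hm
      refine ⟨_, h8.sub h4, ?_⟩
      rw [(h3 hm).1, mul_zero, add_zero]
      have hlip := abs_le.1 (ht'.bounds.phi_lip _ _ _ _ _ 0 _ (ht'.fst_le s hm).1 (ht'.fst_le s hm).2
        (ht'.snd_le s hm).1 (ht'.snd_le s hm).2 (ht'.u_le s hm) (hdev s hm).1 (hdev s hm).2)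
      have hD : L⁻¹ * lam s 0 ≤ S.D (q s) * lam s 0 := by
        rcases (ht'.fst.gap s hm).lt_or_eq with hpos | hz
        · rw [(h5 hpos).1, mul_zero, mul_zero]
        · refine mul_le_mul_of_nonneg_right ?_ h7
          rw [inv_le_iff_one_le_mul₀ hL0, mul_comm]
          exact ht'.bounds.D_lower _ (ht'.fst_le s hm).1 hz.symm
      linarith [hlip.1])
    rw [intervalIntegral.integral_sub intervalIntegrable_const ((ht'.fst.lam_int 0).const_mul _),
      intervalIntegral.integral_const, intervalIntegral.integral_const_mul, smul_eq_mul] at this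
    simp only [Pi.sub_apply, h.q_eq, h.v_eq, sub_self, sub_zero] at this
    have h5 : (t - a) * (L * (2 * (L * (1 + S.μ)) * N)) ≤ L⁻¹ * N := by
      have h6 : (t - a) * (2 * (L * (1 + S.μ)) * L * L) ≤ 1 := by
        have : 0 ≤ 2 * (L * (1 + S.μ)) * L * L := by positivity
        nlinarith [ht.2]
      calc (t - a) * (L * (2 * (L * (1 + S.μ)) * N))
          = ((t - a) * (2 * (L * (1 + S.μ)) * L * L)) * (L⁻¹ * N) := by field_simp
        _ ≤ 1 * (L⁻¹ * N) := mul_le_mul_of_nonneg_right h6 (by positivity)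
        _ = L⁻¹ * N := one_mul _
    linarith
  intro t ht
  have := (h.fst.fc_ac.sub h.snd.fc_ac).monotoneOn (by
    filter_upwards [h.fst.deriv, h.snd.deriv] with s h1 h2 hm
    exact ⟨_, (S.hasDerivAt_fc (h1 hm).1).sub (S.hasDerivAt_fc (h2 hm).1),
      sub_nonneg.2 (hvn s hm)⟩) (left_mem_Icc.2 hac) ht ht.1
  simp only [Pi.sub_apply, h.q_eq, sub_self] at this
  linarith

/-- Uniqueness of free flights. -/
theorem eq_of_free (h : IsPhasePair S u R L a c q v lam q' v' lam')
    (hfree : ∀ t ∈ Ioo a c, 0 < S.fc (q' t)) (hδ : 24 * L ^ 7 * (1 + S.μ) * (c - a) ≤ 1) :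
    ∀ t ∈ Icc a c, q t = q' t ∧ v t = v' t := by
  have hL := h.bounds.one_le
  have hμ := S.μ_pos
  have hca : 0 ≤ c - a := sub_nonneg.2 h.le
  have hδ1 : 2 * L * (c - a) ≤ 1 := by
    have hL1 : L ≤ L ^ 7 := le_self_pow₀ hL (by norm_num)
    have : L * (c - a) ≤ L ^ 7 * (c - a) := mul_le_mul_of_nonneg_right hL1 hca
    have hp : 0 ≤ L ^ 7 * (c - a) := by positivity
    nlinarith
  -- The first motion stays above a positive gap, so it is force-free as well and the deviation
  -- bound is zero.
  have hfree' : ∀ t ∈ Ioo a c, 0 < S.fc (q t) := fun t ht =>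
    (hfree t ht).trans_le (h.fc_le_of_free hfree hδ t ⟨ht.1.le, ht.2.le⟩)
  have hN : ∫ s in a..c, lam s 0 = 0 := by
    rw [intervalIntegral.integral_congr_ae (g := fun _ => (0 : ℝ))]
    · simp
    · filter_upwards [ae_lam_of_free h.fst hfree'] with s hs hm
      rw [uIoc_of_le h.le] at hm
      exact (hs (Ioc_subset_Icc_self hm)).1
  intro t ht
  have := h.dev_le_of_free hfree hδ1 t ht
  rw [hN, mul_zero] at this
  exact ⟨sub_eq_zero.1 (norm_le_zero_iff.1 this.1), sub_eq_zero.1 (norm_le_zero_iff.1 this.2)⟩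

end IsPhasePair

/-! ### Uniqueness against a motion in persistent contact -/

namespace IsPhasePair

variable {n m : ℕ} {S : PlanarCLS n m} {u : ℝ → EuclideanSpace ℝ (Fin m)} {R L a c : ℝ}
  {q v : ℝ → EuclideanSpace ℝ (Fin n)} {lam : ℝ → Fin 2 → ℝ}
  {q' v' : ℝ → EuclideanSpace ℝ (Fin n)} {lam' : ℝ → Fin 2 → ℝ}

theorem snd_contact_ae (h : IsPhasePair S u R L a c q v lam q' v' lam')
    (hcon : ∀ t ∈ Ioo a c, S.fc (q' t) = 0) :
    ∀ᵐ t, t ∈ Icc a c → S.fc (q' t) = 0 ∧ S.vn (q' t) (v' t) = 0 ∧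
      S.phitilde (q' t) (v' t) (u t) 0 + S.D (q' t) * lam' t 0 = 0 := by
  filter_upwards [h.snd.ae_facts, Measure.ae_ne volume a, Measure.ae_ne volume c] with t ht h1 h2 hm
  have h0 := hcon t ⟨lt_of_le_of_ne hm.1 h1.symm, lt_of_le_of_ne hm.2 h2⟩
  exact ⟨h0, (ht hm).2.2.2.1 h0⟩

/-- The normal velocity of the second motion vanishes almost everywhere, hence by continuity at `a`,
where the two motions agree. -/
theorem vn_left_eq_zero (h : IsPhasePair S u R L a c q v lam q' v' lam') (hac : a < c)
    (hcon : ∀ t ∈ Ioo a c, S.fc (q' t) = 0) : S.vn (q a) (v a) = 0 := by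
  rw [h.q_eq, h.v_eq]
  have hc := h.snd.vn_ac.continuousOn
  rw [uIcc_of_le h.le] at hc
  refine Measure.eqOn_Icc_of_ae_eq (μ := volume) (g := fun _ => (0 : ℝ)) hac.ne ?_ hc
    continuousOn_const (left_mem_Icc.2 h.le)
  refine (ae_restrict_iff' measurableSet_Icc).2 ?_
  filter_upwards [h.snd_contact_ae hcon] with t ht hm using (ht hm).2.1

/-- Normal forces while the second motion is in contact. -/
theorem normal_ae (h : IsPhasePair S u R L a c q v lam q' v' lam')
    (hcon : ∀ t ∈ Ioo a c, S.fc (q' t) = 0) {e : ℝ} (he0 : 0 ≤ e)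
    (he : ∀ t ∈ Icc a c, ‖q t - q' t‖ ≤ e ∧ ‖v t - v' t‖ ≤ e) :
    ∀ᵐ t, t ∈ Icc a c → lam t 0 ≤ L ^ 2 ∧ ∃ d, HasDerivAt (fun s => S.vn (q s) (v s)) d t ∧
      d ≤ 3 * L ^ 3 * e - L⁻¹ * |lam t 0 - lam' t 0| := by
  have hL := h.bounds.one_le
  have hL0 : 0 < L := by linarith
  filter_upwards [h.fst.ae_facts, h.snd.ae_facts, h.snd_contact_ae hcon] with t h1 h2 h3 hm
  obtain ⟨hd, -, hfree, hcont, hn, -⟩ := h1 hm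
  obtain ⟨-, -, -, -, hn', -⟩ := h2 hm
  obtain ⟨hc', -, hφ'⟩ := h3 hm
  obtain ⟨hq, hv⟩ := h.fst_le t hm
  obtain ⟨hq', hv'⟩ := h.snd_le t hm
  have hu := h.u_le t hm
  have hφl := abs_le.1
    (h.bounds.phi_lip (q t) (v t) (q' t) (v' t) (u t) 0 e hq hv hq' hv' hu (he t hm).1 (he t hm).2)
  have hD' := h.bounds.D_lower (q' t) hq' hc'
  have hLL3 : L ≤ L ^ 3 := le_self_pow₀ hL (by norm_num)
  have hLe : L * e ≤ L ^ 3 * e := mul_le_mul_of_nonneg_right hLL3 he0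
  have hLe0 : 0 ≤ L ^ 3 * e := by positivity
  -- In the air, the normal acceleration of the first motion is close to `-D λ'_n`, since the second
  -- motion needs `λ'_n` to stay in contact. In contact, both motions satisfy the balance `φ + D λ_n
  -- = 0`, so the normal forces differ by `O(e)`.
  rcases (h.fst.gap t hm).lt_or_eq with hp | hp
  · obtain ⟨e0, -⟩ := hfree hp
    refine ⟨by rw [e0]; positivity, _, hd, ?_⟩
    rw [e0, mul_zero, add_zero, zero_sub, abs_neg, abs_of_nonneg hn']
    have h4 : L⁻¹ * lam' t 0 ≤ S.D (q' t) * lam' t 0 :=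
      mul_le_mul_of_nonneg_right ((inv_le_iff_one_le_mul₀' hL0).2 hD') hn'
    linarith
  · obtain ⟨-, hφ⟩ := hcont hp.symm
    have hD := h.bounds.D_lower (q t) hq hp.symm
    have hφb := abs_le.1 (h.bounds.phi_bd (q t) (v t) (u t) 0 hq hv hu)
    have hl : lam t 0 ≤ L ^ 2 := by
      have h4 : lam t 0 ≤ L * S.D (q t) * lam t 0 := le_mul_of_one_le_left hn hD
      have h5 : L * (S.D (q t) * lam t 0) ≤ L * L :=
        mul_le_mul_of_nonneg_left (by linarith) hL0.le
      nlinarith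
    refine ⟨hl, _, hd, ?_⟩
    rw [hφ]
    have hDl := abs_le.1 (h.bounds.D_lip (q t) (q' t) e hq hq' (he t hm).1)
    have h6 : S.D (q' t) * (lam t 0 - lam' t 0) =
        (S.D (q' t) - S.D (q t)) * lam t 0 -
          (S.phitilde (q t) (v t) (u t) 0 - S.phitilde (q' t) (v' t) (u t) 0) := by linarith
    have h7 : |(S.D (q' t) - S.D (q t)) * lam t 0| ≤ L * e * L ^ 2 := by
      rw [abs_mul, abs_of_nonneg hn]
      exact mul_le_mul (abs_le.2 ⟨by linarith, by linarith⟩) hl hn (by positivity)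
    have h8 := abs_le.1 h7
    have hDpos : 0 < S.D (q' t) := S.D_pos hc'
    have h9 : S.D (q' t) * |lam t 0 - lam' t 0| ≤ 2 * L ^ 3 * e := by
      rw [← abs_of_pos hDpos, ← abs_mul, h6]
      refine abs_le.2 ⟨?_, ?_⟩ <;> nlinarith
    have h10 : L⁻¹ * |lam t 0 - lam' t 0| ≤ S.D (q' t) * |lam t 0 - lam' t 0| :=
      mul_le_mul_of_nonneg_right ((inv_le_iff_one_le_mul₀' hL0).2 hD') (abs_nonneg _)
    linarith

/-- The normal velocity of the first motion is zero at both ends, so integrating `normal_ae` lets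
the `O(e)` term bound the force difference. Detachment is covered, as the motion must have come
back. -/
theorem integral_normal_le (h : IsPhasePair S u R L a c q v lam q' v' lam') (hac : a < c)
    (hcon : ∀ t ∈ Ioo a c, S.fc (q' t) = 0) (hend : S.vn (q c) (v c) = 0) {e : ℝ} (he0 : 0 ≤ e)
    (he : ∀ t ∈ Icc a c, ‖q t - q' t‖ ≤ e ∧ ‖v t - v' t‖ ≤ e) :
    ∫ t in a..c, |lam t 0 - lam' t 0| ≤ 3 * L ^ 4 * e * (c - a) := by
  have hL0 : 0 < L := by linarith [h.bounds.one_le]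
  have hi := ((h.fst.lam_int 0).sub (h.snd.lam_int 0)).abs
  have := h.fst.vn_ac.sub_le_integral h.le (k := fun t => 3 * L ^ 3 * e -
    L⁻¹ * |lam t 0 - lam' t 0|) (intervalIntegrable_const.sub (hi.const_mul _))
    (by filter_upwards [h.normal_ae hcon he0 he] with t ht hm using (ht hm).2)
  rw [hend, h.vn_left_eq_zero hac hcon, sub_zero, intervalIntegral.integral_sub
    intervalIntegrable_const (hi.const_mul _), intervalIntegral.integral_const,
    intervalIntegral.integral_const_mul, smul_eq_mul] at this
  have h1 : L⁻¹ * ∫ t in a..c, |lam t 0 - lam' t 0| ≤ (c - a) * (3 * L ^ 3 * e) := by linarith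
  rw [inv_mul_le_iff₀ hL0] at h1
  linarith

/-- It converts the one-sided bound given by monotone friction into a dissipation term in `|p|`,
which an integral estimate can exploit. -/
theorem mul_le_of_friction {D L p k : ℝ} (hL : 1 ≤ L) (hD : 1 ≤ L * D) (hDL : D ≤ L) (hk : 0 ≤ k)
    (hp : p ≤ k) : D * p ≤ 2 * L * k - L⁻¹ * |p| := by
  have hL0 : 0 < L := by linarith
  have h1 : L⁻¹ ≤ D := (inv_le_iff_one_le_mul₀' hL0).2 hD
  have h2 : L⁻¹ ≤ 1 := inv_le_one_of_one_le₀ hL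
  rcases le_total p 0 with h | h
  · rw [abs_of_nonpos h]
    have : 0 ≤ L * k := by positivity
    nlinarith
  · rw [abs_of_nonneg h]
    nlinarith

/-- The modulus of the difference of tangential velocities starts at zero and stays nonnegative. By
monotone friction its slope is at most a multiple of the normal force difference plus `O(e)`, minus
`L⁻¹` times the tangential force difference. -/
theorem integral_tangential_le (h : IsPhasePair S u R L a c q v lam q' v' lam')
    (hcon : ∀ t ∈ Ioo a c, S.fc (q' t) = 0) {e : ℝ} (he0 : 0 ≤ e)
    (he : ∀ t ∈ Icc a c, ‖q t - q' t‖ ≤ e ∧ ‖v t - v' t‖ ≤ e) :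
    ∫ t in a..c, |lam t 1 - lam' t 1| ≤
      L * (2 * L * S.μ * (∫ t in a..c, |lam t 0 - lam' t 0|) +
        L ^ 3 * (1 + S.μ) * e * (c - a)) := by
  have hL := h.bounds.one_le
  have hL0 : 0 < L := by linarith
  have hμ := S.μ_pos
  have hi0 := ((h.fst.lam_int 0).sub (h.snd.lam_int 0)).abs
  have hi1 := ((h.fst.lam_int 1).sub (h.snd.lam_int 1)).abs
  have hw := h.fst.vt_ac.sub h.snd.vt_ac
  have hi2 := (hi0.const_mul (2 * L * S.μ)).add
    (intervalIntegrable_const (c := L ^ 3 * (1 + S.μ) * e))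
  have := hw.abs.sub_le_integral h.le (k := fun t => 2 * L * S.μ * |lam t 0 - lam' t 0| +
      L ^ 3 * (1 + S.μ) * e - L⁻¹ * |lam t 1 - lam' t 1|) (hi2.sub (hi1.const_mul _)) (by
    filter_upwards [hw.ae_hasDerivAt_abs, h.fst.ae_facts, h.snd.ae_facts, h.snd_contact_ae hcon,
      h.normal_ae hcon he0 he, h.fst.friction, h.snd.friction]
      with t habs h1 h2 h3 h4 hf hf' hm
    obtain ⟨-, hd, -, -, hn, hl1⟩ := h1 hm
    obtain ⟨-, hd', -, -, -, -⟩ := h2 hm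
    obtain ⟨hc', -, -⟩ := h3 hm
    obtain ⟨hq, hv⟩ := h.fst_le t hm
    obtain ⟨hq', hv'⟩ := h.snd_le t hm
    have hφl := abs_le.1 (h.bounds.phi_lip (q t) (v t) (q' t) (v' t) (u t) 1 e hq hv hq' hv'
      (h.u_le t hm) (he t hm).1 (he t hm).2)
    have hT' := h.bounds.Dtan_lower (q' t) hq' hc'
    have hTb := h.bounds.Dtan_bd (q' t) hq'
    have hl1' : |lam t 1| ≤ S.μ * L ^ 2 :=
      hl1.trans (mul_le_mul_of_nonneg_left (h4 hm).1 hμ.le)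
    have h5 : |(S.Dtan (q t) - S.Dtan (q' t)) * lam t 1| ≤ L * e * (S.μ * L ^ 2) := by
      rw [abs_mul]
      exact mul_le_mul (h.bounds.Dtan_lip _ _ e hq hq' (he t hm).1) hl1' (abs_nonneg _)
        (by positivity)
    have h5' := abs_le.1 h5
    have hLe : L * e ≤ L ^ 3 * e :=
      mul_le_mul_of_nonneg_right (le_self_pow₀ hL (by norm_num)) he0
    obtain ⟨d, hdd⟩ : ∃ d, d = S.phitilde (q t) (v t) (u t) 1 + S.Dtan (q t) * lam t 1 -
      (S.phitilde (q' t) (v' t) (u t) 1 + S.Dtan (q' t) * lam' t 1) := ⟨_, rfl⟩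
    have hdw : HasDerivAt ((fun s => S.vt (q s) (v s)) - fun s => S.vt (q' s) (v' s)) d t := by
      rw [hdd]
      exact hd.sub hd'
    obtain ⟨hz, hA⟩ := habs (by rwa [uIcc_of_le h.le]) d hdw
    simp only [Pi.sub_apply] at hz hA
    refine ⟨_, hA, ?_⟩
    have h6 : |d - S.Dtan (q' t) * (lam t 1 - lam' t 1)| ≤ L ^ 3 * (1 + S.μ) * e := by
      rw [hdd]
      refine abs_le.2 ⟨?_, ?_⟩ <;> nlinarith
    have h6' := abs_le.1 h6
    have hk : 0 ≤ S.μ * |lam t 0 - lam' t 0| := by positivity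
    rcases lt_trichotomy (S.vt (q t) (v t) - S.vt (q' t) (v' t)) 0 with h0 | h0 | h0
    · have h7 := (hf' hm).sub_le (hf hm) (sub_neg.1 h0)
      rw [abs_sub_comm] at h7
      have h8 := mul_le_of_friction hL hT' hTb hk h7
      rw [abs_sub_comm (lam' t 1)] at h8
      rw [Real.sign_of_neg h0]
      linarith
    -- Where the velocities coincide, friction gives no sign, but the difference of the two slopes
    -- vanishes almost everywhere, so the force difference is itself `O(e)`.
    · have h7 := mul_le_of_friction hL hT' hTb le_rfl
        (neg_nonpos.2 (abs_nonneg (lam t 1 - lam' t 1)))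
      rw [abs_neg, abs_abs] at h7
      have h8 : S.Dtan (q' t) * |lam t 1 - lam' t 1| ≤ L ^ 3 * (1 + S.μ) * e := by
        have := S.Dtan_pos hc'
        rw [hz h0, zero_sub, abs_neg, abs_mul, abs_of_pos this] at h6
        exact h6
      rw [h0, Real.sign_zero, zero_mul]
      have : 0 ≤ L * (S.μ * |lam t 0 - lam' t 0|) := by positivity
      linarith
    · have h7 := (hf hm).sub_le (hf' hm) (sub_pos.1 h0)
      have h8 := mul_le_of_friction hL hT' hTb hk h7
      rw [Real.sign_of_pos h0]
      linarith)
  rw [intervalIntegral.integral_sub hi2 (hi1.const_mul _), intervalIntegral.integral_add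
    (hi0.const_mul _) intervalIntegrable_const, intervalIntegral.integral_const,
    intervalIntegral.integral_const_mul, intervalIntegral.integral_const_mul, smul_eq_mul] at this
  have h0 : ((fun s => S.vt (q s) (v s)) - fun s => S.vt (q' s) (v' s)) a = 0 := by
    simp [h.q_eq, h.v_eq]
  rw [h0, abs_zero, sub_zero] at this
  rw [← inv_mul_le_iff₀ hL0]
  linarith [abs_nonneg (((fun s => S.vt (q s) (v s)) - fun s => S.vt (q' s) (v' s)) c)]

/-- Uniqueness of motions in contact: if the second motion is in contact and the first one returns
to contact without normal velocity at time `c`, they agree up to `c`. -/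
theorem eq_of_contact (h : IsPhasePair S u R L a c q v lam q' v' lam') (hac : a < c)
    (hcon : ∀ t ∈ Ioo a c, S.fc (q' t) = 0) (hend : S.vn (q c) (v c) = 0)
    (hδ : 24 * L ^ 7 * (1 + S.μ) * (c - a) ≤ 1) : ∀ t ∈ Icc a c, q t = q' t ∧ v t = v' t := by
  obtain ⟨e, he0, he, hmax⟩ := h.exists_max
  have hL := h.bounds.one_le
  have hL0 : 0 < L := by linarith
  have hμ := S.μ_pos
  have hca : 0 < c - a := sub_pos.2 hac
  have hi0 := ((h.fst.lam_int 0).sub (h.snd.lam_int 0)).abs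
  have hi1 := ((h.fst.lam_int 1).sub (h.snd.lam_int 1)).abs
  have hN := h.integral_normal_le hac hcon hend he0 he
  have hT := h.integral_tangential_le hcon he0 he
  have hki := ((hi0.add hi1).const_mul L).add
    (intervalIntegrable_const (c := 2 * L ^ 3 * (1 + S.μ) * e))
  have hv : ∀ t ∈ Icc a c, ‖v t - v' t‖ ≤ 12 * L ^ 7 * (1 + S.μ) * e * (c - a) := fun t ht => by
    have := h.norm_v_le hki (by
      filter_upwards [h.fst.ae_facts, h.normal_ae hcon he0 he] with s h1 h2 hm
      obtain ⟨-, -, -, -, h3, h4⟩ := h1 hm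
      obtain ⟨h5, -⟩ := h2 hm
      rw [add_sub_add_comm]
      have e1 := h.bounds.fv_lip _ _ _ _ _ _ (h.fst_le s hm).1
        (h.fst_le s hm).2 (h.snd_le s hm).1 (h.snd_le s hm).2 (h.u_le s hm) (he s hm).1 (he s hm).2
      have e2 := h.bounds.contactAcc_sub_le (h.fst_le s hm).1 (h.snd_le s hm).1 (he s hm).1
        (lam s) (lam' s)
      have e3 : |lam s 0| + |lam s 1| ≤ (1 + S.μ) * L ^ 2 := by
        rw [abs_of_nonneg h3]
        have := mul_le_mul_of_nonneg_left h5 hμ.le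
        linarith
      have e4 : L * e * (|lam s 0| + |lam s 1|) ≤ L * e * ((1 + S.μ) * L ^ 2) :=
        mul_le_mul_of_nonneg_left e3 (by positivity)
      have e5 : L * e ≤ L ^ 3 * e :=
        mul_le_mul_of_nonneg_right (le_self_pow₀ hL (by norm_num)) he0
      have e6 : 0 ≤ L ^ 3 * e * S.μ := by positivity
      refine (norm_add_le _ _).trans ?_
      linarith) ht
    rw [intervalIntegral.integral_add ((hi0.add hi1).const_mul L) intervalIntegrable_const,
      intervalIntegral.integral_const, intervalIntegral.integral_const_mul,
      intervalIntegral.integral_add hi0 hi1, smul_eq_mul] at this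
    refine this.trans ?_
    generalize (∫ t in a..c, |lam t 0 - lam' t 0|) = N at *
    generalize (∫ t in a..c, |lam t 1 - lam' t 1|) = P at *
    obtain ⟨X, hX⟩ : ∃ X, X = e * (c - a) := ⟨_, rfl⟩
    have hX0 : 0 ≤ X := hX ▸ mul_nonneg he0 hca.le
    have h3 : L ^ 3 * X ≤ L ^ 7 * X :=
      mul_le_mul_of_nonneg_right (pow_le_pow_right₀ hL (by norm_num)) hX0
    have h5 : L ^ 5 * X ≤ L ^ 7 * X :=
      mul_le_mul_of_nonneg_right (pow_le_pow_right₀ hL (by norm_num)) hX0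
    have h3' := mul_le_mul_of_nonneg_left h3 hμ.le
    have h5' := mul_le_mul_of_nonneg_left h5 hμ.le
    have h7 : 0 ≤ L ^ 7 * X := by positivity
    have h7' : 0 ≤ S.μ * (L ^ 7 * X) := by positivity
    have a1 : L * N ≤ 3 * (L ^ 5 * X) := by
      have := mul_le_mul_of_nonneg_left hN hL0.le
      calc _ ≤ _ := this
        _ = _ := by rw [hX]; ring
    have a2 : L * P ≤ 6 * (S.μ * (L ^ 7 * X)) + (1 + S.μ) * (L ^ 5 * X) := by
      have h8 : 2 * L ^ 3 * S.μ * N ≤ 2 * L ^ 3 * S.μ * (3 * L ^ 4 * e * (c - a)) :=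
        mul_le_mul_of_nonneg_left hN (by positivity)
      have := mul_le_mul_of_nonneg_left hT hL0.le
      calc _ ≤ _ := this
        _ = 2 * L ^ 3 * S.μ * N + L ^ 5 * (1 + S.μ) * X := by rw [hX]; ring
        _ ≤ 2 * L ^ 3 * S.μ * (3 * L ^ 4 * e * (c - a)) + L ^ 5 * (1 + S.μ) * X := by linarith
        _ = _ := by rw [hX]; ring
    have a3 : (c - a) * (2 * L ^ 3 * (1 + S.μ) * e) = 2 * (L ^ 3 * X) + 2 * (S.μ * (L ^ 3 * X)) := by
      rw [hX]; ring
    have a4 : 12 * L ^ 7 * (1 + S.μ) * e * (c - a) =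
      12 * (L ^ 7 * X) + 12 * (S.μ * (L ^ 7 * X)) := by rw [hX]; ring
    rw [a3, a4]
    linarith
  -- The constant `24` in `hδ` is twice the `12` of `hv`; thus `e ≤ e / 2`, and the maximal
  -- deviation is zero.
  have hhalf : 12 * L ^ 7 * (1 + S.μ) * e * (c - a) ≤ e / 2 := by nlinarith
  have hL7 : 1 ≤ L ^ 7 := one_le_pow₀ hL
  have hq : e * (c - a) ≤ 12 * L ^ 7 * (1 + S.μ) * e * (c - a) := by
    have h1 : 1 ≤ 12 * L ^ 7 * (1 + S.μ) := by nlinarith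
    have h2 : 0 ≤ e * (c - a) := mul_nonneg he0 hca.le
    calc e * (c - a) ≤ 12 * L ^ 7 * (1 + S.μ) * (e * (c - a)) := le_mul_of_one_le_left h2 h1
      _ = _ := by ring
  have he1 : e ≤ e / 2 := hmax _ (by linarith) fun t ht =>
    ⟨(h.norm_q_le he ht).trans (hq.trans hhalf), (hv t ht).trans hhalf⟩
  have he2 : e = 0 := by linarith
  intro t ht
  have := he t ht
  rw [he2] at this
  exact ⟨sub_eq_zero.1 (norm_le_zero_iff.1 this.1), sub_eq_zero.1 (norm_le_zero_iff.1 this.2)⟩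

end IsPhasePair

/-! ### Regularity of solutions of the complementarity system -/

/-- A function that is a primitive of `g` on `[a, c]`. -/
theorem absolutelyContinuousOnInterval_of_eq_integral {F : Type*} [NormedAddCommGroup F]
    [NormedSpace ℝ F] [CompleteSpace F] {f g : ℝ → F} {a c : ℝ} (hac : a ≤ c)
    (hg : IntervalIntegrable g volume a c) (hf : ∀ t ∈ Icc a c, f t = f a + ∫ s in a..t, g s) :
    AbsolutelyContinuousOnInterval f a c ∧ ∀ᵐ t, t ∈ Icc a c → HasDerivAt f (g t) t := by
  constructor
  · refine (absolutelyContinuousOnInterval_integral hg).of_dist_le (K := 1) fun s hs t ht => ?_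
    rw [uIcc_of_le hac] at hs ht
    rw [hf s hs, hf t ht, dist_add_left, one_mul]
  · filter_upwards [hg.ae_hasDerivAt_integral, Measure.ae_ne volume a, Measure.ae_ne volume c]
      with t ht h1 h2 hm
    have hI : Icc a c ∈ 𝓝 t :=
      Icc_mem_nhds (lt_of_le_of_ne hm.1 h1.symm) (lt_of_le_of_ne hm.2 h2)
    have h3 := (ht (by rwa [uIcc_of_le hac]) a left_mem_uIcc).const_add (f a)
    exact h3.congr_of_eventuallyEq (by filter_upwards [hI] with s hs using hf s hs)

/-- A finite set has no points right after a given time. -/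
theorem Finset.exists_gt_forall_le_or_lt (J : Finset ℝ) {t r : ℝ} (hr : t < r) :
    ∃ r', t < r' ∧ r' ≤ r ∧ ∀ k ∈ J, k ≤ t ∨ r' < k := by
  have h : ∀ᶠ s in 𝓝[>] t, ∀ k ∈ J, k ≤ t ∨ s < k := by
    refine (Filter.eventually_all_finset J).2 fun k _ => ?_
    rcases le_or_gt k t with hk | hk
    · exact Eventually.of_forall fun _ => Or.inl hk
    · filter_upwards [nhdsWithin_le_nhds (gt_mem_nhds hk)] with s hs using Or.inr hs
  obtain ⟨s, h1, h2⟩ := (h.and (Ioc_mem_nhdsGT hr)).exists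
  exact ⟨s, h2.1, h2.2, h1⟩

/-- Acceleration without impulses. -/
def CLSTrajectory.acc {n m : ℕ} (x : CLSTrajectory n) (S : PlanarCLS n m)
    (u : ℝ → EuclideanSpace ℝ (Fin m)) (t : ℝ) : EuclideanSpace ℝ (Fin n) :=
  S.fv (x.q t) (x.v t) (u t) + S.contactAcc (x.q t) (x.lam t)

theorem IsSmoothPhase.hasDerivAt_position {n m : ℕ} {S : PlanarCLS n m}
    {u : ℝ → EuclideanSpace ℝ (Fin m)} {a c : ℝ} {q v : ℝ → EuclideanSpace ℝ (Fin n)}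
    {lam : ℝ → Fin 2 → ℝ} (h : IsSmoothPhase S u a c q v lam) {t : ℝ} (ht : t ∈ Ioo a c) :
    HasDerivAt q (v t) t := by
  have hac : a ≤ c := (ht.1.trans ht.2).le
  have hvc : ContinuousOn v (Icc a c) := by
    have := h.v_ac.continuousOn
    rwa [uIcc_of_le hac] at this
  have hvi : IntervalIntegrable v volume a t :=
    (hvc.mono (Icc_subset_Icc_right ht.2.le)).intervalIntegrable_of_Icc ht.1.le
  have h1 := (intervalIntegral.integral_hasDerivAt_right hvi
    ((hvc.mono Ioo_subset_Icc_self).stronglyMeasurableAtFilter isOpen_Ioo t ht)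
    (hvc.continuousAt (Icc_mem_nhds ht.1 ht.2))).const_add (q a)
  refine h1.congr_of_eventuallyEq ?_
  filter_upwards [Ioo_mem_nhds ht.1 ht.2] with s hs
  have h2 := h.mono ⟨hs.1.le, hs.2.le⟩
  rw [(h2.q_ac.integrable_and_integral_eq (g := v) (by
    rw [uIcc_of_le hs.1.le]
    filter_upwards [h2.deriv] with r hr hm using (hr hm).1)).2]
  abel

/-- In contact, the normal velocity vanishes. -/
theorem IsSmoothPhase.vn_eq_zero {n m : ℕ} {S : PlanarCLS n m}
    {u : ℝ → EuclideanSpace ℝ (Fin m)} {a c : ℝ} {q v : ℝ → EuclideanSpace ℝ (Fin n)}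
    {lam : ℝ → Fin 2 → ℝ} (h : IsSmoothPhase S u a c q v lam) {t : ℝ} (ht : t ∈ Ioo a c)
    (h0 : S.fc (q t) = 0) : S.vn (q t) (v t) = 0 := by
  have hmin : IsLocalMin (fun s => S.fc (q s)) t := by
    filter_upwards [Icc_mem_nhds ht.1 ht.2] with s hs
    rw [h0]
    exact h.gap s hs
  exact hmin.hasDerivAt_eq_zero (S.hasDerivAt_fc (h.hasDerivAt_position ht))

namespace IsCLSSolution

variable {n m : ℕ} {S : PlanarCLS n m} {u : ℝ → EuclideanSpace ℝ (Fin m)} {T r : ℝ}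
  {q₀ v₀ : EuclideanSpace ℝ (Fin n)} {x : CLSTrajectory n} (hx : IsCLSSolution S u T q₀ v₀ x)

include hx

theorem continuousOn_q (hr : IntegrableOn x.v (Icc 0 r)) (hr0 : 0 ≤ r) (hrT : r ≤ T) :
    ContinuousOn x.q (Icc 0 r) := by
  have h1 : ContinuousOn (fun t => ∫ s in (0 : ℝ)..t, x.v s) (Icc 0 r) := by
    have := intervalIntegral.continuousOn_primitive_interval (a := 0) (b := r) (f := x.v)
      (by rwa [uIcc_of_le hr0])
    rwa [uIcc_of_le hr0] at this
  exact (continuousOn_const.add h1).congr fun t ht => hx.position t ⟨ht.1, ht.2.trans hrT⟩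

theorem acc_integrable_of_continuousOn {s t : ℝ} (hst : Icc s t ⊆ Icc 0 T)
    (hq : ContinuousOn x.q (Icc s t)) : IntegrableOn (x.acc S u) (Icc s t) := by
  refine (hx.fv_integrable.mono_set hst).add ?_
  have hl := fun i : Fin 2 => integrable_pi_iff.1 (hx.lam_integrable.mono_set hst) i
  simp only [S.contactAcc_eq]
  exact (IntegrableOn.smul_continuousOn (hl 0)
    (S.invM_normal_contDiff.continuous.comp_continuousOn hq) isCompact_Icc).add
    (IntegrableOn.smul_continuousOn (hl 1)
      (S.invM_b_contDiff.continuous.comp_continuousOn hq) isCompact_Icc)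

theorem acc_integrable (hr : IntegrableOn x.v (Icc 0 r)) (hr0 : 0 ≤ r) (hrT : r ≤ T) :
    IntegrableOn (x.acc S u) (Icc 0 r) :=
  hx.acc_integrable_of_continuousOn (Icc_subset_Icc_right hrT) (hx.continuousOn_q hr hr0 hrT)

/-- Velocities between impacts. -/
theorem velocity_of_no_impact (hA : IntegrableOn (x.acc S u) (Icc 0 r)) (hrT : r ≤ T) {s t : ℝ}
    (hs : 0 ≤ s) (hst : s ≤ t) (htr : t ≤ r) (hJ : ∀ k ∈ x.J, k ≤ s ∨ t < k) :
    x.v t = x.v s + ∫ k in s..t, x.acc S u k := by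
  have h1 := hx.velocity t ⟨hs.trans hst, htr.trans hrT⟩
  have h2 := hx.velocity s ⟨hs, hst.trans (htr.trans hrT)⟩
  have hi : ∀ p ∈ Icc 0 r, ∀ k ∈ Icc 0 r, IntervalIntegrable (x.acc S u) volume p k :=
    fun p hp k hk => (hA.mono_set (uIcc_subset_Icc hp hk)).intervalIntegrable
  have h3 := intervalIntegral.integral_add_adjacent_intervals
    (hi 0 ⟨le_rfl, hs.trans (hst.trans htr)⟩ s ⟨hs, hst.trans htr⟩)
    (hi s ⟨hs, hst.trans htr⟩ t ⟨hs.trans hst, htr⟩)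
  have hF : x.J.filter (fun k => k ≤ t) = x.J.filter (fun k => k ≤ s) := by
    refine Finset.filter_congr fun k hk => ⟨fun h => ?_, fun h => h.trans hst⟩
    exact (hJ k hk).resolve_right (not_lt.2 h)
  have e1 : ∀ p, (∫ k in (0 : ℝ)..p, (S.fv (x.q k) (x.v k) (u k) +
    S.contactAcc (x.q k) (x.lam k))) = ∫ k in (0 : ℝ)..p, x.acc S u k := fun p => rfl
  rw [e1, hF, ← h3] at h1
  rw [e1] at h2
  rw [h1, h2]
  abel

theorem smoothPhase (hr : IntegrableOn x.v (Icc 0 r)) (hrT : r ≤ T) {s : ℝ}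
    (hs : 0 ≤ s) (hsr : s ≤ r) (hJ : ∀ k ∈ x.J, k ≤ s ∨ r < k) :
    IsSmoothPhase S u s r x.q x.v x.lam := by
  have hr0 := hs.trans hsr
  have hsub : Icc s r ⊆ Icc 0 r := Icc_subset_Icc_left hs
  have hsubT : Icc s r ⊆ Icc 0 T := Icc_subset_Icc hs hrT
  have hA := hx.acc_integrable hr hr0 hrT
  have hint : ∀ {F : Type} [NormedAddCommGroup F] {f : ℝ → F}, IntegrableOn f (Icc 0 r) →
      IntervalIntegrable f volume s r := fun hf =>
    (hf.mono_set (by rwa [uIcc_of_le hsr])).intervalIntegrable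
  have hq := absolutelyContinuousOnInterval_of_eq_integral (f := x.q) (g := x.v) hsr (hint hr)
    fun t ht => by
      have hi : ∀ p ∈ Icc 0 r, ∀ k ∈ Icc 0 r, IntervalIntegrable x.v volume p k :=
        fun p hp k hk => (hr.mono_set (uIcc_subset_Icc hp hk)).intervalIntegrable
      rw [hx.position t (hsubT ht), hx.position s (hsubT ⟨le_rfl, hsr⟩), add_assoc,
        intervalIntegral.integral_add_adjacent_intervals
          (hi 0 ⟨le_rfl, hr0⟩ s ⟨hs, hsr⟩) (hi s ⟨hs, hsr⟩ t (hsub ht))]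
  have hv := absolutelyContinuousOnInterval_of_eq_integral (f := x.v) (g := x.acc S u) hsr
    (hint hA) fun t ht => hx.velocity_of_no_impact hA hrT hs ht.1 ht.2 fun k hk =>
      (hJ k hk).imp id fun h => ht.2.trans_lt h
  refine ⟨hq.1, hv.1, fun i => hint (integrable_pi_iff.1
    (hx.lam_integrable.mono_set (Icc_subset_Icc_right hrT)) i), ?_, fun t ht => hx.gap_nonneg t (hsubT ht), ?_, ?_⟩
  · filter_upwards [hq.2, hv.2] with t h1 h2 hm using ⟨h1 hm, h2 hm⟩
  · filter_upwards [hx.complementarity] with t h1 hm using (h1 (hsubT hm)).2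
  · filter_upwards [hx.friction] with t h1 hm using h1 (hsubT hm)

/-- Local regularity of velocities extends to the right. -/
theorem exists_extension (hr : IntegrableOn x.v (Icc 0 r)) (hr0 : 0 ≤ r) (hrT : r < T) :
    ∃ r', r < r' ∧ r' ≤ T ∧ IntegrableOn x.v (Icc 0 r') := by
  by_contra! hno
  -- Integrability of the velocity is not part of `IsCLSSolution`. Without it the position integral
  -- is `0` by convention and `q` is constant beyond `r`; then the acceleration is integrable, so
  -- the velocity is continuous up to the next impact and integrable after all.
  have hq : ∀ t ∈ Ioc r T, x.q t = q₀ := fun t ht => by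
    rw [hx.position t ⟨hr0.trans ht.1.le, ht.2⟩, intervalIntegral.integral_undef, add_zero]
    rw [intervalIntegrable_iff_integrableOn_Icc_of_le (hr0.trans ht.1.le)]
    exact hno t ht.1 ht.2
  have hA : IntegrableOn (x.acc S u) (Icc 0 T) := by
    have h1 : IntegrableOn (x.acc S u) (Ioc r T) := by
      have hsub : Ioc r T ⊆ Icc 0 T := fun t ht => ⟨hr0.trans ht.1.le, ht.2⟩
      refine (hx.fv_integrable.mono_set hsub).add ?_
      have hl := fun i : Fin 2 => integrable_pi_iff.1 (hx.lam_integrable.mono_set hsub) i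
      have h2 : IntegrableOn (fun t => x.lam t 0 • S.invM q₀ (S.normal q₀) +
          x.lam t 1 • S.invM q₀ (S.b q₀)) (Ioc r T) :=
        ((hl 0).smul_const _).add ((hl 1).smul_const _)
      refine h2.congr_fun (fun t ht => ?_) measurableSet_Ioc
      simp only
      rw [hq t ht, S.contactAcc_eq]
    have h2 := (hx.acc_integrable hr hr0 hrT.le).union h1
    rwa [Icc_union_Ioc_eq_Icc hr0 hrT.le] at h2
  obtain ⟨r', h1, h2, h3⟩ := Finset.exists_gt_forall_le_or_lt x.J hrT
  refine hno r' h1 h2 ?_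
  have hint : IntervalIntegrable (x.acc S u) volume r r' :=
    (hA.mono_set (by rw [uIcc_of_le h1.le]; exact Icc_subset_Icc hr0 h2)).intervalIntegrable
  have hc := (absolutelyContinuousOnInterval_of_eq_integral (f := x.v) h1.le hint fun t ht =>
    hx.velocity_of_no_impact hA le_rfl hr0 ht.1 (ht.2.trans h2) fun k hk =>
      (h3 k hk).imp id fun h => ht.2.trans_lt h).1.continuousOn
  rw [uIcc_of_le h1.le] at hc
  have := hr.union hc.integrableOn_Icc
  rwa [Icc_union_Icc_eq_Icc hr0 h1.le] at this

/-- The left limit of the velocity. -/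
theorem leftVel_spec (hr : IntegrableOn x.v (Icc 0 r)) (hr0 : 0 ≤ r) (hrT : r ≤ T) :
    (0 < r → Tendsto x.v (𝓝[<] r) (𝓝 (x.leftVel v₀ r))) ∧
    x.v r = x.leftVel v₀ r + if r ∈ x.J then S.contactAcc (x.q r) (x.P r) else 0 := by
  have hA := hx.acc_integrable hr hr0 hrT
  -- The velocity formula with only the impulses strictly before `r`.
  set w := v₀ + (∫ k in (0 : ℝ)..r, x.acc S u k) +
    ∑ s ∈ x.J.filter (fun s => s < r), S.contactAcc (x.q s) (x.P s) with hw
  have hlim : 0 < r → Tendsto x.v (𝓝[<] r) (𝓝 w) := fun hpos => by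
    have h1 : ContinuousOn (fun t => ∫ s in (0 : ℝ)..t, x.acc S u s) (Icc 0 r) := by
      have := intervalIntegral.continuousOn_primitive_interval (a := 0) (b := r)
        (f := x.acc S u) (μ := volume) (by rwa [uIcc_of_le hr0])
      rwa [uIcc_of_le hr0] at this
    have h2 : Tendsto (fun t => ∫ s in (0 : ℝ)..t, x.acc S u s) (𝓝[<] r)
        (𝓝 (∫ s in (0 : ℝ)..r, x.acc S u s)) := by
      have := (h1 r (right_mem_Icc.2 hr0)).tendsto
      rw [← nhdsWithin_Ico_eq_nhdsLT hpos]
      exact this.mono_left (nhdsWithin_mono _ Ico_subset_Icc_self)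
    refine ((h2.const_add v₀).add_const _).congr' ?_
    have h3 : ∀ᶠ s in 𝓝[<] r, ∀ k ∈ x.J, k < r → k ≤ s := by
      refine (Filter.eventually_all_finset x.J).2 fun k _ => ?_
      by_cases hk : k < r
      · filter_upwards [nhdsWithin_le_nhds (lt_mem_nhds hk)] with s hs _ using hs.le
      · exact Eventually.of_forall fun _ h => absurd h hk
    filter_upwards [h3, Ico_mem_nhdsLT hpos] with s hs hm
    have e : x.J.filter (fun k => k ≤ s) = x.J.filter (fun k => k < r) :=
      Finset.filter_congr fun k hk => ⟨fun h => h.trans_lt hm.2, hs k hk⟩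
    rw [hx.velocity s ⟨hm.1, hm.2.le.trans hrT⟩, e]
    rfl
  have hleft : x.leftVel v₀ r = w := by
    unfold CLSTrajectory.leftVel
    split_ifs with h0
    · have hr00 := le_antisymm h0 hr0
      have : x.J.filter (fun s => s < r) = ∅ :=
        Finset.filter_eq_empty_iff.2 fun k hk hlt => by
          have := ((hx.mem_J k).1 hk).1.1
          linarith
      rw [hw, this, hr00]
      simp
    · exact leftLim_eq_of_tendsto (hlim (not_le.1 h0))
  refine ⟨fun hpos => hleft ▸ hlim hpos, ?_⟩
  rw [hleft, hx.velocity r ⟨hr0, hrT⟩, hw]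
  change v₀ + (∫ k in (0 : ℝ)..r, x.acc S u k) + _ = _
  rw [add_assoc (v₀ + _)]
  congr 1
  split_ifs with hJ
  · have e : x.J.filter (fun k => k ≤ r) = insert r (x.J.filter (fun k => k < r)) := by
      ext k
      simp only [Finset.mem_filter, Finset.mem_insert]
      constructor
      · rintro ⟨h1, h2⟩
        rcases h2.eq_or_lt with h | h
        · exact Or.inl h
        · exact Or.inr ⟨h1, h⟩
      · rintro (rfl | h)
        · exact ⟨hJ, le_rfl⟩
        · exact ⟨h.1, h.2.le⟩
    rw [e, Finset.sum_insert (by simp), add_comm]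
  · rw [add_zero]
    refine Finset.sum_congr (Finset.filter_congr fun k hk => ⟨fun h => lt_of_le_of_ne h ?_,
      le_of_lt⟩) fun _ _ => rfl
    rintro rfl
    exact hJ hk

end IsCLSSolution

/-! ### Uniqueness of solutions of the complementarity system -/

/-- Two solutions of the complementarity system, the second one with integrable velocity and
alternating between contact and free flight without accumulation from the right. -/
structure IsCLSPair {n m : ℕ} (S : PlanarCLS n m) (u : ℝ → EuclideanSpace ℝ (Fin m)) (T : ℝ)
    (q₀ v₀ : EuclideanSpace ℝ (Fin n)) (x x' : CLSTrajectory n) : Prop where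
  fst : IsCLSSolution S u T q₀ v₀ x
  snd : IsCLSSolution S u T q₀ v₀ x'
  v_int : IntegrableOn x'.v (Icc 0 T)
  u_bdd : ∃ C, ∀ t ∈ Icc 0 T, ‖u t‖ ≤ C
  alternation : ∀ t ∈ Ico 0 T, (∀ᶠ s in 𝓝[>] t, S.fc (x'.q s) = 0) ∨
    ∀ᶠ s in 𝓝[>] t, 0 < S.fc (x'.q s)

namespace IsCLSPair

variable {n m : ℕ} {S : PlanarCLS n m} {u : ℝ → EuclideanSpace ℝ (Fin m)} {T t : ℝ}
  {q₀ v₀ : EuclideanSpace ℝ (Fin n)} {x x' : CLSTrajectory n} (h : IsCLSPair S u T q₀ v₀ x x')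

include h

/-- Solutions that agree before `t` agree at `t`. -/
theorem agree_at (ht : t ∈ Icc 0 T) (hag : ∀ s ∈ Ico 0 t, x.q s = x'.q s ∧ x.v s = x'.v s) :
    x.q t = x'.q t ∧ x.v t = x'.v t ∧ (t ∈ x.J ↔ t ∈ x'.J) ∧ (t ∈ x.J → x.P t = x'.P t) := by
  have hr' : IntegrableOn x'.v (Icc 0 t) := h.v_int.mono_set (Icc_subset_Icc_right ht.2)
  -- Integrability is inherited from `x'`; the end point does not matter.
  have hr : IntegrableOn x.v (Icc 0 t) := by
    rw [integrableOn_Icc_iff_integrableOn_Ico] at hr' ⊢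
    exact hr'.congr_fun (fun s hs => (hag s hs).2.symm) measurableSet_Ico
  have hq : x.q t = x'.q t := by
    rw [h.fst.position t ht, h.snd.position t ht]
    congr 1
    refine intervalIntegral.integral_congr_ae ?_
    filter_upwards [Measure.ae_ne volume t] with s hs hm
    rw [uIoc_of_le ht.1] at hm
    exact (hag s ⟨hm.1.le, lt_of_le_of_ne hm.2 hs⟩).2
  obtain ⟨h1, h2⟩ := h.fst.leftVel_spec hr ht.1 ht.2
  obtain ⟨h1', h2'⟩ := h.snd.leftVel_spec hr' ht.1 ht.2
  have hw : x.leftVel v₀ t = x'.leftVel v₀ t := by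
    rcases ht.1.eq_or_lt with h0 | h0
    · simp [CLSTrajectory.leftVel, ← h0]
    · refine tendsto_nhds_unique_of_eventuallyEq (h1 h0) (h1' h0) ?_
      filter_upwards [Ico_mem_nhdsLT h0] with s hs using (hag s hs).2
  have hJ : t ∈ x.J ↔ t ∈ x'.J := by rw [h.fst.mem_J, h.snd.mem_J, hq, hw]
  have hP : t ∈ x.J → x.P t = x'.P t := fun hm => by
    have hm' := hJ.1 hm
    rw [if_pos hm] at h2
    rw [if_pos hm', ← hq, ← hw] at h2'
    have e1 := h.fst.impact_normal t hm
    have e2 := h.snd.impact_normal t hm'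
    have e3 := h.fst.impact_friction t hm
    have e4 := h.snd.impact_friction t hm'
    rw [← hq] at e2 e4
    exact S.impact_unique ((h.fst.mem_J t).1 hm).2.1 h2 h2' e1 e2 e3 e4
  refine ⟨hq, ?_, hJ, hP⟩
  rw [h2, h2', hw, hq]
  by_cases hm : t ∈ x.J
  · rw [if_pos hm, if_pos (hJ.1 hm), hP hm]
  · rw [if_neg hm, if_neg (fun hc => hm (hJ.2 hc))]

/-- Agreement on `[0, t]` extends to the right. -/
theorem exists_agree_gt (ht : t ∈ Ico 0 T)
    (hag : ∀ s ∈ Icc 0 t, x.q s = x'.q s ∧ x.v s = x'.v s) {k : ℝ} (hk : t < k) :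
    ∃ c, t < c ∧ c ≤ k ∧ ∀ s ∈ Icc 0 c, x.q s = x'.q s ∧ x.v s = x'.v s := by
  have hμ := S.μ_pos
  suffices ∃ c, t < c ∧ c ≤ k ∧ ∀ s ∈ Icc t c, x.q s = x'.q s ∧ x.v s = x'.v s by
    obtain ⟨c, h1, h2, h3⟩ := this
    refine ⟨c, h1, h2, fun s hs => ?_⟩
    rcases le_total s t with h4 | h4
    · exact hag s ⟨hs.1, h4⟩
    · exact h3 s ⟨h4, hs.2⟩
  have hr : IntegrableOn x.v (Icc 0 t) :=
    (h.v_int.mono_set (Icc_subset_Icc_right ht.2.le)).congr_fun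
      (fun s hs => (hag s hs).2.symm) measurableSet_Icc
  obtain ⟨r₁, h1, h1T, hr₁⟩ := h.fst.exists_extension hr ht.1 ht.2
  -- Impact times are finite in number, so neither solution has one shortly after `t`.
  obtain ⟨r₂, h2, h21, hJ⟩ := Finset.exists_gt_forall_le_or_lt (x.J ∪ x'.J) (lt_min h1 hk)
  have h2T : r₂ ≤ T := (h21.trans (min_le_left _ _)).trans h1T
  have hp := h.fst.smoothPhase (hr₁.mono_set (Icc_subset_Icc_right (h21.trans (min_le_left _ _))))
    h2T ht.1 h2.le fun j hj => hJ j (Finset.mem_union_left _ hj)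
  have hp' := h.snd.smoothPhase (h.v_int.mono_set (Icc_subset_Icc_right h2T))
    h2T ht.1 h2.le fun j hj => hJ j (Finset.mem_union_right _ hj)
  have hbd : ∀ {f : ℝ → EuclideanSpace ℝ (Fin n)}, AbsolutelyContinuousOnInterval f t r₂ →
      ∃ C, ∀ s ∈ Icc t r₂, ‖f s‖ ≤ C := fun hf => by
    have := hf.continuousOn
    rw [uIcc_of_le h2.le] at this
    exact isCompact_Icc.exists_bound_of_continuousOn this
  obtain ⟨C₁, hC₁⟩ := hbd hp.q_ac
  obtain ⟨C₂, hC₂⟩ := hbd hp.v_ac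
  obtain ⟨C₃, hC₃⟩ := hbd hp'.q_ac
  obtain ⟨C₄, hC₄⟩ := hbd hp'.v_ac
  obtain ⟨C₅, hC₅⟩ := h.u_bdd
  obtain ⟨R, hR₁, hR₂, hR₃, hR₄, hR₅⟩ : ∃ R, C₁ ≤ R ∧ C₂ ≤ R ∧ C₃ ≤ R ∧ C₄ ≤ R ∧ C₅ ≤ R :=
    ⟨max C₁ (max C₂ (max C₃ (max C₄ C₅))), by simp, by simp, by simp, by simp, by simp⟩
  obtain ⟨L, hL⟩ := S.exists_hasBounds R
  have hL1 := hL.one_le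
  have hpair : IsPhasePair S u R L t r₂ x.q x.v x.lam x'.q x'.v x'.lam :=
    ⟨h2.le, hp, hp', hL, fun s hs => (hC₅ s ⟨ht.1.trans hs.1, hs.2.trans h2T⟩).trans hR₅,
      fun s hs => ⟨(hC₁ s hs).trans hR₁, (hC₂ s hs).trans hR₂⟩,
      fun s hs => ⟨(hC₃ s hs).trans hR₃, (hC₄ s hs).trans hR₄⟩,
      (hag t ⟨ht.1, le_rfl⟩).1, (hag t ⟨ht.1, le_rfl⟩).2⟩
  have hB : 0 < 24 * L ^ 7 * (1 + S.μ) := by positivity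
  have hsmall : ∀ {p : ℝ → Prop}, (∀ᶠ s in 𝓝[>] t, p s) → ∃ c, t < c ∧ c ≤ r₂ ∧
      24 * L ^ 7 * (1 + S.μ) * (c - t) ≤ 1 ∧ ∀ s ∈ Ioo t c, p s := fun {p} hev => by
    obtain ⟨r₃, h3, h3'⟩ := mem_nhdsGT_iff_exists_Ioo_subset.1 hev
    have h3'' : t < r₃ := h3
    refine ⟨min (min r₂ r₃) (t + 1 / (24 * L ^ 7 * (1 + S.μ))), lt_min (lt_min h2 h3'')
      (by linarith [one_div_pos.2 hB]), (min_le_left _ _).trans (min_le_left _ _), ?_,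
      fun s hs => h3' ⟨hs.1, hs.2.trans_le ((min_le_left _ _).trans (min_le_right _ _))⟩⟩
    have : min (min r₂ r₃) (t + 1 / (24 * L ^ 7 * (1 + S.μ))) - t ≤
        1 / (24 * L ^ 7 * (1 + S.μ)) := sub_le_iff_le_add'.2 (min_le_right _ _)
    rwa [le_div_iff₀' hB] at this
  have hrk : r₂ ≤ k := h21.trans (min_le_right _ _)
  rcases h.alternation t ht with hc | hc
  · obtain ⟨c, h3, h4, h5, h6⟩ := hsmall hc
    have hpc := hpair.mono ⟨h3.le, h4⟩
    -- If `x` touches at `s`, the gap has a minimum there and the normal velocity is zero, as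
    -- `eq_of_contact` on `[t, s]` requires. If `x` never touches, it is the free motion and the
    -- roles are exchanged.
    by_cases hex : ∃ s ∈ Ioo t c, S.fc (x.q s) = 0
    · obtain ⟨s, hs, hs0⟩ := hex
      refine ⟨s, hs.1, hs.2.le.trans (h4.trans hrk), ?_⟩
      refine (hpc.mono ⟨hs.1.le, hs.2.le⟩).eq_of_contact hs.1
        (fun p hp => h6 p ⟨hp.1, hp.2.trans hs.2⟩) (hpc.fst.vn_eq_zero hs hs0) ?_
      refine le_trans (mul_le_mul_of_nonneg_left ?_ hB.le) h5
      linarith [hs.2]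
    · push Not at hex
      refine ⟨c, h3, h4.trans hrk, fun s hs => ?_⟩
      have := hpc.symm.eq_of_free (fun p hp => lt_of_le_of_ne
        (hpc.fst.gap p ⟨hp.1.le, hp.2.le⟩) (hex p hp).symm) h5 s hs
      exact ⟨this.1.symm, this.2.symm⟩
  · obtain ⟨c, h3, h4, h5, h6⟩ := hsmall hc
    exact ⟨c, h3, h4.trans hrk, (hpair.mono ⟨h3.le, h4⟩).eq_of_free h6 h5⟩

/-- Continuous induction: `agree_at` makes the set of times of agreement closed, impacts included,
and `exists_agree_gt` extends it to the right. -/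
theorem agree (hT : 0 ≤ T) : ∀ t ∈ Icc 0 T, x.q t = x'.q t ∧ x.v t = x'.v t := by
  have hat : ∀ t ∈ Icc 0 T, (∀ s ∈ Ico 0 t, x.q s = x'.q s ∧ x.v s = x'.v s) →
      ∀ s ∈ Icc 0 t, x.q s = x'.q s ∧ x.v s = x'.v s := fun t ht hag s hs => by
    rcases hs.2.eq_or_lt with h1 | h1
    · have := h.agree_at ht hag
      rw [h1]
      exact ⟨this.1, this.2.1⟩
    · exact hag s ⟨hs.1, h1⟩
  have hsub : Icc 0 T ⊆ {t | ∀ s ∈ Icc 0 t, x.q s = x'.q s ∧ x.v s = x'.v s} := by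
    refine IsClosed.Icc_subset_of_forall_exists_gt ?_ ?_ ?_
    · refine isClosed_of_closure_subset fun t ht => ?_
      have htT : t ∈ Icc 0 T := closure_minimal inter_subset_right isClosed_Icc ht
      refine ⟨hat t htT fun s hs => ?_, htT⟩
      obtain ⟨p, hp1, hp2⟩ := mem_closure_iff.1 ht (Ioi s) isOpen_Ioi hs.2
      exact hp2.1 s ⟨hs.1, le_of_lt hp1⟩
    · exact hat 0 ⟨le_rfl, hT⟩ fun s hs => absurd hs.2 (not_lt.2 hs.1)
    · rintro t ⟨h1, h2⟩ k hk
      obtain ⟨c, h3, h4, h5⟩ := h.exists_agree_gt h2 h1 hk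
      exact ⟨c, h5, h3, h4⟩
  exact fun t ht => hsub ht t ⟨ht.1, le_rfl⟩

theorem agree_impacts (hT : 0 ≤ T) : x.J = x'.J ∧ ∀ t ∈ x.J, x.P t = x'.P t := by
  have key : ∀ t ∈ Icc 0 T, (t ∈ x.J ↔ t ∈ x'.J) ∧ (t ∈ x.J → x.P t = x'.P t) := fun t ht =>
    (h.agree_at ht fun s hs => h.agree hT s ⟨hs.1, hs.2.le.trans ht.2⟩).2.2
  refine ⟨Finset.ext fun t => ⟨fun ht => ?_, fun ht => ?_⟩, fun t ht => ?_⟩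
  · exact (key t ((h.fst.mem_J t).1 ht).1).1.1 ht
  · exact (key t ((h.snd.mem_J t).1 ht).1).1.2 ht
  · exact (key t ((h.fst.mem_J t).1 ht).1).2 ht

/-- Equal velocities and impulses give equal primitives of the accelerations, hence equal contact
accelerations almost everywhere. These determine the force in contact; off contact it is zero. -/
theorem agree_force (hT : 0 ≤ T) : ∀ᵐ t, t ∈ Icc 0 T → x.lam t = x'.lam t := by
  have hag := h.agree hT
  obtain ⟨hJ, hP⟩ := h.agree_impacts hT
  have hr : IntegrableOn x.v (Icc 0 T) :=
    h.v_int.congr_fun (fun s hs => (hag s hs).2.symm) measurableSet_Icc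
  have hA := h.fst.acc_integrable hr hT le_rfl
  have hA' := h.snd.acc_integrable h.v_int hT le_rfl
  have hint : ∀ t ∈ Icc 0 T,
      ∫ s in (0 : ℝ)..t, x.acc S u s = ∫ s in (0 : ℝ)..t, x'.acc S u s := fun t ht => by
    have h1 := h.fst.velocity t ht
    have h2 := h.snd.velocity t ht
    have h3 : ∑ s ∈ x.J.filter (fun s => s ≤ t), S.contactAcc (x.q s) (x.P s) =
        ∑ s ∈ x'.J.filter (fun s => s ≤ t), S.contactAcc (x'.q s) (x'.P s) := by
      rw [← hJ]
      refine Finset.sum_congr rfl fun s hs => ?_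
      have hs' := (Finset.mem_filter.1 hs).1
      rw [(hag s ((h.fst.mem_J s).1 hs').1).1, hP s hs']
    rw [(hag t ht).2, h2, h3] at h1
    exact (add_left_cancel (add_right_cancel h1)).symm
  have hI : IntervalIntegrable (x.acc S u) volume 0 T :=
    IntegrableOn.intervalIntegrable (by rwa [uIcc_of_le hT])
  have hI' : IntervalIntegrable (x'.acc S u) volume 0 T :=
    IntegrableOn.intervalIntegrable (by rwa [uIcc_of_le hT])
  filter_upwards [hI.ae_hasDerivAt_integral, hI'.ae_hasDerivAt_integral, h.fst.complementarity,
    h.snd.complementarity, h.fst.friction, h.snd.friction, Measure.ae_ne volume 0,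
    Measure.ae_ne volume T] with t h1 h2 h3 h4 h5 h6 hne hne' ht
  have hmem : t ∈ uIcc 0 T := by rwa [uIcc_of_le hT]
  have hnhds : Icc 0 T ∈ 𝓝 t :=
    Icc_mem_nhds (lt_of_le_of_ne ht.1 hne.symm) (lt_of_le_of_ne ht.2 hne')
  have hacc : x.acc S u t = x'.acc S u t := by
    refine (h1 hmem 0 left_mem_uIcc).unique ((h2 hmem 0 left_mem_uIcc).congr_of_eventuallyEq ?_)
    filter_upwards [hnhds] with s hs using hint s hs
  simp only [CLSTrajectory.acc, (hag t ht).1, (hag t ht).2, add_right_inj] at hacc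
  by_cases h0 : S.fc (x'.q t) = 0
  · exact S.contactAcc_injective h0 hacc
  · have hz : ∀ {l : Fin 2 → ℝ} {q v : EuclideanSpace ℝ (Fin n)}, S.fc q ≠ 0 →
        l 0 * S.fc q = 0 → S.MaxDissipation (l 0) (S.vt q v) (l 1) → l = 0 :=
      fun {l q v} hq hl hd => by
        have e0 : l 0 = 0 := (mul_eq_zero.1 hl).resolve_right hq
        have e1 := (S.maxDissipation_iff.1 hd).1
        rw [e0, mul_zero, abs_nonpos_iff] at e1
        funext i
        fin_cases i
        · exact e0
        · exact e1
    rw [hz (by rwa [(hag t ht).1]) (h3 ht).2 (h5 ht), hz h0 (h4 ht).2 (h6 ht)]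

end IsCLSPair

/-! ### Comparison of arbitrary solutions with the unfrozen trajectory -/

namespace IsTFMotion

variable {n m : ℕ} {S : PlanarCLS n m} {aN τf a b : ℝ} {uτ u : ℝ → EuclideanSpace ℝ (Fin m)}
  {y : ℝ → TFState n} (h : IsTFMotion S aN τf uτ u y a b)

include h

/-- Eventual properties right of a numerical time transfer to physical time. -/
theorem eventually_lastTime {t : ℝ} (ht : t ∈ Ico 0 (y τf).2.2) {p : ℝ → Prop}
    (hp : ∀ᶠ τ in 𝓝[>] (lastTime τf y t), p τ) : ∀ᶠ s in 𝓝[>] t, p (lastTime τf y s) := by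
  have htm : t ∈ Icc 0 (y τf).2.2 := ⟨ht.1, ht.2.le⟩
  have hm := h.lastTime_mem t
  have hlt : lastTime τf y t < τf := by
    refine lt_of_le_of_ne hm.2 fun he => ?_
    have := h.time_lastTime htm
    rw [he] at this
    exact ht.2.ne this.symm
  obtain ⟨r, hr, hr'⟩ := mem_nhdsGT_iff_exists_Ioo_subset.1 hp
  have hrt : lastTime τf y t < min r τf := lt_min hr hlt
  obtain ⟨k, hk1, hk2⟩ := exists_between hrt
  have hkm : k ∈ Icc 0 τf := ⟨hm.1.trans hk1.le, (hk2.trans_le (min_le_right _ _)).le⟩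
  have htk : t < (y k).2.2 := by
    by_contra! hle
    exact absurd (h.le_lastTime hkm hle) (not_le.2 hk1)
  filter_upwards [Ioo_mem_nhdsGT htk] with s hs
  have hsm : s ∈ Icc 0 (y τf).2.2 := ⟨ht.1.trans hs.1.le, hs.2.le.trans (h.time_mem hkm).2⟩
  refine hr' ⟨?_, ?_⟩
  · refine lt_of_le_of_ne (h.lastTime_monotone hs.1.le) fun he => ?_
    have := h.time_lastTime hsm
    rw [← he, h.time_lastTime htm] at this
    exact hs.1.ne this
  · refine lt_of_lt_of_le ?_ ((hk2.le).trans (min_le_left _ _))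
    by_contra! hle
    have := h.monotoneOn hkm (h.lastTime_mem s) hle
    simp only [h.time_lastTime hsm] at this
    exact absurd hs.2 (not_lt.2 this)

theorem alternation (hF : S.FinitelyManyContactPhases τf y) {t : ℝ}
    (ht : t ∈ Ico 0 (y τf).2.2) :
    (∀ᶠ s in 𝓝[>] t, S.fc ((unfreeze S aN τf u y a b).q s) = 0) ∨
      ∀ᶠ s in 𝓝[>] t, 0 < S.fc ((unfreeze S aN τf u y a b).q s) := by
  obtain ⟨F, hF⟩ := hF
  have hmem : ∀ s, S.fc ((unfreeze S aN τf u y a b).q s) = 0 ↔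
      lastTime τf y s ∈ ⋃ p ∈ F, Icc p.1 p.2 := fun s => by
    rw [← hF]
    exact ⟨fun h0 => ⟨h.lastTime_mem s, h0⟩, fun h0 => h0.2⟩
  -- Right of any point, a finite union of compact intervals is either full or empty. The strict
  -- inequality discards point intervals and right ends, after which free flight may begin.
  by_cases hex : ∃ p ∈ F, p.1 ≤ lastTime τf y t ∧ lastTime τf y t < p.2
  · obtain ⟨p, hp, h1, h2⟩ := hex
    refine Or.inl ((h.eventually_lastTime ht (p := fun τ => τ ∈ ⋃ p ∈ F, Icc p.1 p.2) ?_).mono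
      fun s hs => (hmem s).2 hs)
    filter_upwards [Ioo_mem_nhdsGT h2] with τ hτ
    exact mem_iUnion₂.2 ⟨p, hp, h1.trans hτ.1.le, hτ.2.le⟩
  · push Not at hex
    refine Or.inr ((h.eventually_lastTime ht (p := fun τ => τ ∉ ⋃ p ∈ F, Icc p.1 p.2) ?_).mono
      fun s hs => lt_of_le_of_ne (h.sol.gap_nonneg h.aN_pos h.τf_pos h.gap_zero _
        (h.lastTime_mem s)) fun h0 => hs ((hmem s).1 h0.symm))
    have : ∀ᶠ τ in 𝓝[>] (lastTime τf y t), ∀ p ∈ F, τ ∉ Icc p.1 p.2 := by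
      refine (Filter.eventually_all_finset F).2 fun p hp => ?_
      rcases lt_or_ge (lastTime τf y t) p.1 with h1 | h1
      · filter_upwards [nhdsWithin_le_nhds (gt_mem_nhds h1)] with τ hτ hc
        exact absurd hc.1 (not_le.2 hτ)
      · filter_upwards [self_mem_nhdsWithin] with τ hτ hc
        exact absurd ((hex p hp h1).trans_lt hτ) (not_lt.2 hc.2)
    filter_upwards [this] with τ hτ hc
    obtain ⟨p, hp, hc⟩ := mem_iUnion₂.1 hc
    exact hτ p hp hc

theorem solutionsRelated (hF : S.FinitelyManyContactPhases τf y) {x : CLSTrajectory n}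
    (hx : IsCLSSolution S u (y τf).2.2 (y 0).1 (y 0).2.1 x) : S.SolutionsRelated aN u τf y x := by
  have hpair : IsCLSPair S u (y τf).2.2 (y 0).1 (y 0).2.1 x (unfreeze S aN τf u y a b) :=
    ⟨hx, h.isCLSSolution, h.v_integrable, h.u_bdd, fun t ht => h.alternation hF ht⟩
  have hT := h.end_nonneg
  obtain ⟨hJ, hP⟩ := hpair.agree_impacts hT
  exact h.solutionsRelated_of_eq hJ hx.lam_integrable (fun t ht => (hpair.agree hT t ht).1)
    (fun t ht => (hpair.agree hT t ht).2) (hpair.agree_force hT) hP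

end IsTFMotion

end

theorem mainTheorem5 {n m : ℕ} (S : PlanarCLS n m) (aN : ℝ) (haN : 0 < aN)
    (τf : ℝ) (hτf : 0 < τf) (q₀ v₀ : EuclideanSpace ℝ (Fin n)) (hq₀ : 0 ≤ S.fc q₀)
    (uτ u : ℝ → EuclideanSpace ℝ (Fin m)) (y : ℝ → TFState n)
    (hy : S.IsTFSolution aN uτ τf y) (hy0 : y 0 = (q₀, v₀, 0))
    (hu_meas : Measurable u) (hu_bdd : ∃ C, ∀ t ∈ Set.Icc 0 (y τf).2.2, ‖u t‖ ≤ C)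
    (hu : ∀ᵐ τ ∂MeasureTheory.volume, τ ∈ Set.Icc 0 τf →
      0 < deriv (fun σ => (y σ).2.2) τ → uτ τ = u (y τ).2.2)
    (hend : 0 ≤ S.fc (y τf).1 ∧ 0 ≤ S.vn (y τf).1 (y τf).2.1)
    (honce : ∀ τ ∈ S.impactSet τf y, ∀ σ ∈ S.impactSet τf y, (y τ).2.2 = (y σ).2.2) :
    (∃ x : CLSTrajectory n, IsCLSSolution S u (y τf).2.2 q₀ v₀ x ∧
      S.SolutionsRelated aN u τf y x) ∧
    (S.FinitelyManyContactPhases τf y →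
      ∀ x : CLSTrajectory n, IsCLSSolution S u (y τf).2.2 q₀ v₀ x →
        S.SolutionsRelated aN u τf y x) := by
  have h00 : 0 ≤ S.fc (y 0).1 := by rw [hy0]; exact hq₀
  obtain ⟨a, b, hphase⟩ := hy.exists_impactPhase haN hτf h00 hend.2 honce
  have h : IsTFMotion S aN τf uτ u y a b :=
    ⟨haN, hτf, hy, h00, by rw [hy0], hu_meas, hu_bdd, hu, hphase⟩
  have e1 : (y 0).1 = q₀ := by rw [hy0]
  have e2 : (y 0).2.1 = v₀ := by rw [hy0]
  rw [← e1, ← e2]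
  refine ⟨⟨_, h.isCLSSolution, ?_⟩, fun hF x hx => h.solutionsRelated hF hx⟩
  exact h.solutionsRelated_of_eq rfl h.lam_integrable (fun _ _ => rfl) (fun _ _ => rfl)
    (Eventually.of_forall fun _ _ => rfl) fun _ _ => rfl
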